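/- Let $G$ be a compact Lie group whose Lie algebra $\mathfrak g$ is semisimple, let $\mathfrak u\subset\mathfrak g$ be a Cartan subalgebra (the Lie algebra of a maximal torus), and let $r=\dim\mathfrak u$ be the rank of $G$. A \emph{Joyce decomposition} of $\mathfrak g$ is a direct sum of vector spaces $$\mathfrak g=\mathfrak b\oplus\bigoplus_{j=1}^n\partial_j\oplus\bigoplus_{j=1}^n\mathfrak f_j$$ such that (1) $\mathfrak b$ is abelian and every $\partial_j$ is a subalgebra isomorphic to $\mathfrak{sp}(1)$ (the imaginary quaternions with the commutator bracket); (2) $\mathfrak u\subset\mathfrak b\oplus\bigoplus_j\partial_j$; (3) with $\mathfrak b_k=\mathfrak b\oplus\bigoplus_{j>k}\partial_j\oplus\bigoplus_{j>k}\mathfrak f_j$ one has $[\mathfrak b_k,\partial_j]=0$ for $k\ge j$; (4) $[\partial_j,\mathfrak f_j]\subset\mathfrak f_j$; (5) the adjoint action of $\partial_j$ on $\mathfrak f_j$ is a direct sum of copies of the irreducible representation $\mathbb C^2=\mathbb H$ of $\mathfrak{sp}(1)$. Then the following hold for every Joyce decomposition. (a) Its summands are pairwise orthogonal for the Killing form of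 $\mathfrak g$. (b) $r\le 2n$. Let $T=T^{2n-r}$ be a torus (a compact connected abelian Lie group) of dimension $2n-r$ with Lie algebra $\mathfrak t=(2n-r)\mathfrak u(1)$, and write $\mathfrak t\oplus\mathfrak g=\mathbb R^n\oplus\bigoplus_j\partial_j\oplus\bigoplus_j\mathfrak f_j$ with $\mathbb R^n=\mathfrak t\oplus\mathfrak b$. For any choice of isomorphisms $\varphi_j:\mathfrak{sp}(1)\to\partial_j$ there is a basis $E_1,\dots,E_n$ of $\mathfrak t\oplus\mathfrak b$ for which the following is true. Let $I_1,I_2,I_3$ be Joyce's endomorphisms of $\mathfrak t\oplus\mathfrak g$: on $\langle E_j\rangle\oplus\partial_j$, identified with $\mathbb H$ by $1\mapsto E_j$ and $\varphi_j$, they are the left multiplications by $i,j,k$ (so $I_1E_j=\varphi_j(i)$, $I_2E_j=\varphi_j(j)$, $I_3E_j=\varphi_j(k)$), and for $v\in\mathfrak f_j$ they are $I_1v=[\varphi_j(i),v]$, $I_2v=[\varphi_j(j),v]$, $I_3v=[\varphi_j(k),v]$. Then there is a negative definite symmetric bilinear form $\hat B$ on $\mathfrak t\oplus\mathfrak g$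 that restricts to the Killing form on $\mathfrak g$, is invariant ($\hat B([x,y],z)=\hat B(x,[y,z])$), is hyper-Hermitian ($\hat B(I_ax,I_ay)=\hat B(x,y)$ for $a=1,2,3$), and for which the decomposition $\mathbb R^n\oplus\bigoplus_j\partial_j\oplus\bigoplus_j\mathfrak f_j$ is orthogonal. (c) With these choices, let $g$ be the metric and $I_1,I_2,I_3$ the endomorphism fields on $T\times G$ obtained by left translation from $-\hat B$ and from $I_1,I_2,I_3$. Then $g$ is a smooth bi-invariant Riemannian metric, $I_1,I_2,I_3$ are smooth with $I_a^2=-1$ and $I_1I_2=I_3=-I_2I_1$, their Nijenhuis tensors vanish, and $g$ is Hermitian for each of them. The left-invariant connection $\nabla$ (the linear connection for which left-invariant vector fields are parallel) exists, is flat, and is an HKT connection for $(T\times G,\{I_1,I_2,I_3\},g)$: it is smooth, $\nabla g=0$, $\nabla I_1=\nabla I_2=\nabla I_3=0$, and $c(X,Y,Z)=g(X,T^\nabla(Y,Z))$, where $T^\nabla$ is the torsion of $\nabla$, is totally skew-symmetric. -/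

import Mathlib

open scoped Manifold ContDiff Quaternion

noncomputable section

/-- A real Lie group of class `C^∞` is in particular of the class needed for its Lie algebra. -/
instance instLEInftyMinSmoothnessReal : ENat.LEInfty (minSmoothness ℝ 3) :=
  ⟨by rw [minSmoothness_of_isRCLikeNormedField]; exact ENat.LEInfty.out⟩

/-! ### The Lie algebra `𝔰𝔭(1)` of imaginary quaternions -/

section Quaternion

attribute [local instance] LieRing.ofAssociativeRing

/-- `𝔰𝔭(1)`: the imaginary quaternions with the commutator bracket. -/
def sp1 : LieSubalgebra ℝ ℍ[ℝ] where
  carrier := {q | q.re = 0}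
  zero_mem' := by simp
  add_mem' := by
    intro a b ha hb
    simp only [Set.mem_ofPred_eq] at ha hb ⊢
    simp [ha, hb]
  smul_mem' := by
    intro c a ha
    simp only [Set.mem_ofPred_eq] at ha ⊢
    simp [ha]
  lie_mem' := by
    intro a b _ _
    simp only [Ring.lie_def, Set.mem_ofPred_eq, Quaternion.re_sub, Quaternion.re_mul]
    ring

instance instLieRingSp1 : LieRing sp1 := inferInstance

instance instLieAlgebraSp1 : LieAlgebra ℝ sp1 := inferInstance

/-- The imaginary part of a quaternion, as an element of `𝔰𝔭(1)`. -/
def sp1Im (q : ℍ[ℝ]) : sp1 := ⟨⟨0, q.imI, q.imJ, q.imK⟩, rfl⟩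

/-- The imaginary units `i, j, k`, indexed by `0, 1, 2`. -/
def imUnit : Fin 3 → sp1 :=
  ![⟨⟨0, 1, 0, 0⟩, rfl⟩, ⟨⟨0, 0, 1, 0⟩, rfl⟩, ⟨⟨0, 0, 0, 1⟩, rfl⟩]

end Quaternion

/-! ### The Joyce decomposition of a real Lie algebra -/

section Joyce

variable {L : Type*} [LieRing L] [LieAlgebra ℝ L] {n : ℕ}

/-- The summands `𝔟`, `∂ⱼ` and `𝔣ⱼ` as one family of subspaces. -/
def joyceSummand (b : Submodule ℝ L) (sp : Fin n → LieSubalgebra ℝ L)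
    (f : Fin n → Submodule ℝ L) : Unit ⊕ Fin n ⊕ Fin n → Submodule ℝ L :=
  Sum.elim (fun _ => b) (Sum.elim (fun j => (sp j).toSubmodule) f)

/-- `𝔟ₖ`, the sum of `𝔟` and of the `∂ⱼ` and `𝔣ⱼ` with `j > k`. As the index `j` starts at `0` here
and at `1` in mathematical writing, the condition `j > k` reads `k ≤ j`. -/
def joyceTail (b : Submodule ℝ L) (sp : Fin n → LieSubalgebra ℝ L)
    (f : Fin n → Submodule ℝ L) (k : ℕ) : Submodule ℝ L :=
  b ⊔ ⨆ j : Fin n, ⨆ _ : k ≤ (j : ℕ), ((sp j).toSubmodule ⊔ f j)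

/-- The adjoint action of the subalgebra `s`, which is isomorphic to `𝔰𝔭(1)`, on the subspace `f`
is a direct sum of copies of the irreducible representation of `𝔰𝔭(1)` of complex dimension two,
that is, of `ℍ = ℂ²` on which `𝔰𝔭(1)` acts by left multiplication. -/
def IsSumOfStandardRep (s : LieSubalgebra ℝ L) (f : Submodule ℝ L) : Prop :=
  ∃ (N : ℕ) (φ : sp1 ≃ₗ⁅ℝ⁆ s) (ψ : (Fin N → ℍ[ℝ]) ≃ₗ[ℝ] f),
    ∀ (q : sp1) (w : Fin N → ℍ[ℝ]),
      ((ψ fun i => (q : ℍ[ℝ]) * w i : f) : L) = ⁅(φ q : L), (ψ w : L)⁆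

/-- A Joyce decomposition `L = 𝔟 ⊕ ⨁ⱼ ∂ⱼ ⊕ ⨁ⱼ 𝔣ⱼ` with respect to the Cartan subalgebra `u`. -/
structure JoyceDecomposition (u : LieSubalgebra ℝ L) (n : ℕ) where
  /-- the summand `𝔟` -/
  b : Submodule ℝ L
  /-- the subalgebras `∂ⱼ` -/
  sp : Fin n → LieSubalgebra ℝ L
  /-- the subspaces `𝔣ⱼ` -/
  f : Fin n → Submodule ℝ L
  isInternal : DirectSum.IsInternal (joyceSummand b sp f)
  b_abelian : ∀ x ∈ b, ∀ y ∈ b, ⁅x, y⁆ = 0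
  sp_equiv : ∀ j, Nonempty (sp1 ≃ₗ⁅ℝ⁆ sp j)
  cartan_le : u.toSubmodule ≤ b ⊔ ⨆ j, (sp j).toSubmodule
  tail_comm : ∀ k ≤ n, ∀ j : Fin n, (j : ℕ) < k →
    ∀ x ∈ joyceTail b sp f k, ∀ y ∈ sp j, ⁅x, y⁆ = 0
  sp_f : ∀ j, ∀ x ∈ sp j, ∀ v ∈ f j, ⁅x, v⁆ ∈ f j
  f_rep : ∀ j, IsSumOfStandardRep (sp j) (f j)

/-- The summands of a Joyce decomposition. -/
def JoyceDecomposition.summand {u : LieSubalgebra ℝ L} (D : JoyceDecomposition u n) :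
    Unit ⊕ Fin n ⊕ Fin n → Submodule ℝ L :=
  joyceSummand D.b D.sp D.f

/-! ### The extended decomposition and Joyce's hypercomplex structure on `V ⊕ L`

Here `V` is the (abelian) Lie algebra of the torus factor. -/

variable {V : Type*} [AddCommGroup V] [Module ℝ V] {u : LieSubalgebra ℝ L}

/-- The subspace `V ⊕ 𝔟` of `V ⊕ L`, which plays the role of `ℝⁿ`. -/
def JoyceDecomposition.euclid (D : JoyceDecomposition u n) (V : Type*) [AddCommGroup V]
    [Module ℝ V] : Submodule ℝ (V × L) :=
  (⊤ : Submodule ℝ V).prod D.b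

/-- The summands of `V ⊕ L = ℝⁿ ⊕ ⨁ⱼ ∂ⱼ ⊕ ⨁ⱼ 𝔣ⱼ`, where `ℝⁿ = V ⊕ 𝔟`. -/
def JoyceDecomposition.extSummand (D : JoyceDecomposition u n) (V : Type*) [AddCommGroup V]
    [Module ℝ V] : Unit ⊕ Fin n ⊕ Fin n → Submodule ℝ (V × L) :=
  Sum.elim (fun _ => D.euclid V)
    (Sum.elim (fun j => (⊥ : Submodule ℝ V).prod (D.sp j).toSubmodule)
      (fun j => (⊥ : Submodule ℝ V).prod (D.f j)))

/-- The identification of the quaternions with `⟨Eⱼ⟩ ⊕ ∂ⱼ` that sends `1` to `Eⱼ` and is `φⱼ` on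
imaginary quaternions. -/
def quatEmbed (D : JoyceDecomposition u n) (φ : ∀ j, sp1 ≃ₗ⁅ℝ⁆ D.sp j)
    (E : Module.Basis (Fin n) ℝ (D.euclid V)) (j : Fin n) (q : ℍ[ℝ]) : V × L :=
  q.re • (E j : V × L) + (0, (φ j (sp1Im q) : L))

/-- `A 0, A 1, A 2` are Joyce's endomorphisms `I₁, I₂, I₃` of `V ⊕ L`: on `⟨Eⱼ⟩ ⊕ ∂ⱼ = ℍ` they are
the left multiplications by `i, j, k` (so that `I₁ Eⱼ = φⱼ(i)`, and so on), and on `𝔣ⱼ` they are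
`v ↦ [φⱼ(i), v]`, `v ↦ [φⱼ(j), v]`, `v ↦ [φⱼ(k), v]`. These conditions determine `A`. -/
structure IsJoyceHypercomplex (D : JoyceDecomposition u n) (φ : ∀ j, sp1 ≃ₗ⁅ℝ⁆ D.sp j)
    (E : Module.Basis (Fin n) ℝ (D.euclid V)) (A : Fin 3 → Module.End ℝ (V × L)) : Prop where
  on_quat : ∀ (a : Fin 3) (j : Fin n) (q : ℍ[ℝ]),
    A a (quatEmbed D φ E j q) = quatEmbed D φ E j ((imUnit a : ℍ[ℝ]) * q)
  on_f : ∀ (a : Fin 3) (j : Fin n), ∀ v ∈ D.f j,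
    A a ((0 : V), v) = ((0 : V), ⁅(φ j (imUnit a) : L), v⁆)

end Joyce

/-- `B` is an extension of the Killing form of `L` to the Lie algebra `V ⊕ L` that is symmetric,
negative definite, invariant, Hermitian for `A 0, A 1, A 2`, and for which the extended Joyce
decomposition is orthogonal. -/
structure IsExtendedKillingForm {L V : Type*} [LieRing L] [LieAlgebra ℝ L]
    [LieRing V] [LieAlgebra ℝ V] {n : ℕ} {u : LieSubalgebra ℝ L} (D : JoyceDecomposition u n)
    (A : Fin 3 → Module.End ℝ (V × L)) (B : LinearMap.BilinForm ℝ (V × L)) : Prop where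
  symm : ∀ x y, B x y = B y x
  neg_def : ∀ x, x ≠ 0 → B x x < 0
  extends_killing : ∀ x y : L, B ((0 : V), x) ((0 : V), y) = killingForm ℝ L x y
  hermitian : ∀ (a : Fin 3) (x y : V × L), B (A a x) (A a y) = B x y
  orthogonal : ∀ i j, i ≠ j → ∀ x ∈ D.extSummand V i, ∀ y ∈ D.extSummand V j, B x y = 0
  invariant : ∀ x y z : V × L, B ⁅x, y⁆ z = B x ⁅y, z⁆

/-! ### Hyper-Hermitian manifolds and HKT connections -/

section Manifold

open Bundle VectorField CovariantDerivative

variable {E : Type*} [NormedAddCommGroup E] [NormedSpace ℝ E]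
  {H : Type*} [TopologicalSpace H] (I : ModelWithCorners ℝ E H)
  {M : Type*} [TopologicalSpace M] [ChartedSpace H M] [IsManifold I 1 M]

/-- `X` is a smooth vector field. -/
def IsSmoothVectorField (X : Π p : M, TangentSpace I p) : Prop :=
  ContMDiff I I.tangent ∞ (fun p => (⟨p, X p⟩ : TangentBundle I M))

/-- `J` is a smooth field of endomorphisms of the tangent spaces. -/
def IsSmoothEndField
    (J : Π p : M, TangentSpace I p →L[ℝ] TangentSpace I p) : Prop :=
  ContMDiff I (I.prod 𝓘(ℝ, E →L[ℝ] E)) ∞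
    (fun p => TotalSpace.mk' (E →L[ℝ] E)
      (E := fun p : M => TangentSpace I p →L[ℝ] TangentSpace I p) p (J p))

/-- The Nijenhuis tensor of `J`, evaluated on vector fields. -/
def nijenhuis (J : Π p : M, TangentSpace I p →L[ℝ] TangentSpace I p)
    (X Y : Π p : M, TangentSpace I p) (p : M) : TangentSpace I p :=
  mlieBracket I (fun q => J q (X q)) (fun q => J q (Y q)) p - mlieBracket I X Y p
    - J p (mlieBracket I (fun q => J q (X q)) Y p) - J p (mlieBracket I X (fun q => J q (Y q)) p)

/-- `J 0, J 1, J 2` is a hypercomplex structure: three integrable complex structures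
`I₁, I₂, I₃` with `I₁ I₂ = I₃ = - I₂ I₁`. -/
structure IsHypercomplex
    (J : Fin 3 → Π p : M, TangentSpace I p →L[ℝ] TangentSpace I p) : Prop where
  smooth : ∀ a, IsSmoothEndField I (J a)
  sq : ∀ (a : Fin 3) (p : M) (v : TangentSpace I p), J a p (J a p v) = -v
  mul : ∀ (p : M) (v : TangentSpace I p), J 0 p (J 1 p v) = J 2 p v
  anticomm : ∀ (p : M) (v : TangentSpace I p), J 1 p (J 0 p v) = -J 2 p v
  integrable : ∀ (a : Fin 3) (X Y : Π p : M, TangentSpace I p),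
    IsSmoothVectorField I X → IsSmoothVectorField I Y → ∀ p, nijenhuis I (J a) X Y p = 0

/-- `(M, J, g)` is a hyper-Hermitian manifold. -/
structure IsHyperHermitian
    (g : ContMDiffRiemannianMetric I ∞ E (TangentSpace I : M → Type _))
    (J : Fin 3 → Π p : M, TangentSpace I p →L[ℝ] TangentSpace I p) : Prop where
  hypercomplex : IsHypercomplex I J
  hermitian : ∀ (a : Fin 3) (p : M) (v w : TangentSpace I p),
    g.inner p (J a p v) (J a p w) = g.inner p v w

/-- The linear connection `D` is a hyper-Kähler connection with torsion (HKT connection) for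
`(M, J, g)`: it is smooth, `D g = 0`, `D Iₐ = 0`, and the tensor `c(X, Y, Z) = g(X, T(Y, Z))`, where
`T` is the torsion of `D`, is totally skew-symmetric.
Note that `D Y p v` is the covariant derivative of `Y` at `p` in the direction `v`. -/
structure IsHKTConnection [FiniteDimensional ℝ E] [CompleteSpace E]
    [IsManifold I 2 M]
    (g : ContMDiffRiemannianMetric I ∞ E (TangentSpace I : M → Type _))
    (J : Fin 3 → Π p : M, TangentSpace I p →L[ℝ] TangentSpace I p)
    (D : CovariantDerivative I E (TangentSpace I : M → Type _)) : Prop where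
  smooth : ContMDiffCovariantDerivative D ∞
  metric : ∀ Y Z : Π p : M, TangentSpace I p,
    IsSmoothVectorField I Y → IsSmoothVectorField I Z → ∀ (p : M) (v : TangentSpace I p),
      mvfderiv I (fun q => g.inner q (Y q) (Z q)) p v =
        g.inner p (D Y p v) (Z p) + g.inner p (Y p) (D Z p v)
  complex : ∀ (a : Fin 3) (Y : Π p : M, TangentSpace I p), IsSmoothVectorField I Y →
    ∀ (p : M) (v : TangentSpace I p), D (fun q => J a q (Y q)) p v = J a p (D Y p v)
  skew_left : ∀ (p : M) (x y z : TangentSpace I p),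
    g.inner p x (D.torsion p y z) = -g.inner p y (D.torsion p x z)
  skew_right : ∀ (p : M) (x y z : TangentSpace I p),
    g.inner p x (D.torsion p y z) = -g.inner p x (D.torsion p z y)

/-- The curvature of the linear connection `D` vanishes. -/
def IsFlatConnection (D : CovariantDerivative I E (TangentSpace I : M → Type _)) : Prop :=
  ∀ X Y Z : Π p : M, TangentSpace I p, IsSmoothVectorField I X → IsSmoothVectorField I Y →
    IsSmoothVectorField I Z → ∀ p : M,
      D (fun q => D Z q (Y q)) p (X p) - D (fun q => D Z q (X q)) p (Y p)
        - D Z p (mlieBracket I X Y p) = 0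

/-- `D` is the left-invariant connection of a Lie group: left-invariant fields are parallel. -/
def IsLeftInvariantConnection [Group M]
    (D : CovariantDerivative I E (TangentSpace I : M → Type _)) : Prop :=
  ∀ (v : GroupLieAlgebra I M) (p : M), D (mulInvariantVectorField v) p = 0

/-- The metric `g` on a Lie group is bi-invariant: left and right translations are isometries. -/
structure IsBiInvariantMetric [Group M]
    (g : ContMDiffRiemannianMetric I ∞ E (TangentSpace I : M → Type _)) : Prop where
  left : ∀ (p q : M) (v w : TangentSpace I q),
    g.inner (p * q) (mfderiv I I (fun x => p * x) q v) (mfderiv I I (fun x => p * x) q w) =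
      g.inner q v w
  right : ∀ (p q : M) (v w : TangentSpace I q),
    g.inner (q * p) (mfderiv I I (fun x => x * p) q v) (mfderiv I I (fun x => x * p) q w) =
      g.inner q v w

end Manifold

/-! ### Left translation on the product of two Lie groups -/

section Product

variable {E₁ E₂ H₁ H₂ : Type*} [NormedAddCommGroup E₁] [NormedSpace ℝ E₁]
  [NormedAddCommGroup E₂] [NormedSpace ℝ E₂] [TopologicalSpace H₁] [TopologicalSpace H₂]
  (I₁ : ModelWithCorners ℝ E₁ H₁) (I₂ : ModelWithCorners ℝ E₂ H₂)
  {G₁ G₂ : Type*} [TopologicalSpace G₁] [ChartedSpace H₁ G₁] [Group G₁]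
  [TopologicalSpace G₂] [ChartedSpace H₂ G₂] [Group G₂]

/-- The left-invariant vector field on `G₁ × G₂` that is given at the identity by `v`, where
`v = (v₁, v₂)` is read as a tangent vector of the product through the differentials of the
inclusions of the two factors. -/
def prodLeftField (v : GroupLieAlgebra I₁ G₁ × GroupLieAlgebra I₂ G₂) (p : G₁ × G₂) :
    TangentSpace (I₁.prod I₂) p :=
  mulInvariantVectorField (I := I₁.prod I₂) (G := G₁ × G₂)
    (mfderiv I₁ (I₁.prod I₂) (fun x : G₁ => (x, (1 : G₂))) 1 v.1 +
      mfderiv I₂ (I₁.prod I₂) (fun y : G₂ => ((1 : G₁), y)) 1 v.2) p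

end Product

end

/-! Left translation reduces everything to algebra in 𝔱 ⊕ 𝔤. It turns vector fields into functions
with values in the Lie algebra, and the Maurer–Cartan equation `mlieBracket_leftField` expresses
their bracket by derivatives of these functions and by the Lie bracket. In this picture the
left-invariant connection is plain differentiation: it is flat, it preserves every left-invariant
tensor, and its torsion is minus the Lie bracket, so total skewness of c is the invariance of the
form. The Nijenhuis tensor of a left-invariant complex structure becomes the algebraic expression
`lieNijenhuis`.

Compactness enters through Haar averaging: an Ad-invariant scalar product on 𝔤 makes every ad x
skew, and since the center vanishes, the Killing form is negative definite
(`killingForm_neg_of_invariant`).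

The algebra rests on one step of the decomposition, the sum of ∂ⱼ, F = 𝔣ⱼ and the tail Q behind
them. The Casimir operator of ∂ⱼ has the eigenvalues -8, -3 and 0 on these summands. It follows that
Q is a subalgebra, [Q, F] ⊂ F and [F, F] ⊂ ∂ⱼ + Q. Invariance of a symmetric form alone makes the
summands orthogonal, which is (a).

For (b), the Cartan subalgebra is 𝔟 plus one line in each ∂ⱼ, so r = dim 𝔟 + n (`finrank_cartan`),
and r ≤ 2n means dim 𝔟 ≤ n. The center of the tail is zero at the start and equals 𝔟 at the end, and
each step enlarges its dimension by at most one: central elements of Q act on F by operators with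
scalar square (`exists_sq_eq_smul`), which forces the space of these actions to have dimension at
most one (`exists_functional`). The Eⱼ are an orthogonal basis of 𝔱 ⊕ 𝔟 scaled to the length of the
units of ∂ⱼ, which makes Joyce's endomorphisms isometries.

Integrability (`nijenhuis_eq_zero`) is checked on generators. The one delicate case is a pair of
vectors in the same 𝔣ⱼ; there the definite invariant form determines [Av, w] + [v, Aw] explicitly
(`lie_A_add`). -/

set_option linter.unusedSectionVars false

/-! ### Vector fields as derivations, and brackets of related fields -/

section Derivation

open Set Filter VectorField Topology

theorem mvfderiv_vector_comp_apply {E H E' H' F M N : Type*} [NormedAddCommGroup E]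
    [NormedSpace ℝ E] [TopologicalSpace H] {I : ModelWithCorners ℝ E H} [NormedAddCommGroup E']
    [NormedSpace ℝ E'] [TopologicalSpace H'] {I' : ModelWithCorners ℝ E' H'}
    [NormedAddCommGroup F] [NormedSpace ℝ F] [TopologicalSpace M] [ChartedSpace H M]
    [TopologicalSpace N] [ChartedSpace H' N] {g : N → F} {f : M → N} {x : M}
    (hg : MDiffAt g (f x)) (hf : MDiffAt f x) (v : TangentSpace I x) :
    mvfderiv I (fun q => g (f q)) x v = mvfderiv I' g (f x) (mfderiv I I' f x v) :=
  mfderiv_comp_apply x hg hf v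

theorem mvfderiv_model_eq_fderiv {E F : Type*} [NormedAddCommGroup E] [NormedSpace ℝ E]
    [NormedAddCommGroup F] [NormedSpace ℝ F] (f : E → F) (x : E) (v : TangentSpace 𝓘(ℝ, E) x) :
    mvfderiv 𝓘(ℝ, E) f x v = fderiv ℝ f x v := by
  rw [← mfderiv_eq_fderiv]; rfl

theorem mvfderiv_congr_of_eventuallyEq {E H F M : Type*} [NormedAddCommGroup E]
    [NormedSpace ℝ E] [TopologicalSpace H] {I : ModelWithCorners ℝ E H}
    [NormedAddCommGroup F] [NormedSpace ℝ F] [TopologicalSpace M] [ChartedSpace H M]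
    {f g : M → F} {x : M} (h : f =ᶠ[𝓝 x] g) (v : TangentSpace I x) :
    mvfderiv I f x v = mvfderiv I g x v :=
  congrArg (fun A : E →L[ℝ] F => A v) h.mfderiv_eq

variable {E : Type*} [NormedAddCommGroup E] [NormedSpace ℝ E] [CompleteSpace E]
  {H : Type*} [TopologicalSpace H] {I : ModelWithCorners ℝ E H} [I.Boundaryless]
  {M : Type*} [TopologicalSpace M] [ChartedSpace H M] [IsManifold I 2 M]
  {F : Type*} [NormedAddCommGroup F] [NormedSpace ℝ F]

/-- The vector field `V` read in the chart at `x`. -/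
noncomputable def chartField (V : Π q : M, TangentSpace I q) (x : M) : E → E :=
  mpullbackWithin 𝓘(ℝ, E) I (extChartAt I x).symm V (range I)

theorem differentiableAt_chartField {V : Π q : M, TangentSpace I q} {x : M}
    (hV : MDiffAt (T% V) x) : DifferentiableAt ℝ (chartField V x) (extChartAt I x x) := by
  have := (mdifferentiableWithinAt_univ.2 hV).differentiableWithinAt_mpullbackWithin_vectorField
  rw [I.range_eq_univ, preimage_univ, inter_univ] at this
  have h2 := differentiableWithinAt_univ.1 this
  unfold chartField
  rw [I.range_eq_univ]
  exact h2

omit [CompleteSpace E] [I.Boundaryless] in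
theorem inverse_mfderivWithin_extChartAt_symm {x q : M} (hq : q ∈ (extChartAt I x).source) :
    (mfderiv[range I] (extChartAt I x).symm (extChartAt I x q)).inverse =
      mfderiv I 𝓘(ℝ, E) (extChartAt I x) q := by
  have h1 := mfderiv_extChartAt_comp_mfderivWithin_extChartAt_symm' (I := I) hq
  have h2 := mfderivWithin_extChartAt_symm_comp_mfderiv_extChartAt' (I := I) hq
  apply ContinuousLinearMap.inverse_eq
  · convert! h2
  · convert! h1

/-- This makes a field and its coordinate expression related by the chart, also at points other than
the center of the chart. -/
theorem mfderiv_extChartAt_chartField (V : Π q : M, TangentSpace I q) {x q : M}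
    (hq : q ∈ (extChartAt I x).source) :
    mfderiv I 𝓘(ℝ, E) (extChartAt I x) q (V q) = chartField V x (extChartAt I x q) := by
  unfold chartField
  rw [mpullbackWithin_apply]
  have h := congrArg (fun A : E →L[ℝ] E => A (V ((extChartAt I x).symm (extChartAt I x q))))
    (inverse_mfderivWithin_extChartAt_symm (I := I) hq)
  refine Eq.trans ?_ h.symm
  rw [(extChartAt I x).left_inv hq]
  rfl

theorem mlieBracket_eq_chart (V W : Π q : M, TangentSpace I q) (x : M) :
    mfderiv I 𝓘(ℝ, E) (extChartAt I x) x (mlieBracket I V W x) =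
      lieBracket ℝ (chartField V x) (chartField W x) (extChartAt I x x) := by
  have h1 : mlieBracket I V W x = (mfderiv% (extChartAt I x) x).inverse
      (id (α := E) (lieBracket ℝ (chartField V x) (chartField W x) (extChartAt I x x))) := by
    rw [← mlieBracketWithin_univ, mlieBracketWithin_apply]
    unfold chartField
    rw [I.range_eq_univ, preimage_univ, inter_univ]
    exact congrArg (fun v : E => (mfderiv I 𝓘(ℝ, E) (extChartAt I x) x).inverse v)
      (congrFun lieBracketWithin_univ _)
  have h3 := isInvertible_mfderiv_extChartAt (I := I) (mem_extChartAt_source (I := I) x)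
  rw [h1]
  obtain ⟨e, he⟩ := h3
  rw [← he, ContinuousLinearMap.inverse_equiv]
  exact e.apply_symm_apply _

/-- A function has the same differential along a field as its coordinate expression. -/
theorem mvfderiv_field_eq {f : M → F} {V : Π q : M, TangentSpace I q} {x q : M}
    (hf : MDiffAt f q) (hq : q ∈ (extChartAt I x).source) :
    mvfderiv I f q (V q) =
      fderiv ℝ (fun y => f ((extChartAt I x).symm y)) (extChartAt I x q)
        (chartField V x (extChartAt I x q)) := by
  have h1 : MDifferentiableAt 𝓘(ℝ, E) I (extChartAt I x).symm (extChartAt I x q) := by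
    have := mdifferentiableWithinAt_extChartAt_symm (I := I) ((extChartAt I x).map_source hq)
    rwa [I.range_eq_univ, mdifferentiableWithinAt_univ] at this
  have hq' : q ∈ (chartAt H x).source := by rwa [extChartAt_source] at hq
  have hf' : MDifferentiableAt I 𝓘(ℝ, F) f ((extChartAt I x).symm (extChartAt I x q)) := by
    rwa [(extChartAt I x).left_inv hq]
  have h2 : f =ᶠ[𝓝 q] fun p => (fun y => f ((extChartAt I x).symm y)) (extChartAt I x p) := by
    filter_upwards [(isOpen_extChartAt_source x).mem_nhds hq] with p hp
    simp only [(extChartAt I x).left_inv hp]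
  rw [mvfderiv_congr_of_eventuallyEq h2,
    mvfderiv_vector_comp_apply (g := fun y => f ((extChartAt I x).symm y))
      (hf'.comp _ h1) (mdifferentiableAt_extChartAt hq'),
    mvfderiv_model_eq_fderiv, mfderiv_extChartAt_chartField V hq]

/-- The differential of a function along a differentiable field is differentiable. -/
theorem mdifferentiableAt_mvfderiv_field {f : M → F} {V : Π q : M, TangentSpace I q} {x : M}
    (hf : ContMDiffAt I 𝓘(ℝ, F) 2 f x) (hV : MDiffAt (T% V) x) :
    MDiffAt (fun q => mvfderiv I f q (V q)) x ∧
    ∀ W : Π q : M, TangentSpace I q, mvfderiv I (fun q => mvfderiv I f q (V q)) x (W x) =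
      fderiv ℝ (fun y => fderiv ℝ (fun y => f ((extChartAt I x).symm y)) y (chartField V x y))
        (extChartAt I x x) (chartField W x (extChartAt I x x)) := by
  set k : E → F := fun y => f ((extChartAt I x).symm y) with hk
  have hkC : ContDiffAt ℝ 2 k (extChartAt I x x) := by
    have h := (contMDiffAt_iff.1 hf).2
    rw [I.range_eq_univ] at h
    exact h.contDiffAt univ_mem
  have hkd : DifferentiableAt ℝ (fun y => fderiv ℝ k y (chartField V x y)) (extChartAt I x x) := by
    have h1 : DifferentiableAt ℝ (fderiv ℝ k) (extChartAt I x x) :=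
      (hkC.fderiv_right (m := 1) (by norm_num)).differentiableAt one_ne_zero
    exact h1.clm_apply (differentiableAt_chartField hV)
  have hev : (fun q => mvfderiv I f q (V q)) =ᶠ[𝓝 x]
      fun q => (fun y => fderiv ℝ k y (chartField V x y)) (extChartAt I x q) := by
    filter_upwards [extChartAt_source_mem_nhds (I := I) x,
      contMDiffAt_iff_contMDiffAt_nhds (by simp) |>.1 (hf.of_le one_le_two)] with q hq hfq
    exact mvfderiv_field_eq (hfq.mdifferentiableAt one_ne_zero) hq
  have hψ : MDiffAt (extChartAt I x) x := mdifferentiableAt_extChartAt (mem_chart_source H x)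
  refine ⟨(MDifferentiableAt.comp x hkd.mdifferentiableAt hψ).congr_of_eventuallyEq hev, ?_⟩
  intro W
  rw [mvfderiv_congr_of_eventuallyEq hev, mvfderiv_vector_comp_apply hkd.mdifferentiableAt hψ,
    mvfderiv_model_eq_fderiv, mfderiv_extChartAt_chartField W (mem_extChartAt_source x)]

/-- The bracket of vector fields is the commutator of derivations. -/
theorem mvfderiv_mlieBracket {f : M → F} {V W : Π q : M, TangentSpace I q} {x : M}
    (hf : ContMDiffAt I 𝓘(ℝ, F) 2 f x) (hV : MDiffAt (T% V) x) (hW : MDiffAt (T% W) x) :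
    mvfderiv I f x (mlieBracket I V W x) =
      mvfderiv I (fun q => mvfderiv I f q (W q)) x (V x) -
        mvfderiv I (fun q => mvfderiv I f q (V q)) x (W x) := by
  have hkC : ContDiffAt ℝ 2 (fun y => f ((extChartAt I x).symm y)) (extChartAt I x x) := by
    have h := (contMDiffAt_iff.1 hf).2
    rw [I.range_eq_univ] at h
    exact h.contDiffAt univ_mem
  rw [(mdifferentiableAt_mvfderiv_field hf hV).2 W, (mdifferentiableAt_mvfderiv_field hf hW).2 V,
    ← fderiv_apply_lieBracket hkC (by simp) (differentiableAt_chartField hW)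
      (differentiableAt_chartField hV), ← mlieBracket_eq_chart,
    mvfderiv_field_eq (V := mlieBracket I V W) (hf.mdifferentiableAt two_ne_zero)
      (mem_extChartAt_source x),
    ← mfderiv_extChartAt_chartField _ (mem_extChartAt_source x)]

variable {E' : Type*} [NormedAddCommGroup E'] [NormedSpace ℝ E'] [CompleteSpace E']
  {H' : Type*} [TopologicalSpace H'] {I' : ModelWithCorners ℝ E' H'} [I'.Boundaryless]
  {N : Type*} [TopologicalSpace N] [ChartedSpace H' N] [IsManifold I' 2 N]

/-- Brackets of related vector fields are related. -/
theorem mfderiv_mlieBracket_of_related {f : M → N} {V W : Π q : M, TangentSpace I q}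
    {V' W' : Π q : N, TangentSpace I' q} {x : M} (hf : ContMDiffAt I I' 2 f x)
    (hV : MDiffAt (T% V) x) (hW : MDiffAt (T% W) x)
    (hV' : MDiffAt (T% V') (f x)) (hW' : MDiffAt (T% W') (f x))
    (hVV : ∀ q, mfderiv I I' f q (V q) = V' (f q))
    (hWW : ∀ q, mfderiv I I' f q (W q) = W' (f q)) :
    mfderiv I I' f x (mlieBracket I V W x) = mlieBracket I' V' W' (f x) := by
  -- The chart at `f x` serves as a single vector-valued test function. Its differential is
  -- injective, so a tangent vector is determined by the derivative of the chart along it, and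
  -- commutators of derivations can be compared instead of brackets.
  have hψ : ContMDiffAt I' 𝓘(ℝ, E') 2 (extChartAt I' (f x)) (f x) := contMDiffAt_extChartAt
  have hφ : ContMDiffAt I 𝓘(ℝ, E') 2 (fun q => extChartAt I' (f x) (f q)) x := hψ.comp x hf
  have key : ∀ {X : Π q : M, TangentSpace I q} {X' : Π q : N, TangentSpace I' q},
      (∀ q, mfderiv I I' f q (X q) = X' (f q)) →
      (fun q => mvfderiv I (fun q => extChartAt I' (f x) (f q)) q (X q)) =ᶠ[𝓝 x]
        fun q => (fun p => mvfderiv I' (extChartAt I' (f x)) p (X' p)) (f q) := by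
    intro X X' hX
    filter_upwards [contMDiffAt_iff_contMDiffAt_nhds (by simp) |>.1 (hf.of_le one_le_two),
      hf.continuousAt.preimage_mem_nhds (extChartAt_source_mem_nhds (I := I') (f x))]
      with q hfq hq
    rw [mvfderiv_vector_comp_apply (mdifferentiableAt_extChartAt (by simpa using hq))
      (hfq.mdifferentiableAt one_ne_zero), hX]
  have hfx := hf.mdifferentiableAt two_ne_zero
  have hinj : ∀ a b : TangentSpace I' (f x), mvfderiv I' (extChartAt I' (f x)) (f x) a =
      mvfderiv I' (extChartAt I' (f x)) (f x) b → a = b := by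
    intro a b hab
    obtain ⟨e, he⟩ := isInvertible_mfderiv_extChartAt (I := I') (mem_extChartAt_source (I := I') (f x))
    apply e.injective
    have h : ∀ c : TangentSpace I' (f x), e c = mvfderiv I' (extChartAt I' (f x)) (f x) c := by
      intro c
      exact congrArg (fun A : E' →L[ℝ] E' => A c) he
    rw [h, h]; exact hab
  apply hinj
  rw [← mvfderiv_vector_comp_apply (hψ.mdifferentiableAt two_ne_zero) hfx,
    mvfderiv_mlieBracket hφ hV hW, mvfderiv_mlieBracket hψ hV' hW',
    mvfderiv_congr_of_eventuallyEq (key hWW), mvfderiv_congr_of_eventuallyEq (key hVV),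
    mvfderiv_vector_comp_apply (mdifferentiableAt_mvfderiv_field hψ hW').1 hfx,
    mvfderiv_vector_comp_apply (mdifferentiableAt_mvfderiv_field hψ hV').1 hfx, hVV, hWW]

end Derivation

/-! ### Smoothness of bundle maps, tested on sections -/

section HomBundle

open Bundle

variable {E : Type*} [NormedAddCommGroup E] [NormedSpace ℝ E]
  {H : Type*} [TopologicalSpace H] {I : ModelWithCorners ℝ E H}
  {M : Type*} [TopologicalSpace M] [ChartedSpace H M]
  {F₁ F₂ : Type*} [NormedAddCommGroup F₁] [NormedSpace ℝ F₁] [FiniteDimensional ℝ F₁]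
  [NormedAddCommGroup F₂] [NormedSpace ℝ F₂] {V₁ V₂ : M → Type*}
  [∀ x, AddCommGroup (V₁ x)] [∀ x, Module ℝ (V₁ x)] [∀ x, TopologicalSpace (V₁ x)]
  [TopologicalSpace (TotalSpace F₁ V₁)] [FiberBundle F₁ V₁] [VectorBundle ℝ F₁ V₁]
  [∀ x, AddCommGroup (V₂ x)] [∀ x, Module ℝ (V₂ x)] [∀ x, TopologicalSpace (V₂ x)]
  [∀ x, IsTopologicalAddGroup (V₂ x)] [∀ x, ContinuousSMul ℝ (V₂ x)]
  [TopologicalSpace (TotalSpace F₂ V₂)] [FiberBundle F₂ V₂] [VectorBundle ℝ F₂ V₂]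

/-- A field of linear maps between the fibres of two vector bundles is smooth at a point if it maps
sections that are smooth at this point to such sections. -/
theorem contMDiffAt_homSection_of_apply {n : ℕ∞ω} [ContMDiffVectorBundle n F₁ V₁ I]
    {φ : Π x : M, V₁ x →L[ℝ] V₂ x} {x₀ : M}
    (h : ∀ Y : Π x : M, V₁ x,
      ContMDiffAt I (I.prod 𝓘(ℝ, F₁)) n (fun x => TotalSpace.mk' F₁ x (Y x)) x₀ →
      ContMDiffAt I (I.prod 𝓘(ℝ, F₂)) n (fun x => TotalSpace.mk' F₂ x (φ x (Y x))) x₀) :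
    ContMDiffAt I (I.prod 𝓘(ℝ, F₁ →L[ℝ] F₂)) n
      (fun x => TotalSpace.mk' (F₁ →L[ℝ] F₂) (E := fun x => V₁ x →L[ℝ] V₂ x) x (φ x)) x₀ := by
  rw [contMDiffAt_hom_bundle]
  refine ⟨contMDiffAt_id, ?_⟩
  let b := Module.finBasis ℝ F₁
  let e := trivializationAt F₁ V₁ x₀
  -- `T` rebuilds a linear map from its columns. The columns of `φ` in coordinates are the images of
  -- the local frame, which are smooth by hypothesis.
  let T : (Fin (Module.finrank ℝ F₁) → F₂) →L[ℝ] (F₁ →L[ℝ] F₂) :=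
    ∑ i, (ContinuousLinearMap.smulRightL ℝ F₁ F₂ (LinearMap.toContinuousLinearMap (b.coord i))).comp
      (ContinuousLinearMap.proj i)
  have hT : ∀ A : F₁ →L[ℝ] F₂, T (fun i => A (b i)) = A := by
    intro A
    ext v
    conv_rhs => rw [← b.sum_repr v, map_sum]
    simp [T]
  have hx₀ : x₀ ∈ e.baseSet := FiberBundle.mem_baseSet_trivializationAt' x₀
  have h1 : ∀ i, ContMDiffAt I 𝓘(ℝ, F₂) n (fun x => ContinuousLinearMap.inCoordinates F₁ V₁ F₂ V₂
      x₀ x x₀ x (φ x) (b i)) x₀ := by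
    intro i
    have h2 := h _ (contMDiffAt_localFrame_of_mem (I := I) n e b i hx₀)
    rw [contMDiffAt_section] at h2
    refine h2.congr_of_eventuallyEq ?_
    filter_upwards [e.open_baseSet.mem_nhds hx₀, (trivializationAt F₂ V₂ x₀).open_baseSet.mem_nhds
      (FiberBundle.mem_baseSet_trivializationAt' x₀)] with x hx hx2
    rw [e.localFrame_apply_of_mem_baseSet (b := b) hx,
      ContinuousLinearMap.inCoordinates_eq hx hx2]
    simp [Bundle.Trivialization.basisAt, e]
  have h3 := (T.contMDiff (n := n)).contMDiffAt.comp x₀ (contMDiffAt_pi_space.2 h1)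
  refine h3.congr_of_eventuallyEq (Filter.Eventually.of_forall fun x => ?_)
  exact (hT _).symm

end HomBundle

/-! ### The left trivialization and the Maurer–Cartan equation -/

section MaurerCartan

open Bundle VectorField Topology Filter

variable {E : Type*} [NormedAddCommGroup E] [NormedSpace ℝ E]
  {H : Type*} [TopologicalSpace H] {I : ModelWithCorners ℝ E H}
  {K : Type*} [TopologicalSpace K] [ChartedSpace H K] [Group K]

/-- The Maurer–Cartan form, with values in the model space. -/
noncomputable def mcForm (I : ModelWithCorners ℝ E H) (p : K) : TangentSpace I p →L[ℝ] E :=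
  mfderiv I I (fun q : K => p⁻¹ * q) p

/-- Left translation of tangent vectors at the identity. -/
noncomputable def leftTrans (I : ModelWithCorners ℝ E H) (p : K) : E →L[ℝ] TangentSpace I p :=
  mfderiv I I (fun q : K => p * q) 1

theorem trivializationAt_self_snd {M : Type*} [TopologicalSpace M] [ChartedSpace H M]
    [IsManifold I 1 M] (x : M) (v : TangentSpace I x) :
    (trivializationAt E (TangentSpace I) x ⟨x, v⟩).2 = v :=
  tangentCoordChange_self (I := I) (mem_extChartAt_source x)

variable [LieGroup I ∞ K]

theorem mcForm_leftTrans (p : K) (v : E) : mcForm I p (leftTrans I p v) = v := by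
  have h : (fun q : K => p⁻¹ * (p * q)) = fun q => q := by ext q; simp
  have h1 : MDiffAt (fun q : K => p⁻¹ * q) (p * 1) :=
    (contMDiff_mul_left (n := ∞)).mdifferentiableAt (by simp)
  have h2 : MDiffAt (fun q : K => p * q) 1 :=
    (contMDiff_mul_left (n := ∞)).mdifferentiableAt (by simp)
  have h3 := mfderiv_comp_apply (1 : K) h1 h2 v
  have h4 : mfderiv I I ((fun q : K => p⁻¹ * q) ∘ (fun q : K => p * q)) 1 v = v := by
    rw [show (fun q : K => p⁻¹ * q) ∘ (fun q : K => p * q) = id from h, mfderiv_id]; rfl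
  rw [h4] at h3
  rw [mul_one] at h3
  exact h3.symm

theorem leftTrans_mcForm (p : K) (v : TangentSpace I p) : leftTrans I p (mcForm I p v) = v := by
  have h : (fun q : K => p * (p⁻¹ * q)) = fun q => q := by ext q; simp
  have h1 : MDiffAt (fun q : K => p⁻¹ * q) p :=
    (contMDiff_mul_left (n := ∞)).mdifferentiableAt (by simp)
  have h2 : MDiffAt (fun q : K => p * q) (p⁻¹ * p) :=
    (contMDiff_mul_left (n := ∞)).mdifferentiableAt (by simp)
  have h3 := mfderiv_comp_apply p h2 h1 v
  have h4 : mfderiv I I ((fun q : K => p * q) ∘ (fun q : K => p⁻¹ * q)) p v = v := by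
    rw [show (fun q : K => p * q) ∘ (fun q : K => p⁻¹ * q) = id from h, mfderiv_id]; rfl
  rw [h4] at h3
  rw [inv_mul_cancel] at h3
  exact h3.symm

theorem tangentBundle_mk_congr {M : Type*} [TopologicalSpace M] [ChartedSpace H M] {a b : M}
    (h : a = b) (v : E) : (TotalSpace.mk' E a v : TangentBundle I M) = TotalSpace.mk' E b v := by
  subst h; rfl

theorem clm_zero_add_apply {F : Type*} [NormedAddCommGroup F] [NormedSpace ℝ F] (A B : F →L[ℝ] F)
    (v : F) : A 0 + B v = B v := by
  rw [map_zero, zero_add]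

/-- The form is the tangent map of `(p, q) ↦ p⁻¹ q` at the pair of the zero vector and `w`. Its
values lie over the identity, where the trivialization of the tangent bundle does not change
vectors. -/
theorem contMDiff_mcForm :
    ContMDiff I.tangent 𝓘(ℝ, E) ∞ (fun w : TangentBundle I K => mcForm I w.1 w.2) := by
  let F₁ : TangentBundle I K → TangentBundle I K × TangentBundle I K :=
    fun w => (TotalSpace.mk' E w.1 0, w)
  have S₁ : ContMDiff I.tangent (I.tangent.prod I.tangent) ∞ F₁ :=
    ((contMDiff_zeroSection ℝ (TangentSpace I : K → Type _)).comp
      (contMDiff_proj (TangentSpace I))).prodMk contMDiff_id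
  have S₂ := contMDiff_equivTangentBundleProd_symm (n := ∞) (I := I) (M := K) (I' := I) (M' := K)
  have hF : ContMDiff (I.prod I) I ∞ (fun p : K × K => p.1⁻¹ * p.2) :=
    contMDiff_fst.inv.mul contMDiff_snd
  have S₃ := hF.contMDiff_tangentMap (m := ∞) le_rfl
  have S := (S₃.comp S₂).comp S₁
  have key : ∀ w : TangentBundle I K,
      ((tangentMap (I.prod I) I (fun p : K × K => p.1⁻¹ * p.2)) ∘
        (equivTangentBundleProd I K I K).symm ∘ F₁) w =
        TotalSpace.mk' E (1 : K) (mcForm I w.1 w.2) := by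
    rintro ⟨q, w⟩
    refine Eq.trans ?_ (tangentBundle_mk_congr (I := I) (inv_mul_cancel q) (mcForm I q w))
    simp only [Function.comp_apply, tangentMap, F₁]
    refine congrArg (TotalSpace.mk' E (q⁻¹ * q)) ?_
    refine (mfderiv_prod_eq_add_apply (hF.mdifferentiableAt (by simp))).trans ?_
    exact clm_zero_add_apply (F := E) (mfderiv I I (fun z : K => z⁻¹ * q) q)
      (mfderiv I I (fun z : K => q⁻¹ * z) q) w
  intro w
  have S' := ((contMDiffAt_totalSpace (x₀ := w)).1
    ((S.congr (fun w => (key w).symm)) w)).2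
  refine S'.congr_of_eventuallyEq (Eventually.of_forall fun w => ?_)
  exact (trivializationAt_self_snd (1 : K) (mcForm I w.1 w.2)).symm

/-- Same device as for the form: this is the tangent map of the multiplication at the pair of a zero
vector and a vector at the identity. -/
theorem contMDiff_leftTrans :
    ContMDiff (I.prod 𝓘(ℝ, E)) I.tangent ∞
      (fun w : K × E => (TotalSpace.mk' E w.1 (leftTrans I w.1 w.2) : TangentBundle I K)) := by
  have hv : ContMDiff 𝓘(ℝ, E) I.tangent ∞
      (fun v : E => (TotalSpace.mk' E (1 : K) v : TangentBundle I K)) := by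
    intro v
    rw [contMDiffAt_totalSpace]
    refine ⟨contMDiffAt_const, contMDiffAt_id.congr_of_eventuallyEq (Eventually.of_forall ?_)⟩
    intro v
    exact trivializationAt_self_snd (1 : K) v
  let F₁ : K × E → TangentBundle I K × TangentBundle I K :=
    fun w => (TotalSpace.mk' E w.1 0, TotalSpace.mk' E 1 w.2)
  have S₁ : ContMDiff (I.prod 𝓘(ℝ, E)) (I.tangent.prod I.tangent) ∞ F₁ :=
    ((contMDiff_zeroSection ℝ (TangentSpace I : K → Type _)).comp contMDiff_fst).prodMk
      (hv.comp contMDiff_snd)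
  have S₂ := contMDiff_equivTangentBundleProd_symm (n := ∞) (I := I) (M := K) (I' := I) (M' := K)
  have hF : ContMDiff (I.prod I) I ∞ (fun p : K × K => p.1 * p.2) := contMDiff_mul I ∞
  have S₃ := hF.contMDiff_tangentMap (m := ∞) le_rfl
  have S := (S₃.comp S₂).comp S₁
  refine S.congr ?_
  rintro ⟨q, w⟩
  refine (tangentBundle_mk_congr (I := I) (mul_one q) (leftTrans I q w)).symm.trans ?_
  simp only [Function.comp_apply, tangentMap, F₁]
  refine congrArg (TotalSpace.mk' E (q * 1)) ?_
  refine Eq.trans ?_ (mfderiv_prod_eq_add_apply (hF.mdifferentiableAt (by simp))).symm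
  exact (clm_zero_add_apply (F := E) (mfderiv I I (fun z : K => z * 1) q)
    (mfderiv I I (fun z : K => q * z) 1) w).symm

/-- The field `q ↦ q · f(q)` that corresponds to a function with values in the Lie algebra. -/
noncomputable def leftField (I : ModelWithCorners ℝ E H) (f : K → E) (q : K) : TangentSpace I q :=
  leftTrans I q (f q)

/-- The function with values in the Lie algebra that corresponds to a vector field. -/
noncomputable def mcFun (X : Π q : K, TangentSpace I q) (q : K) : E := mcForm I q (X q)

theorem leftField_mcFun (X : Π q : K, TangentSpace I q) : leftField I (mcFun X) = X := by
  ext q; exact leftTrans_mcForm q (X q)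

theorem mcFun_leftField (f : K → E) : mcFun (leftField I f) = f := by
  ext q; exact mcForm_leftTrans q (f q)

theorem ContMDiffAt.leftField {f : K → E} {p : K} {n : ℕ∞ω} (hn : n ≤ ∞)
    (hf : ContMDiffAt I 𝓘(ℝ, E) n f p) :
    ContMDiffAt I I.tangent n (T% (leftField I f)) p :=
  ((contMDiff_leftTrans (I := I) (K := K)).of_le hn).contMDiffAt.comp p
    (contMDiffAt_id.prodMk hf)

theorem ContMDiffAt.mcFun {X : Π q : K, TangentSpace I q} {p : K} {n : ℕ∞ω} (hn : n ≤ ∞)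
    (hX : ContMDiffAt I I.tangent n (T% X) p) : ContMDiffAt I 𝓘(ℝ, E) n (mcFun X) p :=
  ((contMDiff_mcForm (I := I) (K := K)).of_le hn).contMDiffAt.comp p hX

theorem MDifferentiableAt.leftField {f : K → E} {p : K} (hf : MDiffAt f p) :
    MDiffAt (T% (leftField I f)) p :=
  MDifferentiableAt.comp p ((contMDiff_leftTrans (I := I) (K := K)).mdifferentiableAt (by simp))
    (mdifferentiableAt_id.prodMk hf)

theorem MDifferentiableAt.mcFun {X : Π q : K, TangentSpace I q} {p : K}
    (hX : MDiffAt (T% X) p) : MDiffAt (mcFun X) p :=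
  MDifferentiableAt.comp p ((contMDiff_mcForm (I := I) (K := K)).mdifferentiableAt (by simp)) hX

/-- Differentiability of the sum is carried along because the induction needs it to apply additivity
of the bracket. -/
theorem mlieBracket_sum_smul_right [CompleteSpace E] {ι : Type*} (s : Finset ι)
    (V : Π q : K, TangentSpace I q) {g : ι → K → ℝ} {W : ι → Π q : K, TangentSpace I q} {p : K}
    (hg : ∀ i, MDiffAt (g i) p) (hW : ∀ i, MDiffAt (T% (W i)) p) :
    mlieBracket I V (∑ i ∈ s, g i • W i) p =
      ∑ i ∈ s, (mvfderiv I (g i) p (V p) • W i p + g i p • mlieBracket I V (W i) p) ∧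
    MDiffAt (T% (∑ i ∈ s, g i • W i)) p := by
  classical
  induction s using Finset.induction_on with
  | empty =>
    refine ⟨by simp, ?_⟩
    exact mdifferentiableAt_zeroSection ..
  | insert i s hi ih =>
    simp only [Finset.sum_insert hi]
    have h := (hg i).smul_section (hW i)
    refine ⟨?_, mdifferentiableAt_add_section h ih.2⟩
    rw [mlieBracket_add_right h ih.2, ih.1, mlieBracket_smul_right (hg i) (hW i)]

variable [CompleteSpace E]

/-- The bracket of the model space that corresponds to the one of the Lie algebra of `K`. -/
noncomputable def bracketE (I : ModelWithCorners ℝ E H) (K : Type*) [TopologicalSpace K]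
    [ChartedSpace H K] [Group K] [LieGroup I ∞ K] : E →ₗ[ℝ] E →ₗ[ℝ] E :=
  LinearMap.mk₂ ℝ (fun v w => Bracket.bracket (L := GroupLieAlgebra I K) (M := GroupLieAlgebra I K) v w)
    (fun u v w => add_lie (L := GroupLieAlgebra I K) (M := GroupLieAlgebra I K) u v w)
    (fun c v w => smul_lie (R := ℝ) (L := GroupLieAlgebra I K) (M := GroupLieAlgebra I K) c v w)
    (fun u v w => lie_add (L := GroupLieAlgebra I K) (M := GroupLieAlgebra I K) u v w)
    (fun c v w => lie_smul (R := ℝ) (L := GroupLieAlgebra I K) (M := GroupLieAlgebra I K) c v w)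

theorem mlieBracket_leftTrans (v w : E) :
    mlieBracket I (fun q : K => leftTrans I q v) (fun q : K => leftTrans I q w) =
      fun q => leftTrans I q (bracketE I K v w) :=
  (mulInvariantVector_mlieBracket (I := I) (G := K) v w).symm

theorem mdifferentiableAt_leftTrans (v : E) (p : K) :
    MDiffAt (T% (fun q : K => leftTrans I q v)) p :=
  MDifferentiableAt.leftField (mdifferentiableAt_const (c := v))

variable [FiniteDimensional ℝ E]

/-- Left-invariant fields form a global frame, so the Leibniz rule reduces statements on general
fields to left-invariant ones. -/
theorem leftField_eq_sum (f : K → E) :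
    leftField I f = ∑ i, (fun q => (Module.finBasis ℝ E).coord i (f q)) •
      (fun q => leftTrans I q (Module.finBasis ℝ E i)) := by
  ext q
  rw [Finset.sum_apply]
  conv_lhs => rw [leftField, ← (Module.finBasis ℝ E).sum_repr (f q), map_sum]
  exact Finset.sum_congr rfl fun i _ => map_smul _ _ _

theorem mdifferentiableAt_coord {f : K → E} {p : K} (hf : MDiffAt f p)
    (i : Fin (Module.finrank ℝ E)) :
    MDiffAt (fun q => (Module.finBasis ℝ E).coord i (f q)) p ∧
    ∀ v, mvfderiv I (fun q => (Module.finBasis ℝ E).coord i (f q)) p v =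
      (Module.finBasis ℝ E).coord i (mvfderiv I f p v) := by
  let c : E →L[ℝ] ℝ := LinearMap.toContinuousLinearMap ((Module.finBasis ℝ E).coord i)
  have hc : MDiffAt c (f p) := c.differentiableAt.mdifferentiableAt
  refine ⟨hc.comp p hf, fun v => ?_⟩
  refine (mvfderiv_vector_comp_apply hc hf v).trans ?_
  rw [mvfderiv_model_eq_fderiv, c.fderiv]
  rfl

theorem mlieBracket_leftField_right (X : Π q : K, TangentSpace I q) {g : K → E} {p : K}
    (hg : MDiffAt g p) :
    mlieBracket I X (leftField I g) p = leftTrans I p (mvfderiv I g p (X p)) +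
      ∑ i, (Module.finBasis ℝ E).coord i (g p) •
        mlieBracket I X (fun q : K => leftTrans I q (Module.finBasis ℝ E i)) p := by
  rw [leftField_eq_sum g, (mlieBracket_sum_smul_right Finset.univ X
    (fun i => (mdifferentiableAt_coord hg i).1)
    (fun i => mdifferentiableAt_leftTrans _ p)).1,
    Finset.sum_add_distrib]
  congr 1
  conv_rhs => rw [← (Module.finBasis ℝ E).sum_repr (mvfderiv I g p (X p)), map_sum]
  refine Finset.sum_congr rfl fun i _ => ?_
  rw [(mdifferentiableAt_coord hg i).2, map_smul]; rfl

theorem mlieBracket_leftTrans_leftField (v : E) {g : K → E} {p : K} (hg : MDiffAt g p) :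
    mlieBracket I (fun q : K => leftTrans I q v) (leftField I g) p =
      leftTrans I p (mvfderiv I g p (leftTrans I p v) + bracketE I K v (g p)) := by
  rw [mlieBracket_leftField_right _ hg, map_add]
  congr 1
  conv_rhs => rw [← (Module.finBasis ℝ E).sum_repr (g p), map_sum, map_sum]
  refine Finset.sum_congr rfl fun i _ => ?_
  rw [mlieBracket_leftTrans, map_smul, map_smul]; rfl

/-- The Maurer–Cartan equation. -/
theorem mlieBracket_leftField {f g : K → E} {p : K} (hf : MDiffAt f p) (hg : MDiffAt g p) :
    mlieBracket I (leftField I f) (leftField I g) p =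
      leftTrans I p (mvfderiv I g p (leftTrans I p (f p)) - mvfderiv I f p (leftTrans I p (g p)) +
        bracketE I K (f p) (g p)) := by
  have hskew : ∀ v w : E, bracketE I K v w = - bracketE I K w v := fun v w =>
    (lie_skew (L := GroupLieAlgebra I K) v w).symm
  have h : ∀ w : E, mlieBracket I (leftField I f) (fun q : K => leftTrans I q w) p =
      leftTrans I p (bracketE I K (f p) w - mvfderiv I f p (leftTrans I p w)) := by
    intro w
    rw [mlieBracket_swap_apply, mlieBracket_leftTrans_leftField w hf, hskew, ← map_neg]
    congr 1; abel
  rw [mlieBracket_leftField_right _ hg, sub_add_eq_add_sub, add_sub_assoc, map_add]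
  congr 1
  -- The bracket with the left-invariant field of `w` is linear in `w`, so the sum over the frame
  -- collapses to the value of `A` at `g p`.
  let A : E →ₗ[ℝ] TangentSpace I p := (leftTrans I p).toLinearMap.comp
    (bracketE I K (f p) - ((mvfderiv I f p).comp (leftTrans I p)).toLinearMap)
  have hA : ∀ w, A w = leftTrans I p (bracketE I K (f p) w - mvfderiv I f p (leftTrans I p w)) :=
    fun w => rfl
  rw [← hA]
  conv_rhs => rw [← (Module.finBasis ℝ E).sum_repr (g p), map_sum]
  refine Finset.sum_congr rfl fun i _ => ?_
  rw [h, ← hA, map_smul]; rfl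

end MaurerCartan

/-! ### Left-invariant metrics, endomorphism fields and connections -/

section LeftInvariant

open Bundle VectorField Topology Filter

variable {E : Type*} [NormedAddCommGroup E] [NormedSpace ℝ E] [CompleteSpace E]
  [FiniteDimensional ℝ E]
  {H : Type*} [TopologicalSpace H] {I : ModelWithCorners ℝ E H}
  {K : Type*} [TopologicalSpace K] [ChartedSpace H K] [Group K] [LieGroup I ∞ K]

/-- By compactness `B v v` has a positive minimum on the unit sphere, so the sublevel set lies in a
ball. -/
theorem bounded_of_posDef (B : E →L[ℝ] E →L[ℝ] ℝ) (hB : ∀ v, v ≠ 0 → 0 < B v v) :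
    Bornology.IsVonNBounded ℝ {v : E | B v v < 1} := by
  rw [NormedSpace.isVonNBounded_iff, isBounded_iff_forall_norm_le]
  rcases subsingleton_or_nontrivial E with hE | hE
  · exact ⟨0, fun v _ => by rw [Subsingleton.elim v 0, norm_zero]⟩
  obtain ⟨w, hw, hmin⟩ := (isCompact_sphere (0 : E) 1).exists_isMinOn
    (NormedSpace.sphere_nonempty.2 zero_le_one) (f := fun v => B v v)
    (B.continuous.clm_apply continuous_id).continuousOn
  have hw0 : w ≠ 0 := by rintro rfl; simp at hw
  have hpos := hB w hw0
  -- The square of the norm is at most `1 / B w w`, and `2‖v‖ ≤ 1 + ‖v‖²` gives a bound without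
  -- square roots.
  refine ⟨1 + 1 / B w w, fun v hv => ?_⟩
  rcases eq_or_ne v 0 with rfl | hv0
  · simp only [norm_zero]; positivity
  have hn : 0 < ‖v‖ := norm_pos_iff.2 hv0
  have h1 : B w w ≤ B (‖v‖⁻¹ • v) (‖v‖⁻¹ • v) := hmin (by simp [norm_smul, hn.ne'])
  simp only [map_smul, smul_apply, smul_eq_mul] at h1
  have h2 : B w w * ‖v‖ ^ 2 ≤ B v v := by
    have := mul_le_mul_of_nonneg_right h1 (sq_nonneg ‖v‖)
    refine this.trans (le_of_eq ?_)
    field_simp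
  have h3 : ‖v‖ ^ 2 ≤ 1 / B w w := by
    rw [le_div_iff₀ hpos, mul_comm]; exact h2.trans (le_of_lt hv)
  nlinarith [sq_nonneg (‖v‖ - 1)]

/-- The field of endomorphisms obtained by left translation from an endomorphism of the Lie
algebra. -/
noncomputable def leftEnd (I : ModelWithCorners ℝ E H) (A : E →L[ℝ] E) (p : K) :
    TangentSpace I p →L[ℝ] TangentSpace I p :=
  ((leftTrans I p).comp A).comp (mcForm I p)

theorem leftEnd_leftTrans (A : E →L[ℝ] E) (p : K) (v : E) :
    leftEnd I A p (leftTrans I p v) = leftTrans I p (A v) := by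
  change leftTrans I p (A (mcForm I p (leftTrans I p v))) = _
  rw [mcForm_leftTrans]

theorem leftEnd_field (A : E →L[ℝ] E) (X : Π p : K, TangentSpace I p) :
    (fun p => leftEnd I A p (X p)) = leftField I (fun p => A (mcFun X p)) := rfl

theorem isSmoothEndField_leftEnd (A : E →L[ℝ] E) :
    IsSmoothEndField I (M := K) (leftEnd I A) := by
  intro p
  apply contMDiffAt_homSection_of_apply
  intro Y hY
  exact ContMDiffAt.leftField le_rfl (A.contMDiff.contMDiffAt.comp p (ContMDiffAt.mcFun le_rfl hY))

theorem mvfderiv_clm_comp {F G M : Type*} [NormedAddCommGroup F] [NormedSpace ℝ F]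
    [NormedAddCommGroup G] [NormedSpace ℝ G] [TopologicalSpace M] [ChartedSpace H M]
    (A : F →L[ℝ] G) {f : M → F} {p : M} (hf : MDiffAt f p) :
    MDiffAt (fun q => A (f q)) p ∧
    ∀ v, mvfderiv I (fun q => A (f q)) p v = A (mvfderiv I f p v) := by
  have hA : MDiffAt A (f p) := A.differentiableAt.mdifferentiableAt
  refine ⟨hA.comp p hf, fun v => ?_⟩
  refine (mvfderiv_vector_comp_apply hA hf v).trans ?_
  rw [mvfderiv_model_eq_fderiv, A.fderiv]
  rfl

theorem mvfderiv_bilin {F F' G M : Type*} [NormedAddCommGroup F] [NormedSpace ℝ F]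
    [NormedAddCommGroup F'] [NormedSpace ℝ F']
    [NormedAddCommGroup G] [NormedSpace ℝ G] [TopologicalSpace M] [ChartedSpace H M]
    (B : F →L[ℝ] F' →L[ℝ] G) {f : M → F} {g : M → F'} {p : M} (hf : MDiffAt f p)
    (hg : MDiffAt g p) (v : TangentSpace I p) :
    mvfderiv I (fun q => B (f q) (g q)) p v =
      B (mvfderiv I f p v) (g p) + B (f p) (mvfderiv I g p v) := by
  have hb := B.hasFDerivAt_of_bilinear (hasFDerivAt_fst (p := (f p, g p))) hasFDerivAt_snd
  have hd := hf.prodMk_space hg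
  have h1 : MDifferentiableAt 𝓘(ℝ, F × F') 𝓘(ℝ, G) (fun w : F × F' => B w.1 w.2) (f p, g p) :=
    hb.differentiableAt.mdifferentiableAt
  have h2 : mvfderiv I (fun q => (f q, g q)) p v = (mvfderiv I f p v, mvfderiv I g p v) := by
    have e1 := (mvfderiv_clm_comp (I := I) (ContinuousLinearMap.fst ℝ F F') hd).2 v
    have e2 := (mvfderiv_clm_comp (I := I) (ContinuousLinearMap.snd ℝ F F') hd).2 v
    exact Prod.ext e1.symm e2.symm
  refine (mvfderiv_vector_comp_apply (f := fun q => (f q, g q)) h1 hd v).trans ?_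
  rw [mvfderiv_model_eq_fderiv, hb.fderiv]
  refine (congrArg (fun w : F × F' => B (f p) w.2 + B w.1 (g p)) h2).trans ?_
  exact add_comm _ _

theorem IsSmoothVectorField.mdifferentiableAt {X : Π p : K, TangentSpace I p}
    (hX : IsSmoothVectorField I X) (p : K) : MDiffAt (T% X) p :=
  (hX p).mdifferentiableAt (by simp)

/-- After the Maurer–Cartan equation is inserted in the four brackets, the derivative terms cancel
because `A` is constant in the left trivialization and squares to -1. What remains is the algebraic
condition at the values of the two fields. -/
theorem nijenhuis_leftEnd_eq_zero (A : E →L[ℝ] E) (hA : ∀ v, A (A v) = -v)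
    (hN : ∀ v w : E, bracketE I K (A v) (A w) - bracketE I K v w - A (bracketE I K (A v) w) -
      A (bracketE I K v (A w)) = 0)
    {X Y : Π p : K, TangentSpace I p} {p : K} (hX : MDiffAt (T% X) p) (hY : MDiffAt (T% Y) p) :
    nijenhuis I (leftEnd I A) X Y p = 0 := by
  have hx := MDifferentiableAt.mcFun hX
  have hy := MDifferentiableAt.mcFun hY
  have hax := mvfderiv_clm_comp (I := I) A hx
  have hay := mvfderiv_clm_comp (I := I) A hy
  unfold nijenhuis
  simp only [leftEnd_field]
  have hX' := leftField_mcFun X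
  have hY' := leftField_mcFun Y
  set x := mcFun X
  set y := mcFun Y
  rw [← hX', ← hY', mlieBracket_leftField hax.1 hay.1, mlieBracket_leftField hx hy,
    mlieBracket_leftField hax.1 hy, mlieBracket_leftField hx hay.1, leftEnd_leftTrans,
    leftEnd_leftTrans, ← map_sub, ← map_sub, ← map_sub, hax.2, hay.2, hax.2, hay.2]
  convert map_zero (leftTrans I p) using 2
  simp only [map_add, map_sub, hA]
  rw [← hN (x p) (y p)]
  abel

/-- The metric obtained by left translation from a scalar product on the Lie algebra. -/
noncomputable def leftMetric (I : ModelWithCorners ℝ E H) (K : Type*) [TopologicalSpace K]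
    [ChartedSpace H K] [Group K] [LieGroup I ∞ K] (B : E →L[ℝ] E →L[ℝ] ℝ)
    (hs : ∀ v w, B v w = B w v) (hB : ∀ v, v ≠ 0 → 0 < B v v) :
    ContMDiffRiemannianMetric I ∞ E (TangentSpace I : K → Type _) where
  inner p := (ContinuousLinearMap.precomp ℝ (mcForm I p)).comp (B.comp (mcForm I p))
  symm p v w := hs _ _
  pos p v hv := by
    apply hB
    intro h
    apply hv
    rw [← leftTrans_mcForm p v]
    exact (congrArg (leftTrans I p) h).trans (map_zero _)
  isVonNBounded p := by
    refine ((bounded_of_posDef B hB).image (leftTrans I p)).subset ?_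
    intro v hv
    exact ⟨mcForm I p v, hv, leftTrans_mcForm p v⟩
  contMDiff p := by
    apply contMDiffAt_homSection_of_apply
    intro X hX
    apply contMDiffAt_homSection_of_apply
    intro Y hY
    rw [contMDiffAt_totalSpace]
    exact ⟨contMDiffAt_id, (B.contMDiff.contMDiffAt.comp p (ContMDiffAt.mcFun le_rfl hX)).clm_apply
      (ContMDiffAt.mcFun le_rfl hY)⟩

theorem leftMetric_inner (B : E →L[ℝ] E →L[ℝ] ℝ)
    (hs : ∀ v w, B v w = B w v) (hB : ∀ v, v ≠ 0 → 0 < B v v) (p : K) (v w : TangentSpace I p) :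
    (leftMetric I K B hs hB).inner p v w = B (mcForm I p v) (mcForm I p w) := rfl

/-- The left-invariant connection. -/
noncomputable def leftConnection (I : ModelWithCorners ℝ E H) (K : Type*) [TopologicalSpace K]
    [ChartedSpace H K] [Group K] [LieGroup I ∞ K] :
    CovariantDerivative I E (TangentSpace I : K → Type _) where
  toFun Y p := (leftTrans I p).comp (mvfderiv I (mcFun Y) p)
  isCovariantDerivativeOnUniv :=
    { add := by
        intro σ σ' p hσ hσ' _
        have h : mcFun (σ + σ') = mcFun σ + mcFun σ' := by
          ext q; exact map_add (mcForm I q) _ _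
        rw [h, mvfderiv_add (MDifferentiableAt.mcFun hσ) (MDifferentiableAt.mcFun hσ'),
          ContinuousLinearMap.comp_add]
      leibniz := by
        intro σ g p hσ hg _
        have h : mcFun (g • σ) = g • mcFun σ := by
          ext q; exact map_smul (mcForm I q) _ _
        rw [h, mvfderiv_smul hg (MDifferentiableAt.mcFun hσ)]
        ext v
        simp only [ContinuousLinearMap.comp_apply, add_apply,
          smul_apply, ContinuousLinearMap.smulRight_apply, map_add, map_smul]
        congr 2
        exact leftTrans_mcForm p (σ p) }

theorem leftConnection_apply (Y : Π p : K, TangentSpace I p) (p : K) (v : TangentSpace I p) :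
    leftConnection I K Y p v = leftTrans I p (mvfderiv I (mcFun Y) p v) := rfl

theorem isLeftInvariantConnection_leftConnection :
    IsLeftInvariantConnection I (leftConnection I K) := by
  have key : ∀ (v : E) (p : K), leftConnection I K (fun q => leftTrans I q v) p = 0 := by
    intro v p
    ext w
    rw [leftConnection_apply]
    have h : mcFun (I := I) (fun q : K => leftTrans I q v) = fun _ => v :=
      funext fun q => mcForm_leftTrans q v
    rw [h, mvfderiv_const]
    exact map_zero _
  exact fun v p => key v p

theorem covariantDerivative_sum_smul {ι : Type*} (s : Finset ι)
    (N : CovariantDerivative I E (TangentSpace I : K → Type _)) {g : ι → K → ℝ}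
    {W : ι → Π q : K, TangentSpace I q} {p : K}
    (hg : ∀ i, MDiffAt (g i) p) (hW : ∀ i, MDiffAt (T% (W i)) p) :
    N (∑ i ∈ s, g i • W i) p =
      ∑ i ∈ s, (g i p • N (W i) p + (mvfderiv I (g i) p).smulRight (W i p)) ∧
    MDiffAt (T% (∑ i ∈ s, g i • W i)) p := by
  classical
  induction s using Finset.induction_on with
  | empty =>
    refine ⟨by simp, ?_⟩
    exact mdifferentiableAt_zeroSection ..
  | insert i s hi ih =>
    simp only [Finset.sum_insert hi]
    have h := (hg i).smul_section (hW i)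
    refine ⟨?_, mdifferentiableAt_add_section h ih.2⟩
    rw [N.isCovariantDerivativeOnUniv.add h ih.2, ih.1,
      N.isCovariantDerivativeOnUniv.leibniz (hW i) (hg i)]

/-- A left-invariant connection is determined on differentiable fields. -/
theorem IsLeftInvariantConnection.eq {N : CovariantDerivative I E (TangentSpace I : K → Type _)}
    (hN : IsLeftInvariantConnection I N) {Y : Π p : K, TangentSpace I p} {p : K}
    (hY : MDiffAt (T% Y) p) (v : TangentSpace I p) :
    N Y p v = leftTrans I p (mvfderiv I (mcFun Y) p v) := by
  have hy := MDifferentiableAt.mcFun hY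
  conv_lhs => rw [← leftField_mcFun Y, leftField_eq_sum]
  rw [(covariantDerivative_sum_smul Finset.univ N (fun i => (mdifferentiableAt_coord hy i).1)
    (fun i => mdifferentiableAt_leftTrans _ p)).1]
  have h0 : ∀ w : E, N (fun q => leftTrans I q w) p = 0 := fun w => hN w p
  simp only [h0, smul_zero, zero_add, sum_apply,
    ContinuousLinearMap.smulRight_apply, (mdifferentiableAt_coord hy _).2]
  conv_rhs => rw [← (Module.finBasis ℝ E).sum_repr (mvfderiv I (mcFun Y) p v), map_sum]
  exact Finset.sum_congr rfl fun i _ => (map_smul _ _ _).symm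

/-- In the left trivialization the connection differentiates vector-valued functions, so the
curvature measures the failure of the bracket to be the commutator of derivations. -/
theorem isFlatConnection_of_isLeftInvariant [I.Boundaryless]
    {N : CovariantDerivative I E (TangentSpace I : K → Type _)}
    (hN : IsLeftInvariantConnection I N) : IsFlatConnection I N := by
  intro X Y Z hX hY hZ p
  have hz : ContMDiff I 𝓘(ℝ, E) ∞ (mcFun Z) := fun q => ContMDiffAt.mcFun le_rfl (hZ q)
  have hd : ∀ {W : Π q : K, TangentSpace I q}, IsSmoothVectorField I W →
      MDiffAt (fun q => mvfderiv I (mcFun Z) q (W q)) p := fun hW =>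
    (mdifferentiableAt_mvfderiv_field ((hz p).of_le ENat.LEInfty.out) (hW.mdifferentiableAt p)).1
  have h1 : ∀ W : Π q : K, TangentSpace I q, (fun q => N Z q (W q)) =
      leftField I (fun q => mvfderiv I (mcFun Z) q (W q)) := fun W =>
    funext fun q => hN.eq (hZ.mdifferentiableAt q) (W q)
  rw [h1 Y, h1 X, hN.eq (MDifferentiableAt.leftField (hd hY)),
    hN.eq (MDifferentiableAt.leftField (hd hX)), hN.eq (hZ.mdifferentiableAt p),
    mcFun_leftField, mcFun_leftField, mvfderiv_mlieBracket ((hz p).of_le ENat.LEInfty.out)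
      (hX.mdifferentiableAt p) (hY.mdifferentiableAt p), ← map_sub, ← map_sub, sub_self, map_zero]

/-- The metric and the endomorphisms have constant coefficients in the left trivialization, hence
are parallel. On a parallel frame only the bracket term of the torsion survives, so skewness of the
torsion is the invariance of `B`. -/
theorem isHKTConnection_of_isLeftInvariant [I.Boundaryless]
    {N : CovariantDerivative I E (TangentSpace I : K → Type _)}
    (hN : IsLeftInvariantConnection I N) (B : E →L[ℝ] E →L[ℝ] ℝ)
    (hs : ∀ v w, B v w = B w v) (hB : ∀ v, v ≠ 0 → 0 < B v v) (A : Fin 3 → E →L[ℝ] E)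
    (hinv : ∀ x y z, B (bracketE I K x y) z = B x (bracketE I K y z)) :
    IsHKTConnection I (leftMetric I K B hs hB) (fun a => leftEnd I (A a)) N where
  smooth := by
    refine ⟨⟨fun {Y} hY => ?_⟩⟩
    rw [contMDiffOn_univ] at hY ⊢
    have hY' : IsSmoothVectorField I Y := hY.of_le (by simp)
    have hy : ContMDiff I 𝓘(ℝ, E) ∞ (mcFun Y) := fun q => ContMDiffAt.mcFun le_rfl (hY' q)
    intro p
    apply contMDiffAt_homSection_of_apply
    intro X hX
    have h1 : (fun q => TotalSpace.mk' E (E := TangentSpace I) q (N.toFun Y q (X q))) =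
        (T% (leftField I (fun q => mvfderiv I (mcFun Y) q (X q)))) := by
      funext q
      exact congrArg _ (hN.eq (hY'.mdifferentiableAt q) (X q))
    rw [h1]
    apply ContMDiffAt.leftField le_rfl
    -- The derivative along `X` is the fibre component of the tangent map of `mcFun Y` evaluated on
    -- `X`; this shows that it is smooth.
    have h2 : ContMDiff I.tangent 𝓘(ℝ, E).tangent ∞ (tangentMap I 𝓘(ℝ, E) (mcFun Y)) :=
      ContMDiff.contMDiff_tangentMap hy (by simp)
    exact (contMDiff_snd_tangentBundle_modelSpace E 𝓘(ℝ, E)).contMDiffAt.comp p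
      (h2.contMDiffAt.comp p hX)
  metric Y Z hY hZ p v := by
    have hy := MDifferentiableAt.mcFun (hY.mdifferentiableAt p)
    have hz := MDifferentiableAt.mcFun (hZ.mdifferentiableAt p)
    rw [hN.eq (hY.mdifferentiableAt p), hN.eq (hZ.mdifferentiableAt p)]
    simp only [leftMetric_inner, mcForm_leftTrans]
    exact mvfderiv_bilin B hy hz v
  complex a Y hY p v := by
    have hy := mvfderiv_clm_comp (I := I) (A a) (MDifferentiableAt.mcFun (hY.mdifferentiableAt p))
    rw [leftEnd_field, hN.eq (MDifferentiableAt.leftField hy.1), hN.eq (hY.mdifferentiableAt p),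
      mcFun_leftField, hy.2, leftEnd_leftTrans]
  skew_left p x y z := by
    have key : ∀ b c : E, N.torsion p (leftTrans I p b) (leftTrans I p c) =
        -leftTrans I p (bracketE I K b c) := by
      intro b c
      have h := N.torsion_apply (mdifferentiableAt_leftTrans b p) (mdifferentiableAt_leftTrans c p)
      have h0 : ∀ w : E, N (fun q => leftTrans I q w) p = 0 := fun w => hN w p
      rw [h, h0, h0, mlieBracket_leftTrans]
      exact (congrArg (fun w : E => w - id (α := E) (leftTrans I p (bracketE I K b c))) (sub_self (0 : E))).trans
        (zero_sub _)
    have hskew : ∀ v w : E, bracketE I K v w = - bracketE I K w v := fun v w =>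
      (lie_skew (L := GroupLieAlgebra I K) v w).symm
    rw [← leftTrans_mcForm p x, ← leftTrans_mcForm p y, ← leftTrans_mcForm p z]
    set a := mcForm I p x
    set b := mcForm I p y
    set c := mcForm I p z
    rw [key, key, map_neg, map_neg, leftMetric_inner, leftMetric_inner]
    simp only [mcForm_leftTrans]
    rw [← hinv, ← hinv, hskew a b, map_neg]
    simp
  skew_right p x y z := by
    rw [N.torsion_antisymm, map_neg]

theorem isHyperHermitian_left [I.Boundaryless] (B : E →L[ℝ] E →L[ℝ] ℝ)
    (hs : ∀ v w, B v w = B w v) (hB : ∀ v, v ≠ 0 → 0 < B v v) (A : Fin 3 → E →L[ℝ] E)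
    (hsq : ∀ a v, A a (A a v) = -v) (hmul : ∀ v, A 0 (A 1 v) = A 2 v)
    (hanti : ∀ v, A 1 (A 0 v) = -A 2 v) (hherm : ∀ a v w, B (A a v) (A a w) = B v w)
    (hN : ∀ a v w, bracketE I K (A a v) (A a w) - bracketE I K v w -
      A a (bracketE I K (A a v) w) - A a (bracketE I K v (A a w)) = 0) :
    IsHyperHermitian I (leftMetric I K B hs hB) (fun a => leftEnd I (A a)) where
  hypercomplex :=
    { smooth := fun a => isSmoothEndField_leftEnd (A a)
      sq := fun a p v => by
        rw [← leftTrans_mcForm p v, leftEnd_leftTrans, leftEnd_leftTrans, hsq, map_neg]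
      mul := fun p v => by
        rw [← leftTrans_mcForm p v, leftEnd_leftTrans, leftEnd_leftTrans, leftEnd_leftTrans, hmul]
      anticomm := fun p v => by
        rw [← leftTrans_mcForm p v, leftEnd_leftTrans, leftEnd_leftTrans, leftEnd_leftTrans, hanti,
          map_neg]
      integrable := fun a _ _ hX hY p => nijenhuis_leftEnd_eq_zero (A a) (hsq a) (hN a)
        (hX.mdifferentiableAt p) (hY.mdifferentiableAt p) }
  hermitian a p v w := by
    rw [← leftTrans_mcForm p v, ← leftTrans_mcForm p w, leftEnd_leftTrans, leftEnd_leftTrans]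
    simp only [leftMetric_inner, mcForm_leftTrans, hherm]

/-- The differential at the identity of conjugation by `p⁻¹`. -/
noncomputable def adInv (I : ModelWithCorners ℝ E H) (p : K) : E →L[ℝ] E :=
  mfderiv I I (fun q : K => p⁻¹ * q * p) 1

theorem mcForm_mul_left (p q : K) (v : TangentSpace I q) :
    mcForm I (p * q) (mfderiv I I (fun x => p * x) q v) = mcForm I q v := by
  have h1 : MDiffAt (fun x : K => (p * q)⁻¹ * x) (p * q) :=
    (contMDiff_mul_left (n := ∞)).mdifferentiableAt (by simp)
  have h2 : MDiffAt (fun x : K => p * x) q :=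
    (contMDiff_mul_left (n := ∞)).mdifferentiableAt (by simp)
  have h3 := mfderiv_comp_apply q h1 h2 v
  have h4 : (fun x : K => (p * q)⁻¹ * x) ∘ (fun x : K => p * x) = fun x => q⁻¹ * x := by
    ext x; simp [mul_assoc]
  rw [h4] at h3
  exact h3.symm

/-- From `(q p)⁻¹ (x p) = p⁻¹ (q⁻¹ x) p`: in the left trivialization a right translation acts as
`Ad(p⁻¹)`, so bi-invariance of a left-invariant metric is Ad-invariance. -/
theorem mcForm_mul_right (p q : K) (v : TangentSpace I q) :
    mcForm I (q * p) (mfderiv I I (fun x => x * p) q v) = adInv I p (mcForm I q v) := by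
  have h1 : MDiffAt (fun x : K => (q * p)⁻¹ * x) (q * p) :=
    (contMDiff_mul_left (n := ∞)).mdifferentiableAt (by simp)
  have h2 : MDiffAt (fun x : K => x * p) q :=
    (contMDiff_mul_right (n := ∞)).mdifferentiableAt (by simp)
  have h3 := mfderiv_comp_apply q h1 h2 v
  have h1' : MDiffAt (fun x : K => p⁻¹ * x * p) (q⁻¹ * q) :=
    ((contMDiff_mul_right (n := ∞)).comp (contMDiff_mul_left (n := ∞))).mdifferentiableAt (by simp)
  have h2' : MDiffAt (fun x : K => q⁻¹ * x) q :=
    (contMDiff_mul_left (n := ∞)).mdifferentiableAt (by simp)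
  have h3' := mfderiv_comp_apply q h1' h2' v
  have h4 : (fun x : K => (q * p)⁻¹ * x) ∘ (fun x : K => x * p) =
      (fun x : K => p⁻¹ * x * p) ∘ (fun x : K => q⁻¹ * x) := by
    ext x; simp [mul_assoc]
  rw [h4] at h3
  refine h3.symm.trans (h3'.trans ?_)
  have h5 : ∀ (r : K), r = 1 → ∀ w : E, id (α := E) (mfderiv I I (fun x : K => p⁻¹ * x * p) r w) =
      adInv I p w := by
    rintro _ rfl w; rfl
  exact h5 _ (by simp) _

theorem isBiInvariantMetric_leftMetric (B : E →L[ℝ] E →L[ℝ] ℝ)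
    (hs : ∀ v w, B v w = B w v) (hB : ∀ v, v ≠ 0 → 0 < B v v)
    (hAd : ∀ (p : K) v w, B (adInv I p v) (adInv I p w) = B v w) :
    IsBiInvariantMetric I (leftMetric I K B hs hB) where
  left p q v w := by
    simp only [leftMetric_inner, mcForm_mul_left]
  right p q v w := by
    simp only [leftMetric_inner, mcForm_mul_right, hAd]

end LeftInvariant

/-! ### Homomorphisms, products and the adjoint representation -/

section GroupHom

open Bundle VectorField Topology Filter

variable {E : Type*} [NormedAddCommGroup E] [NormedSpace ℝ E] [CompleteSpace E]
  [FiniteDimensional ℝ E]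
  {H : Type*} [TopologicalSpace H] {I : ModelWithCorners ℝ E H} [I.Boundaryless]
  {K : Type*} [TopologicalSpace K] [ChartedSpace H K] [Group K] [LieGroup I ∞ K]
  {E' : Type*} [NormedAddCommGroup E'] [NormedSpace ℝ E'] [CompleteSpace E']
  [FiniteDimensional ℝ E']
  {H' : Type*} [TopologicalSpace H'] {I' : ModelWithCorners ℝ E' H'} [I'.Boundaryless]
  {K' : Type*} [TopologicalSpace K'] [ChartedSpace H' K'] [Group K'] [LieGroup I' ∞ K']

theorem leftTrans_one (v : E) : leftTrans I (1 : K) v = v := by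
  have h : (fun q : K => 1 * q) = id := by ext; simp
  unfold leftTrans
  rw [h, mfderiv_id]
  rfl

/-- The differential at the identity of a map, read as a map of the model spaces. -/
noncomputable def homDeriv (I : ModelWithCorners ℝ E H) (I' : ModelWithCorners ℝ E' H')
    (f : K → K') : E →L[ℝ] E' := mfderiv I I' f 1

/-- Here `id (α := E)` reads tangent vectors at two only propositionally equal points in the common
model space. The same device handles such changes of base point elsewhere. -/
theorem leftTrans_congr {p q : K} (h : p = q) (v : E) :
    id (α := E) (leftTrans I p v) = leftTrans I q v := by
  subst h; rfl

theorem mfderiv_leftTrans_of_mul {f : K → K'} (hf : ContMDiff I I' ∞ f)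
    (hmul : ∀ x y, f (x * y) = f x * f y) (q : K) (v : E) :
    mfderiv I I' f q (leftTrans I q v) = leftTrans I' (f q) (homDeriv I I' f v) := by
  have h1 : MDiffAt f (q * 1) := hf.mdifferentiableAt (by simp)
  have h2 : MDiffAt (fun x : K => q * x) 1 :=
    (contMDiff_mul_left (n := ∞)).mdifferentiableAt (by simp)
  have h3 := mfderiv_comp_apply (1 : K) h1 h2 v
  have hf1 : f 1 = 1 := by simpa using hmul 1 1
  have h1' : MDiffAt (fun x : K' => f q * x) (f 1) :=
    (contMDiff_mul_left (n := ∞)).mdifferentiableAt (by simp)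
  have h2' : MDiffAt f 1 := hf.mdifferentiableAt (by simp)
  have h3' := mfderiv_comp_apply (1 : K) h1' h2' v
  have h4 : f ∘ (fun x : K => q * x) = (fun x : K' => f q * x) ∘ f := by
    ext x; exact hmul q x
  rw [h4] at h3
  have h5 : ∀ r, r = q → ∀ w : E, id (α := E') (mfderiv I I' f r w) = mfderiv I I' f q w := by
    rintro _ rfl w; rfl
  have h6 : ∀ r, r = 1 → ∀ w : E', id (α := E') (mfderiv I' I' (fun x : K' => f q * x) r w) =
      leftTrans I' (f q) w := by
    rintro _ rfl w; rfl
  exact (h5 _ (mul_one q) _).symm.trans (h3.symm.trans (h3'.trans (h6 _ hf1 _)))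

/-- A multiplicative map relates the left-invariant field of `v` to that of its image, and brackets
of related fields are related. -/
theorem homDeriv_bracketE {f : K → K'} (hf : ContMDiff I I' ∞ f)
    (hmul : ∀ x y, f (x * y) = f x * f y) (v w : E) :
    homDeriv I I' f (bracketE I K v w) =
      bracketE I' K' (homDeriv I I' f v) (homDeriv I I' f w) := by
  have hf1 : f 1 = 1 := by simpa using hmul 1 1
  have h := mfderiv_mlieBracket_of_related (x := (1 : K)) ((hf 1).of_le ENat.LEInfty.out)
    (mdifferentiableAt_leftTrans v _) (mdifferentiableAt_leftTrans w _)
    (mdifferentiableAt_leftTrans _ _) (mdifferentiableAt_leftTrans _ _)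
    (fun q => mfderiv_leftTrans_of_mul hf hmul q v)
    (fun q => mfderiv_leftTrans_of_mul hf hmul q w)
  rw [mlieBracket_leftTrans, mlieBracket_leftTrans] at h
  refine (congrArg (homDeriv I I' f) (leftTrans_one (K := K) (bracketE I K v w)).symm).trans
    (h.trans ?_)
  exact (leftTrans_congr hf1 (bracketE I' K' (homDeriv I I' f v) (homDeriv I I' f w))).trans
    (leftTrans_one (I := I') (K := K') _)

theorem contMDiff_conj_inv (p : K) : ContMDiff I I ∞ (fun q : K => p⁻¹ * q * p) :=
  (contMDiff_mul_right (n := ∞)).comp (contMDiff_mul_left (n := ∞))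

theorem adInv_bracketE (p : K) (v w : E) :
    adInv I p (bracketE I K v w) = bracketE I K (adInv I p v) (adInv I p w) :=
  homDeriv_bracketE (contMDiff_conj_inv p) (fun x y => by group) v w

theorem adInv_adInv (p q : K) (v : E) : adInv I p (adInv I q v) = adInv I (q * p) v := by
  have h1 : MDiffAt (fun x : K => p⁻¹ * x * p) (q⁻¹ * 1 * q) :=
    (contMDiff_conj_inv p).mdifferentiableAt (by simp)
  have h2 : MDiffAt (fun x : K => q⁻¹ * x * q) 1 :=
    (contMDiff_conj_inv q).mdifferentiableAt (by simp)
  have h3 := mfderiv_comp_apply (1 : K) h1 h2 v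
  have h4 : (fun x : K => p⁻¹ * x * p) ∘ (fun x : K => q⁻¹ * x * q) =
      fun x : K => (q * p)⁻¹ * x * (q * p) := by
    ext x; simp [mul_assoc]
  rw [h4] at h3
  have h5 : ∀ r, r = 1 → ∀ w : E, id (α := E) (mfderiv I I (fun x : K => p⁻¹ * x * p) r w) =
      adInv I p w := by
    rintro _ rfl w; rfl
  exact (h5 _ (by simp) _).symm.trans h3.symm

theorem adInv_one (v : E) : adInv I (1 : K) v = v := by
  have h : (fun q : K => (1 : K)⁻¹ * q * 1) = id := by ext; simp
  unfold adInv
  rw [h, mfderiv_id]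
  rfl

/-- The derivative of a family of maps depends smoothly on the parameter in tangent coordinates.
Conjugation fixes the identity, so these coordinate changes are the identity here. -/
theorem contMDiff_adInv : ContMDiff I 𝓘(ℝ, E →L[ℝ] E) ∞ (fun p : K => adInv I p) := by
  intro p
  have hF : ContMDiffAt (I.prod I) I ∞ (Function.uncurry fun p q : K => p⁻¹ * q * p) (p, 1) :=
    ((contMDiff_fst.inv.mul contMDiff_snd).mul contMDiff_fst) _
  have h := ContMDiffAt.mfderiv (m := ∞) (fun p q : K => p⁻¹ * q * p) (fun _ => (1 : K)) hF
    contMDiffAt_const le_rfl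
  refine h.congr_of_eventuallyEq (Eventually.of_forall fun q => ?_)
  refine Eq.trans ?_ (inTangentCoordinates_eq (I := I) (I' := I) (fun _ : K => (1 : K))
    (fun x : K => x⁻¹ * 1 * x) (fun x : K => adInv I x) (mem_chart_source _ _) (by simp)).symm
  have hc : ∀ (r s : K), r = 1 → s = 1 → ∀ w : E, (tangentBundleCore I K).coordChange
      (achart H r) (achart H s) r w = w := by
    rintro _ _ rfl rfl w
    exact tangentCoordChange_self (I := I) (mem_extChartAt_source (1 : K))
  ext w
  refine Eq.trans ?_ (hc _ _ (by simp) (by simp) _).symm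
  exact congrArg (adInv I q) (hc 1 1 rfl rfl w).symm

theorem bracketE_fst (v w : E × E') : (bracketE (I.prod I') (K × K') v w).1 =
    bracketE I K v.1 w.1 := by
  have h : ∀ v : E × E', homDeriv (I.prod I') I (Prod.fst : K × K' → K) v = v.1 := fun v =>
    congrArg (fun A : E × E' →L[ℝ] E => A v) (mfderiv_fst (I := I) (I' := I') (x := (1 : K × K')))
  have := homDeriv_bracketE (I := I.prod I') (I' := I) (contMDiff_fst (M := K) (N := K') (n := ∞))
    (fun _ _ => rfl) v w
  rwa [h, h, h] at this

theorem bracketE_snd (v w : E × E') : (bracketE (I.prod I') (K × K') v w).2 =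
    bracketE I' K' v.2 w.2 := by
  have h : ∀ v : E × E', homDeriv (I.prod I') I' (Prod.snd : K × K' → K') v = v.2 := fun v =>
    congrArg (fun A : E × E' →L[ℝ] E' => A v) (mfderiv_snd (I := I) (I' := I') (x := (1 : K × K')))
  have := homDeriv_bracketE (I := I.prod I') (I' := I') (contMDiff_snd (M := K) (N := K') (n := ∞))
    (fun _ _ => rfl) v w
  rwa [h, h, h] at this

theorem bracketE_prod (v w : E × E') : bracketE (I.prod I') (K × K') v w =
    (bracketE I K v.1 w.1, bracketE I' K' v.2 w.2) :=
  Prod.ext (bracketE_fst v w) (bracketE_snd v w)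

theorem adInv_prod (p : K × K') (v : E × E') :
    adInv (I.prod I') p v = (adInv I p.1 v.1, adInv I' p.2 v.2) := by
  have h1 : MDiffAt (fun q : K => p.1⁻¹ * q * p.1) 1 :=
    (contMDiff_conj_inv p.1).mdifferentiableAt (by simp)
  have h2 : MDiffAt (fun q : K' => p.2⁻¹ * q * p.2) 1 :=
    (contMDiff_conj_inv p.2).mdifferentiableAt (by simp)
  exact congrArg (fun A : E × E' →L[ℝ] E × E' => A v)
    (mfderiv_prodMap (p := (1 : K × K')) h1 h2)

/-- Differentiate `u u⁻¹ = 1` at the identity. -/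
theorem mfderiv_inv_one (y : E) : id (α := E) (mfderiv I I (fun u : K => u⁻¹) 1 y) = -y := by
  have hm : MDifferentiableAt (I.prod I) I (fun p : K × K => p.1 * p.2) ((1 : K), (1 : K)⁻¹) :=
    (contMDiff_mul I ∞).mdifferentiableAt (by simp)
  have hi : MDiffAt (fun u : K => u⁻¹) 1 := (contMDiff_inv I ∞).mdifferentiableAt (by simp)
  have hd : MDiffAt (fun u : K => (u, u⁻¹)) 1 := mdifferentiableAt_id.prodMk hi
  have h1 := mfderiv_comp_apply (1 : K) hm hd y
  have h2 : (fun p : K × K => p.1 * p.2) ∘ (fun u : K => (u, u⁻¹)) = fun _ => 1 := by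
    ext u; simp
  rw [h2, mfderiv_const] at h1
  have h3 := congrArg (fun A : E →L[ℝ] E × E => A y)
    (mfderiv_prodMk (mdifferentiableAt_id (I := I) (x := (1 : K))) hi)
  rw [mfderiv_id] at h3
  have h4 := mfderiv_prod_eq_add_apply hm (v := (id (α := E × E) (y, id (α := E) (mfderiv I I (fun u : K => u⁻¹) 1 y))))
  have h5 : ∀ r : K, r = 1 → ∀ w : E, id (α := E) (mfderiv I I (fun z : K => z * r) 1 w) = w := by
    rintro _ rfl w
    rw [show (fun z : K => z * 1) = id by ext; simp, mfderiv_id]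
    rfl
  have h6 : ∀ r : K, r = 1 → ∀ w : E, id (α := E) (mfderiv I I (fun z : K => 1 * z) r w) = w := by
    rintro _ rfl w
    rw [show (fun z : K => 1 * z) = id by ext; simp, mfderiv_id]
    rfl
  have h7 := congrArg (fun w : E × E => id (α := E)
    (mfderiv (I.prod I) I (fun p : K × K => p.1 * p.2) ((1 : K), (1 : K)⁻¹) w)) h3
  have h8 : (0 : E) = y + id (α := E) (mfderiv I I (fun u : K => u⁻¹) 1 y) := by
    refine h1.trans (h7.trans (h4.trans ?_))
    exact congrArg₂ (fun a b : E => a + b) (h5 _ inv_one _) (h6 _ inv_one _)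
  exact (neg_eq_of_add_eq_zero_right h8.symm).symm

/-- Write `u⁻¹ p = p (p⁻¹ u p)⁻¹` and use the chain rule. -/
theorem mfderiv_inv_mul_one (p : K) (y : E) :
    mfderiv I I (fun u : K => u⁻¹ * p) 1 y = leftTrans I p (-adInv I p y) := by
  have hc : MDiffAt (fun u : K => p⁻¹ * u * p) 1 :=
    (contMDiff_conj_inv p).mdifferentiableAt (by simp)
  have hi : MDiffAt (fun u : K => u⁻¹) (p⁻¹ * 1 * p) :=
    (contMDiff_inv I ∞).mdifferentiableAt (by simp)
  have hl : MDiffAt (fun u : K => p * u) (p⁻¹ * 1 * p)⁻¹ :=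
    (contMDiff_mul_left (n := ∞)).mdifferentiableAt (by simp)
  have h1 := mfderiv_comp_apply (1 : K) hi hc y
  have h2 := mfderiv_comp_apply (1 : K) hl (hi.comp 1 hc) y
  have h3 : (fun u : K => p * u) ∘ ((fun u : K => u⁻¹) ∘ fun u : K => p⁻¹ * u * p) =
      fun u => u⁻¹ * p := by
    ext u; simp [mul_assoc]
  rw [h3] at h2
  have h4 : ∀ r : K, r = 1 → ∀ w : E, id (α := E) (mfderiv I I (fun u : K => u⁻¹) r w) = -w := by
    rintro _ rfl w; exact mfderiv_inv_one w
  have h5 : ∀ r : K, r = 1 → ∀ w : E, id (α := E) (mfderiv I I (fun u : K => p * u) r w) =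
      leftTrans I p w := by
    rintro _ rfl w; rfl
  refine h2.trans ((h5 _ (by simp) _).trans ?_)
  exact congrArg (leftTrans I p) (h1.trans (h4 _ (by simp) _))

/-- Prepares the derivative of Ad: under `(p, q) ↦ p⁻¹ q` every left-invariant field of `K × K` is
related to a field on `K`, whose left trivialization is given here. -/
theorem mfderiv_inv_mul_leftTrans (q : K × K) (v : E × E) :
    mfderiv (I.prod I) I (fun p : K × K => p.1⁻¹ * p.2) q (leftTrans (I.prod I) q v) =
      leftTrans I (q.1⁻¹ * q.2) (-adInv I (q.1⁻¹ * q.2) v.1 + v.2) := by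
  have hF : ContMDiff (I.prod I) I ∞ (fun p : K × K => p.1⁻¹ * p.2) :=
    contMDiff_fst.inv.mul contMDiff_snd
  have h1 : MDiffAt (fun x : K × K => q * x) 1 :=
    (contMDiff_mul_left (n := ∞)).mdifferentiableAt (by simp)
  have h2 := mfderiv_comp_apply (1 : K × K) (hF.mdifferentiableAt (by simp) (x := q * 1)) h1 v
  have h3 : (fun p : K × K => p.1⁻¹ * p.2) ∘ (fun x : K × K => q * x) =
      fun x => x.1⁻¹ * (q.1⁻¹ * q.2) * x.2 := by
    ext u; simp [mul_assoc]
  rw [h3] at h2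
  have h4 : ∀ r : K × K, r = q → ∀ w : E × E, id (α := E)
      (mfderiv (I.prod I) I (fun p : K × K => p.1⁻¹ * p.2) r w) =
      mfderiv (I.prod I) I (fun p : K × K => p.1⁻¹ * p.2) q w := by
    rintro _ rfl w; rfl
  have hG : ContMDiff (I.prod I) I ∞ (fun x : K × K => x.1⁻¹ * (q.1⁻¹ * q.2) * x.2) :=
    (contMDiff_fst.inv.mul contMDiff_const).mul contMDiff_snd
  have h5 := mfderiv_prod_eq_add_apply (hG.mdifferentiableAt (by simp) (x := (1 : K × K))) (v := v)
  have h6 : (fun z : K => z⁻¹ * (q.1⁻¹ * q.2) * 1) = fun z => z⁻¹ * (q.1⁻¹ * q.2) := by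
    ext z; simp
  have h7 : (fun z : K => (1 : K)⁻¹ * (q.1⁻¹ * q.2) * z) = fun z => (q.1⁻¹ * q.2) * z := by
    ext z; simp
  simp only [Prod.fst_one, Prod.snd_one] at h5
  rw [h6, h7] at h5
  refine (h4 _ (mul_one q) _).symm.trans (h2.symm.trans (h5.trans ?_))
  rw [map_add]
  exact congrArg (fun w : E => w + id (α := E) (leftTrans I (q.1⁻¹ * q.2) v.2))
    (mfderiv_inv_mul_one (q.1⁻¹ * q.2) v.1)

/-- The derivative at the identity of `p ↦ Ad(p⁻¹) y`. -/
theorem mvfderiv_adInv_one (x y : E) :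
    mvfderiv I (fun p : K => adInv I p y) 1 (id (α := E) x) = -bracketE I K x y := by
  have hF : ContMDiff (I.prod I) I ∞ (fun p : K × K => p.1⁻¹ * p.2) :=
    contMDiff_fst.inv.mul contMDiff_snd
  have hd : ∀ p : K, MDiffAt (fun p : K => -adInv I p y) p ∧
      ∀ v, mvfderiv I (fun p : K => -adInv I p y) p v =
        -mvfderiv I (fun p : K => adInv I p y) p v := by
    intro p
    have h1 := mvfderiv_clm_comp (ContinuousLinearMap.apply ℝ E y)
      ((contMDiff_adInv (I := I) (K := K)).mdifferentiableAt (by simp) (x := p))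
    have h2 := mvfderiv_clm_comp (-ContinuousLinearMap.id ℝ E) h1.1
    exact h2
  -- The fields of `(0, x)` and `(y, 0)` commute on `K × K`. Under `(p, q) ↦ p⁻¹ q` they are related
  -- to the left-invariant field of `x` and to the field with left trivialization `-Ad(r⁻¹) y`. So
  -- these commute at the identity, and the Maurer–Cartan formula for their bracket gives the
  -- derivative.
  have h := mfderiv_mlieBracket_of_related (x := (1 : K × K)) ((hF 1).of_le ENat.LEInfty.out)
    (mdifferentiableAt_leftTrans (I := I.prod I) (E := E × E) (0, x) 1)
    (mdifferentiableAt_leftTrans (I := I.prod I) (E := E × E) (y, 0) 1)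
    (mdifferentiableAt_leftTrans x _) (MDifferentiableAt.leftField (hd _).1)
    (fun q => (mfderiv_inv_mul_leftTrans q (0, x)).trans (by simp))
    (fun q => (mfderiv_inv_mul_leftTrans q (y, 0)).trans
      (congrArg (leftTrans I (q.1⁻¹ * q.2)) (add_zero (-adInv I (q.1⁻¹ * q.2) y))))
  rw [mlieBracket_leftTrans, bracketE_prod, mlieBracket_leftTrans_leftField _ (hd _).1, (hd _).2] at h
  have h0 : (bracketE I K 0 y, bracketE I K x 0) = (0 : E × E) := by simp
  have h1 : leftTrans (I.prod I) (1 : K × K) (bracketE I K 0 y, bracketE I K x 0) = 0 :=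
    (congrArg (leftTrans (I.prod I) (1 : K × K)) h0).trans (map_zero _)
  have h2 := h.symm.trans ((congrArg (fun w => id (α := E) (mfderiv (I.prod I) I
    (fun p : K × K => p.1⁻¹ * p.2) 1 w)) h1).trans (map_zero _))
  have h3 : ∀ r : K, r = 1 → leftTrans I r (-mvfderiv I (fun p : K => adInv I p y) r
      (leftTrans I r x) + bracketE I K x (-adInv I r y)) = 0 →
      mvfderiv I (fun p : K => adInv I p y) 1 (id (α := E) x) = -bracketE I K x y := by
    rintro _ rfl h4
    have h5 := (leftTrans_one _).symm.trans h4
    have h6 := congrArg (fun w : E => mvfderiv I (fun p : K => adInv I p y) 1 w)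
      (leftTrans_one (I := I) (K := K) x)
    rw [adInv_one, map_neg] at h5
    refine h6.symm.trans ?_
    have h7 := neg_eq_of_add_eq_zero_right h5
    exact (neg_neg (id (α := E) _)).symm.trans h7
  exact h3 _ (by simp) h2

end GroupHom

/-! ### Negativity of the Killing form from an invariant scalar product -/

section KillingNegative

/-- Since ad x is skew for `h`, in an orthogonal basis `v` the trace of its square is minus the sum
of `h ⁅x, v i⁆ ⁅x, v i⁆ / h (v i) (v i)`. It vanishes only if x commutes with the basis, that is, if
x is central. -/
theorem killingForm_neg_of_invariant {L : Type*} [LieRing L] [LieAlgebra ℝ L]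
    [FiniteDimensional ℝ L] (h : LinearMap.BilinForm ℝ L) (hs : ∀ x y, h x y = h y x)
    (hpos : ∀ x, x ≠ 0 → 0 < h x x) (hinv : ∀ x y z : L, h ⁅x, y⁆ z = -h y ⁅x, z⁆)
    (hc : LieAlgebra.center ℝ L = ⊥) {x : L} (hx : x ≠ 0) : killingForm ℝ L x x < 0 := by
  obtain ⟨v, hv⟩ := LinearMap.BilinForm.exists_orthogonal_basis (B := h) ⟨fun x y => hs x y⟩
  have hvi : ∀ i, 0 < h (v i) (v i) := fun i => hpos _ (v.ne_zero i)
  have hrepr : ∀ (w : L) i, v.repr w i = h (v i) w / h (v i) (v i) := by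
    intro w i
    rw [eq_div_iff (hvi i).ne']
    conv_rhs => rw [← v.sum_repr w, map_sum]
    rw [Finset.sum_eq_single i]
    · simp
    · intro j _ hj
      rw [map_smul, hv hj.symm, smul_zero]
    · simp
  have htr : killingForm ℝ L x x = -∑ i, h ⁅x, v i⁆ ⁅x, v i⁆ / h (v i) (v i) := by
    rw [killingForm_apply_apply, LinearMap.trace_eq_matrix_trace ℝ v, Matrix.trace,
      ← Finset.sum_neg_distrib]
    refine Finset.sum_congr rfl fun i _ => ?_
    rw [Matrix.diag_apply, LinearMap.toMatrix_apply, hrepr]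
    have := hinv x (v i) ⁅x, v i⁆
    simp only [LinearMap.comp_apply, LieAlgebra.ad_apply]
    rw [this]; ring
  rw [htr, neg_lt_zero]
  have hnn : ∀ y, 0 ≤ h y y := fun y => by
    rcases eq_or_ne y 0 with rfl | hy
    · simp
    · exact (hpos y hy).le
  refine lt_of_le_of_ne (Finset.sum_nonneg fun i _ => div_nonneg (hnn _) (hvi i).le) fun h0 => hx ?_
  have h1 := (Finset.sum_eq_zero_iff_of_nonneg
    (fun i _ => div_nonneg (hnn ⁅x, v i⁆) (hvi i).le)).1 h0.symm
  have h2 : ∀ i, ⁅x, v i⁆ = 0 := by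
    intro i
    by_contra hne
    exact (div_pos (hpos _ hne) (hvi i)).ne' (h1 i (Finset.mem_univ i))
  have h3 : LieAlgebra.ad ℝ L x = 0 := v.ext fun i => h2 i
  have h4 : x ∈ LieAlgebra.center ℝ L := by
    rw [LieModule.mem_maxTrivSubmodule]
    intro y
    rw [← lie_skew, neg_eq_zero]
    exact congrArg (fun A : Module.End ℝ L => A y) h3
  rw [hc] at h4
  simpa using h4

end KillingNegative

/-! ### Compact groups: averaging, Ad-invariance, commutative groups -/

section Compact

open Bundle VectorField Topology Filter MeasureTheory

variable {E : Type*} [NormedAddCommGroup E] [InnerProductSpace ℝ E] [CompleteSpace E]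
  [FiniteDimensional ℝ E]
  {H : Type*} [TopologicalSpace H] {I : ModelWithCorners ℝ E H} [I.Boundaryless]
  {K : Type*} [TopologicalSpace K] [ChartedSpace H K] [Group K] [LieGroup I ∞ K]

theorem continuous_adInv_apply (x : E) : Continuous fun p : K => adInv I p x :=
  (contMDiff_adInv (I := I) (K := K)).continuous.clm_apply continuous_const

/-- Average the inner product of the model space over Haar measure. Since `adInv` reverses the order
of products, left invariance of the measure is what is needed. -/
theorem exists_invariant_inner [CompactSpace K] :
    ∃ h : LinearMap.BilinForm ℝ E, (∀ x y, h x y = h y x) ∧ (∀ x, x ≠ 0 → 0 < h x x) ∧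
      ∀ (p : K) x y, h (adInv I p x) (adInv I p y) = h x y := by
  let _ : MeasurableSpace K := borel K
  have : BorelSpace K := ⟨rfl⟩
  have : IsTopologicalGroup K := topologicalGroup_of_lieGroup I ∞
  let μ : Measure K := Measure.haar
  have hcont : ∀ x y : E, Continuous fun p : K => inner ℝ (adInv I p x) (adInv I p y) :=
    fun x y => (continuous_adInv_apply x).inner (continuous_adInv_apply y)
  have hint : ∀ x y : E, Integrable (fun p : K => inner ℝ (adInv I p x) (adInv I p y)) μ :=
    fun x y => (hcont x y).integrable_of_hasCompactSupport (HasCompactSupport.of_compactSpace _)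
  refine ⟨LinearMap.mk₂ ℝ (fun x y => ∫ p, inner ℝ (adInv I p x) (adInv I p y) ∂μ) ?_ ?_ ?_ ?_,
    ?_, ?_, ?_⟩
  · intro x x' y
    simp only [map_add, inner_add_left]
    exact integral_add (hint x y) (hint x' y)
  · intro c x y
    simp only [map_smul, inner_smul_left]
    exact integral_const_mul _ _
  · intro x y y'
    simp only [map_add, inner_add_right]
    exact integral_add (hint x y) (hint x y')
  · intro c x y
    simp only [map_smul, inner_smul_right]
    exact integral_const_mul _ _
  · intro x y
    simp only [LinearMap.mk₂_apply, real_inner_comm]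
  · intro x hx
    simp only [LinearMap.mk₂_apply]
    -- The integrand is continuous, nonnegative and positive at the identity, where Ad is trivial.
    refine (hcont x x).integral_pos_of_hasCompactSupport_nonneg_nonzero
      (HasCompactSupport.of_compactSpace _) (fun p => real_inner_self_nonneg) (x := 1) ?_
    rw [adInv_one]
    simpa using hx
  · intro p x y
    simp only [LinearMap.mk₂_apply, adInv_adInv]
    exact integral_mul_left_eq_self (fun q : K => inner ℝ (adInv I q x) (adInv I q y)) p

/-- Differentiate the constant function `p ↦ h (adInv I p y) (adInv I p z)` at the identity in the
direction x. -/
theorem invariant_of_adInv_invariant (h : LinearMap.BilinForm ℝ E)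
    (hAd : ∀ (p : K) x y, h (adInv I p x) (adInv I p y) = h x y) (x y z : E) :
    h (bracketE I K x y) z = -h y (bracketE I K x z) := by
  let B : E →L[ℝ] E →L[ℝ] ℝ := LinearMap.toContinuousLinearMap
    ((LinearMap.toContinuousLinearMap (𝕜 := ℝ) (E := E) (F' := ℝ)).toLinearMap ∘ₗ h)
  have hd : ∀ w : E, MDiffAt (fun p : K => adInv I p w) 1 := fun w =>
    (mvfderiv_clm_comp (ContinuousLinearMap.apply ℝ E w)
      ((contMDiff_adInv (I := I) (K := K)).mdifferentiableAt (by simp) (x := 1))).1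
  have h1 := mvfderiv_bilin B (hd y) (hd z) (id (α := E) x)
  have h2 : (fun q : K => B (adInv I q y) (adInv I q z)) = fun _ => B y z :=
    funext fun q => hAd q y z
  rw [h2, mvfderiv_const, mvfderiv_adInv_one, mvfderiv_adInv_one, adInv_one, adInv_one] at h1
  have h3 : (0 : ℝ) = h (-bracketE I K x y) z + h y (-bracketE I K x z) := h1
  simp only [map_neg, LinearMap.neg_apply] at h3
  linarith

theorem killingForm_neg_of_compact [CompactSpace K]
    (hc : LieAlgebra.center ℝ (GroupLieAlgebra I K) = ⊥) {x : GroupLieAlgebra I K} (hx : x ≠ 0) :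
    killingForm ℝ (GroupLieAlgebra I K) x x < 0 := by
  obtain ⟨h, hs, hpos, hAd⟩ := exists_invariant_inner (I := I) (K := K)
  have : FiniteDimensional ℝ (GroupLieAlgebra I K) := inferInstanceAs (FiniteDimensional ℝ E)
  exact killingForm_neg_of_invariant (L := GroupLieAlgebra I K) h hs hpos
    (fun x y z => invariant_of_adInv_invariant h hAd x y z) hc hx

theorem adInv_of_comm {T : Type*} [TopologicalSpace T] [ChartedSpace H T] [CommGroup T]
    [LieGroup I ∞ T] (p : T) (v : E) : adInv I p v = v := by
  refine Eq.trans ?_ (adInv_one (I := I) (K := T) v)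
  unfold adInv
  congr 3
  ext q; simp

/-- The Lie algebra of a commutative Lie group is abelian. -/
theorem bracketE_eq_zero_of_comm {T : Type*} [TopologicalSpace T] [ChartedSpace H T] [CommGroup T]
    [LieGroup I ∞ T] (x y : E) : bracketE I T x y = 0 := by
  have h := mvfderiv_adInv_one (I := I) (K := T) x y
  have h2 : (fun p : T => adInv I p y) = fun _ => y := funext fun p => adInv_of_comm p y
  rw [h2, mvfderiv_const] at h
  exact neg_eq_zero.1 h.symm

/-- `Ad(p⁻¹)` is an automorphism of the Lie algebra, and automorphisms preserve the Killing form.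
Arguing on the group level avoids any connectedness of `K`. -/
theorem killingForm_adInv (p : K) (x y : GroupLieAlgebra I K) :
    killingForm ℝ (GroupLieAlgebra I K) (adInv I p x) (adInv I p y) =
      killingForm ℝ (GroupLieAlgebra I K) x y := by
  have hl : ∀ v : E, adInv I p⁻¹ (adInv I p v) = v := fun v => by
    rw [adInv_adInv, mul_inv_cancel, adInv_one]
  have hr : ∀ v : E, adInv I p (adInv I p⁻¹ v) = v := fun v => by
    rw [adInv_adInv, inv_mul_cancel, adInv_one]
  let e : GroupLieAlgebra I K ≃ₗ⁅ℝ⁆ GroupLieAlgebra I K :=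
    { toFun := adInv I p
      map_add' := fun v w => (adInv I p).map_add v w
      map_smul' := fun c v => (adInv I p).map_smul c v
      map_lie' := fun {x y} => adInv_bracketE (I := I) (E := E) p x y
      invFun := adInv I p⁻¹
      left_inv := hl
      right_inv := hr }
  exact LieAlgebra.killingForm_of_equiv_apply e x y

end Compact

/-! ### Imaginary quaternions -/

section ImaginaryQuaternions

attribute [local instance] LieRing.ofAssociativeRing

theorem sp1_re (p : sp1) : (p : ℍ[ℝ]).re = 0 := p.2

theorem sp1_ext {p q : sp1} (hi : (p : ℍ[ℝ]).imI = (q : ℍ[ℝ]).imI)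
    (hj : (p : ℍ[ℝ]).imJ = (q : ℍ[ℝ]).imJ) (hk : (p : ℍ[ℝ]).imK = (q : ℍ[ℝ]).imK) : p = q :=
  Subtype.ext (QuaternionAlgebra.ext (p.2.trans q.2.symm) hi hj hk)

theorem sp1_lie_imI (p q : sp1) : ((⁅p, q⁆ : sp1) : ℍ[ℝ]).imI =
    2 * ((p : ℍ[ℝ]).imJ * (q : ℍ[ℝ]).imK - (p : ℍ[ℝ]).imK * (q : ℍ[ℝ]).imJ) := by
  change ((p : ℍ[ℝ]) * q - q * p).imI = _
  simp [sp1_re]; ring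

theorem sp1_lie_imJ (p q : sp1) : ((⁅p, q⁆ : sp1) : ℍ[ℝ]).imJ =
    2 * ((p : ℍ[ℝ]).imK * (q : ℍ[ℝ]).imI - (p : ℍ[ℝ]).imI * (q : ℍ[ℝ]).imK) := by
  change ((p : ℍ[ℝ]) * q - q * p).imJ = _
  simp [sp1_re]; ring

theorem sp1_lie_imK (p q : sp1) : ((⁅p, q⁆ : sp1) : ℍ[ℝ]).imK =
    2 * ((p : ℍ[ℝ]).imI * (q : ℍ[ℝ]).imJ - (p : ℍ[ℝ]).imJ * (q : ℍ[ℝ]).imI) := by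
  change ((p : ℍ[ℝ]) * q - q * p).imK = _
  simp [sp1_re]; ring

theorem sp1_smul_imI (c : ℝ) (p : sp1) :
    ((c • p : sp1) : ℍ[ℝ]).imI = c * (p : ℍ[ℝ]).imI := rfl

theorem sp1_smul_imJ (c : ℝ) (p : sp1) :
    ((c • p : sp1) : ℍ[ℝ]).imJ = c * (p : ℍ[ℝ]).imJ := rfl

theorem sp1_smul_imK (c : ℝ) (p : sp1) :
    ((c • p : sp1) : ℍ[ℝ]).imK = c * (p : ℍ[ℝ]).imK := rfl

theorem sp1_add_imI (p q : sp1) :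
    ((p + q : sp1) : ℍ[ℝ]).imI = (p : ℍ[ℝ]).imI + (q : ℍ[ℝ]).imI := rfl

theorem sp1_add_imJ (p q : sp1) :
    ((p + q : sp1) : ℍ[ℝ]).imJ = (p : ℍ[ℝ]).imJ + (q : ℍ[ℝ]).imJ := rfl

theorem sp1_add_imK (p q : sp1) :
    ((p + q : sp1) : ℍ[ℝ]).imK = (p : ℍ[ℝ]).imK + (q : ℍ[ℝ]).imK := rfl

theorem imUnit_imI (a : Fin 3) : (imUnit a : ℍ[ℝ]).imI = if a = 0 then 1 else 0 := by
  fin_cases a <;> rfl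

theorem imUnit_imJ (a : Fin 3) : (imUnit a : ℍ[ℝ]).imJ = if a = 1 then 1 else 0 := by
  fin_cases a <;> rfl

theorem imUnit_imK (a : Fin 3) : (imUnit a : ℍ[ℝ]).imK = if a = 2 then 1 else 0 := by
  fin_cases a <;> rfl

theorem imUnit_lie (a : Fin 3) : ⁅imUnit a, imUnit (a + 1)⁆ = (2 : ℝ) • imUnit (a + 2) := by
  fin_cases a <;> apply sp1_ext <;>
    simp [sp1_lie_imI, sp1_lie_imJ, sp1_lie_imK,
      imUnit_imI, imUnit_imJ, imUnit_imK, -LieSubalgebra.coe_bracket, -SetLike.val_smul]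

theorem sp1_eq_sum (p : sp1) : p = (p : ℍ[ℝ]).imI • imUnit 0 + (p : ℍ[ℝ]).imJ • imUnit 1 +
    (p : ℍ[ℝ]).imK • imUnit 2 := by
  apply sp1_ext <;>
    simp only [sp1_add_imI, sp1_add_imJ, sp1_add_imK, sp1_smul_imI, sp1_smul_imJ, sp1_smul_imK,
      imUnit_imI, imUnit_imJ, imUnit_imK] <;> simp

/-- The square of the norm of an imaginary quaternion. -/
def sp1NormSq (p : sp1) : ℝ := (p : ℍ[ℝ]).imI ^ 2 + (p : ℍ[ℝ]).imJ ^ 2 + (p : ℍ[ℝ]).imK ^ 2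

theorem sp1_mul_self_mul (p : sp1) (q : ℍ[ℝ]) : (p : ℍ[ℝ]) * (p * q) = (-sp1NormSq p) • q := by
  have h := sp1_re p
  ext <;> simp only [Quaternion.re_mul, Quaternion.imI_mul, Quaternion.imJ_mul, Quaternion.imK_mul,
    h, sp1NormSq, Quaternion.re_smul, Quaternion.imI_smul, Quaternion.imJ_smul,
    Quaternion.imK_smul, smul_eq_mul] <;> ring

/-- This expresses the norm of an imaginary quaternion by the bracket alone, which is why
automorphisms preserve it. -/
theorem sp1_lie_lie_lie (p q : sp1) : ⁅p, ⁅p, ⁅p, q⁆⁆⁆ = (-(4 * sp1NormSq p)) • ⁅p, q⁆ := by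
  apply sp1_ext <;>
    simp only [sp1_lie_imI, sp1_lie_imJ, sp1_lie_imK, sp1_smul_imI, sp1_smul_imJ, sp1_smul_imK,
      sp1NormSq] <;> ring

theorem sp1NormSq_ne_zero {p : sp1} (hp : p ≠ 0) : sp1NormSq p ≠ 0 := by
  intro h
  unfold sp1NormSq at h
  apply hp
  have h1 := sq_nonneg (p : ℍ[ℝ]).imI
  have h2 := sq_nonneg (p : ℍ[ℝ]).imJ
  have h3 := sq_nonneg (p : ℍ[ℝ]).imK
  have hi : (p : ℍ[ℝ]).imI ^ 2 = 0 := by linarith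
  have hj : (p : ℍ[ℝ]).imJ ^ 2 = 0 := by linarith
  have hk : (p : ℍ[ℝ]).imK ^ 2 = 0 := by linarith
  exact sp1_ext (pow_eq_zero_iff two_ne_zero |>.1 hi) (pow_eq_zero_iff two_ne_zero |>.1 hj)
    (pow_eq_zero_iff two_ne_zero |>.1 hk)

/-- Elements of `𝔰𝔭(1)` that commute with a nonzero element are multiples of it. -/
theorem sp1_exists_smul_of_lie_eq_zero {p q : sp1} (hp : p ≠ 0) (h : ⁅p, q⁆ = 0) :
    ∃ c : ℝ, q = c • p := by
  have hN := sp1NormSq_ne_zero hp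
  have hi := sp1_lie_imI p q
  have hj := sp1_lie_imJ p q
  have hk := sp1_lie_imK p q
  rw [h] at hi hj hk
  have hi' : (0 : ℝ) = 2 * ((p : ℍ[ℝ]).imJ * (q : ℍ[ℝ]).imK -
    (p : ℍ[ℝ]).imK * (q : ℍ[ℝ]).imJ) := hi
  have hj' : (0 : ℝ) = 2 * ((p : ℍ[ℝ]).imK * (q : ℍ[ℝ]).imI -
    (p : ℍ[ℝ]).imI * (q : ℍ[ℝ]).imK) := hj
  have hk' : (0 : ℝ) = 2 * ((p : ℍ[ℝ]).imI * (q : ℍ[ℝ]).imJ -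
    (p : ℍ[ℝ]).imJ * (q : ℍ[ℝ]).imI) := hk
  unfold sp1NormSq at hN
  -- The coefficient is the scalar product of p and q divided by the square of the norm of p; the
  -- three hypotheses say that the cross product vanishes.
  refine ⟨((p : ℍ[ℝ]).imI * (q : ℍ[ℝ]).imI + (p : ℍ[ℝ]).imJ * (q : ℍ[ℝ]).imJ +
    (p : ℍ[ℝ]).imK * (q : ℍ[ℝ]).imK) / ((p : ℍ[ℝ]).imI ^ 2 + (p : ℍ[ℝ]).imJ ^ 2 +
    (p : ℍ[ℝ]).imK ^ 2), ?_⟩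
  apply sp1_ext <;> simp only [sp1_smul_imI, sp1_smul_imJ, sp1_smul_imK] <;> field_simp
  · linear_combination (-(p : ℍ[ℝ]).imK / 2) * hj' + ((p : ℍ[ℝ]).imJ / 2) * hk'
  · linear_combination ((p : ℍ[ℝ]).imK / 2) * hi' - ((p : ℍ[ℝ]).imI / 2) * hk'
  · linear_combination (-(p : ℍ[ℝ]).imJ / 2) * hi' + ((p : ℍ[ℝ]).imI / 2) * hj'

theorem exists_sp1_lie_ne_zero {p : sp1} (hp : p ≠ 0) : ∃ q : sp1, ⁅p, q⁆ ≠ 0 := by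
  by_contra! h
  apply hp
  have hj := (sp1_lie_imJ p (imUnit 2)).symm.trans (congrArg (fun x : sp1 => (x : ℍ[ℝ]).imJ) (h _))
  have hi := (sp1_lie_imI p (imUnit 2)).symm.trans (congrArg (fun x : sp1 => (x : ℍ[ℝ]).imI) (h _))
  have hk := (sp1_lie_imI p (imUnit 1)).symm.trans (congrArg (fun x : sp1 => (x : ℍ[ℝ]).imI) (h _))
  simp [imUnit_imI, imUnit_imJ, imUnit_imK] at hi hj hk
  apply sp1_ext <;> simp [hi, hj, hk]

theorem sp1NormSq_equiv (σ : sp1 ≃ₗ⁅ℝ⁆ sp1) (p : sp1) :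
    sp1NormSq (σ p) = sp1NormSq p := by
  rcases eq_or_ne p 0 with rfl | hp
  · simp
  obtain ⟨q, hq⟩ := exists_sp1_lie_ne_zero hp
  have h1 := congrArg σ (sp1_lie_lie_lie p q)
  have h2 := sp1_lie_lie_lie (σ p) (σ q)
  simp only [LieEquiv.map_lie, map_smul] at h1
  rw [h1] at h2
  have h3 : ⁅σ p, σ q⁆ ≠ 0 := by
    rw [← LieEquiv.map_lie]
    intro h
    exact hq (σ.injective (h.trans (map_zero _).symm))
  have h4 := smul_left_injective ℝ h3 h2
  linarith

end ImaginaryQuaternions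

/-! ### The quaternionic action of ∂ⱼ on 𝔣ⱼ -/

section QuaternionicStep

variable {L : Type*} [LieRing L] [LieAlgebra ℝ L]

/-- The elements `e 0, e 1, e 2` satisfy the relations of the imaginary units of `𝔰𝔭(1)`, act on
`F` as the left multiplications by the imaginary units and commute with `Q`. -/
structure IsQuaternionicTriple (e : Fin 3 → L) (F Q : Submodule ℝ L) : Prop where
  lie_succ : ∀ a, ⁅e a, e (a + 1)⁆ = (2 : ℝ) • e (a + 2)
  lie_mem : ∀ a, ∀ v ∈ F, ⁅e a, v⁆ ∈ F
  sq : ∀ a, ∀ v ∈ F, ⁅e a, ⁅e a, v⁆⁆ = -v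
  mul : ∀ a, ∀ v ∈ F, ⁅e a, ⁅e (a + 1), v⁆⁆ = ⁅e (a + 2), v⁆
  comm : ∀ a, ∀ q ∈ Q, ⁅e a, q⁆ = 0

/-- The representation comes with its own parametrization of `s`, which need not be the chosen `φ`.
The two differ by an automorphism of 𝔰𝔭(1), and this preserves the norm, so squares of the action
are the same scalars. -/
theorem lie_lie_of_standardRep {s : LieSubalgebra ℝ L} {F : Submodule ℝ L}
    (h : IsSumOfStandardRep s F) (φ : sp1 ≃ₗ⁅ℝ⁆ s) (p : sp1) {v : L} (hv : v ∈ F) :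
    ⁅(φ p : L), ⁅(φ p : L), v⁆⁆ = (-sp1NormSq p) • v := by
  obtain ⟨N, φ', ψ, hψ⟩ := h
  obtain ⟨w, hw⟩ : ∃ w, ψ w = ⟨v, hv⟩ := ψ.surjective _
  have h1 : v = (ψ w : L) := by rw [hw]
  have h2 : φ p = φ' (φ.trans φ'.symm p) := by simp
  rw [h1, h2, ← hψ, ← hψ]
  simp only [sp1_mul_self_mul, sp1NormSq_equiv]
  rw [← Submodule.coe_smul, ← map_smul]
  rfl

theorem isQuaternionicTriple_of_standardRep {s : LieSubalgebra ℝ L} {F Q : Submodule ℝ L}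
    (h : IsSumOfStandardRep s F) (hF : ∀ x ∈ s, ∀ v ∈ F, ⁅x, v⁆ ∈ F)
    (hQ : ∀ x ∈ Q, ∀ y ∈ s, ⁅x, y⁆ = 0) (φ : sp1 ≃ₗ⁅ℝ⁆ s) :
    IsQuaternionicTriple (fun a => (φ (imUnit a) : L)) F Q := by
  have hlie : ∀ a, ⁅(φ (imUnit a) : L), (φ (imUnit (a + 1)) : L)⁆ =
      (2 : ℝ) • (φ (imUnit (a + 2)) : L) := by
    intro a
    rw [← LieSubalgebra.coe_bracket, ← LieEquiv.map_lie, imUnit_lie, map_smul]; rfl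
  have hsq : ∀ a, ∀ v ∈ F, ⁅(φ (imUnit a) : L), ⁅(φ (imUnit a) : L), v⁆⁆ = -v := by
    intro a v hv
    rw [lie_lie_of_standardRep h φ _ hv]
    have h1 : sp1NormSq (imUnit a) = 1 := by
      fin_cases a <;> simp [sp1NormSq, imUnit_imI, imUnit_imJ, imUnit_imK]
    rw [h1, neg_one_smul]
  refine ⟨hlie, fun a v hv => hF _ (φ (imUnit a)).2 v hv, hsq, fun a v hv => ?_, fun a q hq => ?_⟩
  -- Polarization: the square of the action of the sum of two units is -2, so the units anticommute
  -- on `F`. Together with the commutator relation this gives their product.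
  · have h1 := lie_lie_of_standardRep h φ (imUnit a + imUnit (a + 1)) hv
    have h2 : sp1NormSq (imUnit a + imUnit (a + 1)) = 2 := by
      obtain rfl | rfl | rfl : a = 0 ∨ a = 1 ∨ a = 2 := by lia
      all_goals
        simp [sp1NormSq, sp1_add_imI, sp1_add_imJ, sp1_add_imK, imUnit_imI, imUnit_imJ,
          imUnit_imK, -AddMemClass.coe_add]
      all_goals norm_num
    rw [h2, map_add] at h1
    have h3 := lie_lie (φ (imUnit a) : L) (φ (imUnit (a + 1)) : L) v
    rw [hlie] at h3
    have h6 : ((φ (imUnit a) + φ (imUnit (a + 1)) : s) : L) =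
      (φ (imUnit a) : L) + (φ (imUnit (a + 1)) : L) := rfl
    rw [h6] at h1
    simp only [add_lie, lie_add, hsq _ v hv, smul_lie] at h1 h3
    have h4 : (2 : ℝ) • ⁅(φ (imUnit a) : L), ⁅(φ (imUnit (a + 1)) : L), v⁆⁆ =
        (2 : ℝ) • ⁅(φ (imUnit (a + 2)) : L), v⁆ := by
      rw [h3]
      have h5 : ⁅(φ (imUnit (a + 1)) : L), ⁅(φ (imUnit a) : L), v⁆⁆ =
        -⁅(φ (imUnit a) : L), ⁅(φ (imUnit (a + 1)) : L), v⁆⁆ := by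
        linear_combination (norm := module) h1
      rw [h5]; module
    exact smul_right_injective L (two_ne_zero (α := ℝ)) h4
  · rw [← lie_skew, hQ q hq _ (φ (imUnit a)).2, neg_zero]

end QuaternionicStep

/-! ### One step of the decomposition: orthogonality and the Casimir operator -/

section QuaternionicStep

variable {L : Type*} [LieRing L] [LieAlgebra ℝ L]

/-- Indices of units are cyclic modulo 3, so each relation is needed only for `a`, `a + 1`, `a + 2`
with `a` arbitrary. -/
theorem fin_three_add (a : Fin 3) :
    a + 1 + 1 = a + 2 ∧ a + 1 + 2 = a ∧ a + 2 + 1 = a ∧ a + 2 + 2 = a + 1 := by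
  revert a; decide

theorem fin_three_eq (a b : Fin 3) : b = a ∨ b = a + 1 ∨ b = a + 2 := by
  revert a b; decide

theorem fin_three_sum {M : Type*} [AddCommMonoid M] (f : Fin 3 → M) (a : Fin 3) :
    ∑ b, f b = f a + f (a + 1) + f (a + 2) := by
  obtain rfl | rfl | rfl : a = 0 ∨ a = 1 ∨ a = 2 := by lia
  · exact Fin.sum_univ_three f
  · rw [Fin.sum_univ_three f]
    change f 0 + f 1 + f 2 = f 1 + f 2 + f 0
    abel
  · rw [Fin.sum_univ_three f]
    change f 0 + f 1 + f 2 = f 2 + f 0 + f 1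
    abel

namespace IsQuaternionicTriple

variable {e : Fin 3 → L} {F Q : Submodule ℝ L} (h : IsQuaternionicTriple e F Q)
include h

theorem lie_succ_two (a : Fin 3) : ⁅e (a + 1), e (a + 2)⁆ = (2 : ℝ) • e a := by
  have := h.lie_succ (a + 1)
  rwa [(fin_three_add a).1, (fin_three_add a).2.1] at this

theorem lie_two_self (a : Fin 3) : ⁅e (a + 2), e a⁆ = (2 : ℝ) • e (a + 1) := by
  have := h.lie_succ (a + 2)
  rwa [(fin_three_add a).2.2.1, (fin_three_add a).2.2.2] at this

theorem lie_self_two (a : Fin 3) : ⁅e a, e (a + 2)⁆ = -((2 : ℝ) • e (a + 1)) := by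
  rw [← lie_skew, h.lie_two_self]

theorem lie_succ_self (a : Fin 3) : ⁅e (a + 1), e a⁆ = -((2 : ℝ) • e (a + 2)) := by
  rw [← lie_skew, h.lie_succ]

theorem lie_two_succ (a : Fin 3) : ⁅e (a + 2), e (a + 1)⁆ = -((2 : ℝ) • e a) := by
  rw [← lie_skew, h.lie_succ_two]

theorem mul_swap (a : Fin 3) {v : L} (hv : v ∈ F) : ⁅e (a + 1), ⁅e a, v⁆⁆ = -⁅e (a + 2), v⁆ := by
  have h1 := lie_lie (e a) (e (a + 1)) v
  rw [h.lie_succ, h.mul a v hv, smul_lie] at h1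
  linear_combination (norm := module) h1

theorem mul_two_self (a : Fin 3) {v : L} (hv : v ∈ F) : ⁅e (a + 2), ⁅e a, v⁆⁆ = ⁅e (a + 1), v⁆ := by
  have := h.mul (a + 2) v hv
  rwa [(fin_three_add a).2.2.1, (fin_three_add a).2.2.2] at this

theorem mul_self_two (a : Fin 3) {v : L} (hv : v ∈ F) :
    ⁅e a, ⁅e (a + 2), v⁆⁆ = -⁅e (a + 1), v⁆ := by
  have := h.mul_swap (a + 2) hv
  rwa [(fin_three_add a).2.2.1, (fin_three_add a).2.2.2] at this

theorem lie_lie_comm {q : L} (hq : q ∈ Q) (a : Fin 3) (v : L) : ⁅q, ⁅e a, v⁆⁆ = ⁅e a, ⁅q, v⁆⁆ := by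
  rw [leibniz_lie (e a) q v, h.comm a q hq, zero_lie, zero_add]

section Form

variable {B : LinearMap.BilinForm ℝ L} (hinv : ∀ x y z : L, B ⁅x, y⁆ z = B x ⁅y, z⁆)
include hinv

omit h in
theorem form_lie_left (x y z : L) : B ⁅x, y⁆ z = -B y ⁅x, z⁆ := by
  rw [← lie_skew, map_neg, LinearMap.neg_apply, hinv]

/-- A unit is half the bracket of the other two, and by invariance this bracket can be moved onto
`q`, where it vanishes. -/
theorem form_e_Q (a : Fin 3) {q : L} (hq : q ∈ Q) : B (e a) q = 0 := by
  have h1 : B (e a) q = (2⁻¹ : ℝ) * B ⁅e (a + 1), e (a + 2)⁆ q := by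
    rw [h.lie_succ_two, map_smul, LinearMap.smul_apply, smul_eq_mul]; ring
  rw [h1, hinv, h.comm _ q hq, map_zero, mul_zero]

theorem form_e_F (a : Fin 3) {v : L} (hv : v ∈ F) : B (e a) v = 0 := by
  have h1 := h.sq a v hv
  have h2 := hinv (e a) (e a) ⁅e a, v⁆
  rw [h1, lie_self, map_neg] at h2
  simpa using h2.symm

/-- Every `v` in `F` is minus `⁅e 0, ⁅e 0, v⁆⁆`, and `e 0` commutes with `q`. -/
theorem form_F_Q {v q : L} (hv : v ∈ F) (hq : q ∈ Q) : B v q = 0 := by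
  have h1 := h.sq 0 v hv
  have h2 := form_lie_left hinv (e 0) ⁅e 0, v⁆ q
  rw [h1, h.comm 0 q hq] at h2
  simpa using h2

theorem form_e_succ (a : Fin 3) : B (e a) (e (a + 1)) = 0 := by
  have h1 := hinv (e (a + 1)) (e (a + 2)) (e (a + 1))
  have h2 := hinv (e a) (e (a + 1)) (e (a + 1))
  have h3 := form_lie_left hinv (e (a + 1)) (e (a + 2)) (e (a + 1))
  rw [h.lie_succ_two, lie_self, map_zero] at h3
  simpa using h3

theorem form_e_two (a : Fin 3) : B (e a) (e (a + 2)) = 0 := by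
  have h3 := hinv (e (a + 1)) (e (a + 2)) (e (a + 2))
  rw [h.lie_succ_two, lie_self, map_zero] at h3
  simpa using h3

theorem form_e_e_succ (a : Fin 3) : B (e (a + 1)) (e (a + 1)) = B (e a) (e a) := by
  have h1 := hinv (e (a + 1)) (e (a + 2)) (e a)
  rw [h.lie_succ_two, h.lie_two_self, map_smul, map_smul] at h1
  simpa using h1.symm

theorem form_e_e (a : Fin 3) : B (e a) (e a) = B (e 0) (e 0) := by
  have h1 := h.form_e_e_succ hinv 0
  have h2 := h.form_e_e_succ hinv 1
  obtain rfl | rfl | rfl : a = 0 ∨ a = 1 ∨ a = 2 := by lia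
  · rfl
  · exact h1
  · exact h2.trans h1

theorem form_e_e_of_ne {a b : Fin 3} (hab : a ≠ b) : B (e a) (e b) = 0 := by
  obtain rfl | rfl | rfl := fin_three_eq a b
  · exact absurd rfl hab
  · exact h.form_e_succ hinv a
  · exact h.form_e_two hinv a

end Form

section Casimir

omit h in
/-- The Casimir operator of the triple `e`. -/
def _root_.tripleCasimir (e : Fin 3 → L) : Module.End ℝ L :=
  ∑ a, LieAlgebra.ad ℝ L (e a) * LieAlgebra.ad ℝ L (e a)

omit h in
theorem _root_.tripleCasimir_apply (e : Fin 3 → L) (x : L) :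
    tripleCasimir e x = ∑ a, ⁅e a, ⁅e a, x⁆⁆ := by
  simp [tripleCasimir]

theorem casimir_e (a : Fin 3) : tripleCasimir e (e a) = (-8 : ℝ) • e a := by
  rw [tripleCasimir_apply, fin_three_sum _ a, h.lie_succ_self, h.lie_two_self, lie_self, lie_neg,
    lie_smul, lie_smul, h.lie_succ_two, h.lie_two_succ, lie_zero]
  module

theorem casimir_F {v : L} (hv : v ∈ F) : tripleCasimir e v = (-3 : ℝ) • v := by
  rw [tripleCasimir_apply, Fin.sum_univ_three, h.sq _ v hv, h.sq _ v hv, h.sq _ v hv]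
  module

theorem casimir_Q {q : L} (hq : q ∈ Q) : tripleCasimir e q = 0 := by
  rw [tripleCasimir_apply]
  exact Finset.sum_eq_zero fun a _ => by rw [h.comm a q hq, lie_zero]

/-- The eigenvalues -8, -3 and 0 are distinct, so applying the operator once and twice isolates the
three components. Directness of the sum is not needed for this. -/
theorem casimir_decomposition (c : Fin 3 → ℝ) {v q : L} (hv : v ∈ F) (hq : q ∈ Q) :
    tripleCasimir e (∑ a, c a • e a + v + q) = (-8 : ℝ) • ∑ a, c a • e a + (-3 : ℝ) • v := by
  rw [map_add, map_add, h.casimir_F hv, h.casimir_Q hq, add_zero, map_sum, Finset.smul_sum]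
  congr 1
  exact Finset.sum_congr rfl fun a _ => by rw [map_smul, h.casimir_e, smul_comm]

omit h in
theorem _root_.tripleCasimir_lie (e : Fin 3 → L) (x y : L) :
    tripleCasimir e ⁅x, y⁆ = ⁅tripleCasimir e x, y⁆ + (2 : ℝ) • ∑ a, ⁅⁅e a, x⁆, ⁅e a, y⁆⁆ +
      ⁅x, tripleCasimir e y⁆ := by
  simp only [tripleCasimir_apply, sum_lie, lie_sum, Finset.smul_sum,
    ← Finset.sum_add_distrib]
  refine Finset.sum_congr rfl fun a _ => ?_
  rw [leibniz_lie (e a) x y, lie_add, leibniz_lie (e a) ⁅e a, x⁆ y, leibniz_lie (e a) x ⁅e a, y⁆]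
  module

/-- The sum of the span of the triple and of the subspaces `F` and `Q`. -/
structure _root_.IsTripleTotal (e : Fin 3 → L) (F Q P : Submodule ℝ L) : Prop where
  mem_iff : ∀ x, x ∈ P ↔ ∃ c : Fin 3 → ℝ, ∃ v ∈ F, ∃ q ∈ Q, x = ∑ a, c a • e a + v + q
  lie_mem : ∀ x ∈ P, ∀ y ∈ P, ⁅x, y⁆ ∈ P

variable {P : Submodule ℝ L} (hP : IsTripleTotal e F Q P)
include hP

omit h in
theorem _root_.IsTripleTotal.F_le : F ≤ P := fun v hv =>
  (hP.mem_iff v).2 ⟨0, v, hv, 0, Q.zero_mem, by simp⟩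

omit h in
theorem _root_.IsTripleTotal.Q_le : Q ≤ P := fun q hq =>
  (hP.mem_iff q).2 ⟨0, 0, F.zero_mem, q, hq, by simp⟩

/-- An element that commutes with the triple is killed by the Casimir operator, hence has only its
`Q` component. So `Q` is the centralizer of the triple in `P`. -/
theorem mem_Q_of_comm {x : L} (hx : x ∈ P) (hc : ∀ a, ⁅e a, x⁆ = 0) : x ∈ Q := by
  obtain ⟨c, v, hv, q, hq, rfl⟩ := (hP.mem_iff x).1 hx
  have h1 : tripleCasimir e (∑ a, c a • e a + v + q) = 0 := by
    rw [tripleCasimir_apply]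
    exact Finset.sum_eq_zero fun a _ => by rw [hc, lie_zero]
  have h2 := congrArg (tripleCasimir e) (h.casimir_decomposition c hv hq)
  have h3 := h.casimir_decomposition c hv hq
  have h4 := h.casimir_decomposition ((-8 : ℝ) • c) (F.smul_mem (-3) hv) Q.zero_mem
  simp only [Pi.smul_apply, smul_eq_mul, mul_smul, ← Finset.smul_sum, add_zero] at h4
  rw [h4, h1, map_zero] at h2
  rw [h1] at h3
  have h5 : v = 0 := by
    have : (-15 : ℝ) • v = 0 := by linear_combination (norm := module) (-8 : ℝ) • h3 - h2
    exact (smul_eq_zero.1 this).resolve_left (by norm_num)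
  have h6 : ∑ a, c a • e a = 0 := by
    rw [h5, smul_zero, add_zero] at h3
    exact (smul_eq_zero.1 h3.symm).resolve_left (by norm_num)
  rwa [h5, h6, zero_add, zero_add]

theorem lie_Q_mem {x y : L} (hx : x ∈ Q) (hy : y ∈ Q) : ⁅x, y⁆ ∈ Q := by
  refine h.mem_Q_of_comm hP (hP.lie_mem x (hP.Q_le hx) y (hP.Q_le hy)) fun a => ?_
  rw [leibniz_lie, h.comm a x hx, h.comm a y hy, zero_lie, lie_zero, add_zero]

/-- The Casimir operator commutes with ad x for `x` in `Q`, so it still acts as -3 on the bracket,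
which therefore lies in `F`. -/
theorem lie_Q_F_mem {x v : L} (hx : x ∈ Q) (hv : v ∈ F) : ⁅x, v⁆ ∈ F := by
  obtain ⟨c, w, hw, q, hq, hz⟩ := (hP.mem_iff _).1 (hP.lie_mem x (hP.Q_le hx) v (hP.F_le hv))
  have h1 : tripleCasimir e ⁅x, v⁆ = (-3 : ℝ) • ⁅x, v⁆ := by
    rw [tripleCasimir_lie, h.casimir_Q hx, h.casimir_F hv, lie_smul, zero_lie, zero_add]
    simp [h.comm _ x hx]
  have h3 := h.casimir_decomposition c hw hq
  rw [← hz, h1] at h3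
  have h2 := congrArg (tripleCasimir e) h3
  have h4 := h.casimir_decomposition ((-8 : ℝ) • c) (F.smul_mem (-3) hw) Q.zero_mem
  simp only [Pi.smul_apply, smul_eq_mul, mul_smul, ← Finset.smul_sum, add_zero] at h4
  rw [map_smul, h1, h4] at h2
  have h5 : ∑ a, c a • e a = 0 := by
    have : (40 : ℝ) • ∑ a, c a • e a = 0 := by
      linear_combination (norm := module) (-3 : ℝ) • h3 - h2
    exact (smul_eq_zero.1 this).resolve_left (by norm_num)
  have h6 : ⁅x, v⁆ = w := by
    rw [h5] at h3
    have : (3 : ℝ) • (⁅x, v⁆ - w) = 0 := by linear_combination (norm := module) -h3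
    exact sub_eq_zero.1 ((smul_eq_zero.1 this).resolve_left (by norm_num))
  rwa [h6]

omit hP in
-- For fixed `a`, the product of the units b and a is -1 if b = a and plus or minus the third unit
-- otherwise. The signs occur twice and cancel in the bracket.
theorem casimir_sum {v w : L} (hv : v ∈ F) (hw : w ∈ F) :
    ∑ b, ∑ a, ⁅⁅e b, ⁅e a, v⁆⁆, ⁅e b, ⁅e a, w⁆⁆⁆ =
      (3 : ℝ) • ⁅v, w⁆ + (2 : ℝ) • ∑ a, ⁅⁅e a, v⁆, ⁅e a, w⁆⁆ := by
  have key : ∀ a, ∑ b, ⁅⁅e b, ⁅e a, v⁆⁆, ⁅e b, ⁅e a, w⁆⁆⁆ = ⁅v, w⁆ +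
      (∑ b, ⁅⁅e b, v⁆, ⁅e b, w⁆⁆ - ⁅⁅e a, v⁆, ⁅e a, w⁆⁆) := by
    intro a
    rw [fin_three_sum _ a, fin_three_sum _ a, h.sq a v hv, h.sq a w hw, h.mul_swap a hv,
      h.mul_swap a hw, h.mul_two_self a hv, h.mul_two_self a hw]
    simp only [neg_lie, lie_neg, neg_neg]
    abel
  rw [Finset.sum_comm, Finset.sum_congr rfl fun a _ => key a]
  simp only [Finset.sum_add_distrib, Finset.sum_sub_distrib, Finset.sum_const, Finset.card_univ,
    Fintype.card_fin]
  module

/-- The Casimir operator maps the span of `⁅v, w⁆` and `S` to itself with matrix entries -6, 2 and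
6, -2. Its eigenvalues there are -8 and 0, never -3, so the component in `F` must vanish. -/
theorem lie_F_F {v w : L} (hv : v ∈ F) (hw : w ∈ F) :
    ∃ c : Fin 3 → ℝ, ∃ q ∈ Q, ⁅v, w⁆ = ∑ a, c a • e a + q := by
  obtain ⟨c, z, hz, q, hq, hvw⟩ := (hP.mem_iff _).1 (hP.lie_mem v (hP.F_le hv) w (hP.F_le hw))
  set S := ∑ a, ⁅⁅e a, v⁆, ⁅e a, w⁆⁆ with hS
  have h1 : tripleCasimir e ⁅v, w⁆ = (-6 : ℝ) • ⁅v, w⁆ + (2 : ℝ) • S := by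
    rw [tripleCasimir_lie, h.casimir_F hv, h.casimir_F hw, smul_lie, lie_smul]
    module
  have h2 : tripleCasimir e S = (-2 : ℝ) • S + (6 : ℝ) • ⁅v, w⁆ := by
    have h3 : tripleCasimir e S = (-6 : ℝ) • S +
        (2 : ℝ) • ∑ a, ∑ b, ⁅⁅e b, ⁅e a, v⁆⁆, ⁅e b, ⁅e a, w⁆⁆⁆ := by
      rw [hS, map_sum, Finset.smul_sum, Finset.smul_sum, ← Finset.sum_add_distrib]
      refine Finset.sum_congr rfl fun a _ => ?_
      rw [tripleCasimir_lie, h.casimir_F (h.lie_mem a v hv), h.casimir_F (h.lie_mem a w hw),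
        smul_lie, lie_smul]
      module
    rw [h3, Finset.sum_comm, h.casimir_sum hv hw]
    module
  have h3 := h.casimir_decomposition c hz hq
  have h4 := h.casimir_decomposition ((-8 : ℝ) • c) (F.smul_mem (-3) hz) Q.zero_mem
  simp only [Pi.smul_apply, smul_eq_mul, mul_smul, ← Finset.smul_sum, add_zero] at h4
  have h5 := congrArg (tripleCasimir e) h1
  rw [map_add, map_smul, map_smul, h2, h1] at h5
  rw [← hvw, h1] at h3
  have h6 := congrArg (tripleCasimir e) h3
  rw [map_add, map_smul, map_smul, h2, h1, h4] at h6
  have h7 : z = 0 := by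
    have : (15 : ℝ) • z = 0 := by linear_combination (norm := module) h6 + (8 : ℝ) • h3
    exact (smul_eq_zero.1 this).resolve_left (by norm_num)
  refine ⟨c, q, hq, ?_⟩
  rw [hvw, h7, add_zero]

end Casimir

end IsQuaternionicTriple

end QuaternionicStep

/-! ### The Nijenhuis tensor on a Lie algebra -/

section AlgebraicNijenhuis

variable {W : Type*} [LieRing W] [LieAlgebra ℝ W]

/-- The Nijenhuis tensor of the left-invariant endomorphism field given by `A`. -/
def lieNijenhuis (A : Module.End ℝ W) : W →ₗ[ℝ] W →ₗ[ℝ] W :=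
  LinearMap.mk₂ ℝ (fun x y => ⁅A x, A y⁆ - ⁅x, y⁆ - A ⁅A x, y⁆ - A ⁅x, A y⁆)
    (fun x x' y => by simp only [map_add, add_lie]; abel)
    (fun c x y => by simp only [map_smul, smul_lie, smul_sub])
    (fun x y y' => by simp only [map_add, lie_add]; abel)
    (fun c x y => by simp only [map_smul, lie_smul, smul_sub])

theorem lieNijenhuis_apply (A : Module.End ℝ W) (x y : W) :
    lieNijenhuis A x y = ⁅A x, A y⁆ - ⁅x, y⁆ - A ⁅A x, y⁆ - A ⁅x, A y⁆ := rfl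

theorem lieNijenhuis_swap (A : Module.End ℝ W) (x y : W) :
    lieNijenhuis A x y = -lieNijenhuis A y x := by
  rw [lieNijenhuis_apply, lieNijenhuis_apply, ← lie_skew (A y) (A x), ← lie_skew y x,
    ← lie_skew (A y) x, ← lie_skew y (A x), map_neg, map_neg]
  abel

/-- Antilinearity makes the vectors annihilated by the tensor stable under `A`, so one vector of
each pair x, A x suffices. -/
theorem lieNijenhuis_apply_left {A : Module.End ℝ W} (hA : ∀ x, A (A x) = -x) (x y : W) :
    lieNijenhuis A (A x) y = -A (lieNijenhuis A x y) := by
  simp only [lieNijenhuis_apply, map_sub, hA, neg_lie, map_neg]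
  abel

theorem lieNijenhuis_eq_zero_of_linear {A : Module.End ℝ W} (hA : ∀ x, A (A x) = -x) {x v : W}
    (h1 : ⁅x, A v⁆ = A ⁅x, v⁆) (h2 : ⁅A x, A v⁆ = A ⁅A x, v⁆) : lieNijenhuis A x v = 0 := by
  rw [lieNijenhuis_apply, h1, h2, hA]
  abel

end AlgebraicNijenhuis

/-! ### Joyce frames: integrability and the Hermitian property -/

section JoyceFrame

variable {W : Type*} [LieRing W] [LieAlgebra ℝ W] {n : ℕ}

/-- A family of quaternionic triples `e j` acting on `F j`, together with pairwise commuting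
elements `E j`, as in the Lie algebra `ℝⁿ ⊕ ⨁ⱼ ∂ⱼ ⊕ ⨁ⱼ 𝔣ⱼ`; the subspace `Q j` is the tail of
the decomposition that commutes with the triple `e j`. -/
structure IsJoyceFrame (e : Fin n → Fin 3 → W) (E : Fin n → W) (F Q : Fin n → Submodule ℝ W) :
    Prop where
  triple : ∀ j, IsQuaternionicTriple (e j) (F j) (Q j)
  E_mem : ∀ i j, E i ∈ Q j
  e_mem : ∀ i j, j < i → ∀ a, e i a ∈ Q j
  F_le : ∀ i j, j < i → F i ≤ Q j
  lie_Q_F : ∀ j, ∀ q ∈ Q j, ∀ v ∈ F j, ⁅q, v⁆ ∈ F j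
  lie_F_F : ∀ j, ∀ v ∈ F j, ∀ w ∈ F j,
    ∃ c : Fin 3 → ℝ, ∃ q ∈ Q j, ⁅v, w⁆ = ∑ a, c a • e j a + q
  E_comm : ∀ i j, ⁅E i, E j⁆ = 0
  span_eq_top : ∀ P : Submodule ℝ W, (∀ j, E j ∈ P) → (∀ j a, e j a ∈ P) → (∀ j, F j ≤ P) → P = ⊤

/-- The endomorphism `A` acts as the left multiplication by the imaginary unit of index `a`. -/
structure IsJoyceEnd (e : Fin n → Fin 3 → W) (E : Fin n → W) (F : Fin n → Submodule ℝ W)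
    (a : Fin 3) (A : Module.End ℝ W) : Prop where
  on_E : ∀ j, A (E j) = e j a
  on_self : ∀ j, A (e j a) = -E j
  on_succ : ∀ j, A (e j (a + 1)) = e j (a + 2)
  on_two : ∀ j, A (e j (a + 2)) = -e j (a + 1)
  on_F : ∀ j, ∀ v ∈ F j, A v = ⁅e j a, v⁆

variable {e : Fin n → Fin 3 → W} {E : Fin n → W} {F Q : Fin n → Submodule ℝ W}

theorem IsJoyceFrame.linearMap_ext (h : IsJoyceFrame e E F Q) {M : Type*} [AddCommGroup M]
    [Module ℝ M] {f g : W →ₗ[ℝ] M} (hE : ∀ j, f (E j) = g (E j))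
    (he : ∀ j a, f (e j a) = g (e j a)) (hF : ∀ j, ∀ v ∈ F j, f v = g v) : f = g := by
  have := h.span_eq_top (LinearMap.eqLocus f g) hE he hF
  exact LinearMap.eqLocus_eq_top.1 this

theorem IsJoyceFrame.lie_e_e (h : IsJoyceFrame e E F Q) {i j : Fin n} (hij : i ≠ j) (a b : Fin 3) :
    ⁅e i a, e j b⁆ = 0 := by
  rcases lt_or_gt_of_ne hij with hlt | hlt
  · exact (h.triple i).comm a _ (h.e_mem j i hlt b)
  · rw [← lie_skew, (h.triple j).comm b _ (h.e_mem i j hlt a), neg_zero]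

theorem IsJoyceFrame.lie_e_E (h : IsJoyceFrame e E F Q) (i j : Fin n) (a : Fin 3) :
    ⁅e i a, E j⁆ = 0 := (h.triple i).comm a _ (h.E_mem j i)

theorem IsJoyceFrame.lie_E_e (h : IsJoyceFrame e E F Q) (i j : Fin n) (a : Fin 3) :
    ⁅E j, e i a⁆ = 0 := by
  rw [← lie_skew, h.lie_e_E, neg_zero]

namespace IsJoyceEnd

variable {a : Fin 3} {A : Module.End ℝ W} (hA : IsJoyceEnd e E F a A) (h : IsJoyceFrame e E F Q)
include hA h

theorem F_mem {j : Fin n} {v : W} (hv : v ∈ F j) : A v ∈ F j := by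
  rw [hA.on_F j v hv]; exact (h.triple j).lie_mem a v hv

theorem sq (x : W) : A (A x) = -x := by
  have : A * A = -1 := by
    apply h.linearMap_ext
    · intro j; simp [hA.on_E, hA.on_self]
    · intro j b
      obtain rfl | rfl | rfl := fin_three_eq a b
      · simp [hA.on_E, hA.on_self]
      · simp [hA.on_succ, hA.on_two]
      · simp [hA.on_succ, hA.on_two]
    · intro j v hv
      have h1 := hA.on_F j _ (hA.F_mem h hv)
      simp only [Module.End.mul_apply, LinearMap.neg_apply, Module.End.one_apply]
      rw [h1, hA.on_F j v hv, (h.triple j).sq a v hv]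
  exact congrArg (fun T : Module.End ℝ W => T x) this

/-- `A` produces the remaining units: it sends `E j` to the unit `a` and the unit `a + 1` to the
unit `a + 2`. -/
theorem span_of_stable {P : Submodule ℝ W} (hP : ∀ x ∈ P, A x ∈ P) (hE : ∀ j, E j ∈ P)
    (he : ∀ j, e j (a + 1) ∈ P) (hF : ∀ j, F j ≤ P) : P = ⊤ := by
  refine h.span_eq_top P hE (fun j b => ?_) hF
  obtain rfl | rfl | rfl := fin_three_eq a b
  · rw [← hA.on_E]; exact hP _ (hE j)
  · exact he j
  · rw [← hA.on_succ]; exact hP _ (he j)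

theorem lie_Q_A {j : Fin n} {q v : W} (hq : q ∈ Q j) (hv : v ∈ F j) : ⁅q, A v⁆ = A ⁅q, v⁆ := by
  rw [hA.on_F j v hv, hA.on_F j _ (h.lie_Q_F j q hq v hv), (h.triple j).lie_lie_comm hq]

theorem lie_e_A_of_ne {i j : Fin n} (hij : i ≠ j) (b : Fin 3) {v : W} (hv : v ∈ F j) :
    ⁅e i b, A v⁆ = A ⁅e i b, v⁆ := by
  rcases lt_or_gt_of_ne hij with hlt | hlt
  · rw [(h.triple i).comm b _ (h.F_le j i hlt hv),
      (h.triple i).comm b _ (h.F_le j i hlt (hA.F_mem h hv)), map_zero]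
  · exact hA.lie_Q_A h (h.e_mem i j hlt b) hv

theorem nijenhuis_E_F (i j : Fin n) {v : W} (hv : v ∈ F j) : lieNijenhuis A (E i) v = 0 := by
  refine lieNijenhuis_eq_zero_of_linear (hA.sq h) (hA.lie_Q_A h (h.E_mem i j) hv) ?_
  rw [hA.on_E]
  rcases eq_or_ne i j with rfl | hij
  · rw [← hA.on_F i _ (hA.F_mem h hv), ← hA.on_F i v hv]
  · exact hA.lie_e_A_of_ne h hij a hv

theorem nijenhuis_e_F (i j : Fin n) {v : W} (hv : v ∈ F j) :
    lieNijenhuis A (e i (a + 1)) v = 0 := by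
  rcases eq_or_ne i j with rfl | hij
  · have t := h.triple i
    have m := fun b => t.lie_mem b v hv
    rw [lieNijenhuis_apply, hA.on_succ, hA.on_F i v hv, hA.on_F i _ (m _), t.mul_two_self a hv,
      t.mul_swap a hv, map_neg, hA.on_F i _ (m _), t.mul_self_two a hv]
    abel
  · refine lieNijenhuis_eq_zero_of_linear (hA.sq h) (hA.lie_e_A_of_ne h hij _ hv) ?_
    rw [hA.on_succ]
    exact hA.lie_e_A_of_ne h hij _ hv

theorem nijenhuis_E_E (i j : Fin n) : lieNijenhuis A (E i) (E j) = 0 := by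
  rw [lieNijenhuis_apply, hA.on_E, hA.on_E, h.E_comm, h.lie_e_E, h.lie_E_e, map_zero]
  rcases eq_or_ne i j with rfl | hij
  · simp
  · simp [h.lie_e_e hij]

theorem nijenhuis_E_e (i j : Fin n) : lieNijenhuis A (E i) (e j (a + 1)) = 0 := by
  rw [lieNijenhuis_apply, hA.on_E, hA.on_succ, h.lie_E_e, h.lie_E_e]
  rcases eq_or_ne i j with rfl | hij
  · rw [(h.triple i).lie_self_two, (h.triple i).lie_succ, map_smul, hA.on_two, map_zero]
    module
  · simp [h.lie_e_e hij]

theorem nijenhuis_e_e (i j : Fin n) : lieNijenhuis A (e i (a + 1)) (e j (a + 1)) = 0 := by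
  rcases eq_or_ne i j with rfl | hij
  · have h1 := lieNijenhuis_swap A (e i (a + 1)) (e i (a + 1))
    have h2 : (2 : ℝ) • lieNijenhuis A (e i (a + 1)) (e i (a + 1)) = 0 := by
      linear_combination (norm := module) h1
    exact (smul_eq_zero.1 h2).resolve_left two_ne_zero
  · rw [lieNijenhuis_apply, hA.on_succ, hA.on_succ]
    simp [h.lie_e_e hij]

/-- Vectors of the later `F j` lie in the tail `Q i`, and so do their images under `A`; the tail
acts on `F i` by maps commuting with `A`. -/
theorem nijenhuis_F_F_of_lt {i j : Fin n} (hij : i < j) {v w : W} (hv : v ∈ F i) (hw : w ∈ F j) :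
    lieNijenhuis A w v = 0 :=
  lieNijenhuis_eq_zero_of_linear (hA.sq h) (hA.lie_Q_A h (h.F_le j i hij hw) hv)
    (hA.lie_Q_A h (h.F_le j i hij (hA.F_mem h hw)) hv)

variable {B : LinearMap.BilinForm ℝ W} (hinv : ∀ x y z : W, B ⁅x, y⁆ z = B x ⁅y, z⁆)
  (hneg : ∀ x, x ≠ 0 → B x x < 0)
include hinv

omit h in
theorem form_A_F {j : Fin n} {v w : W} (hv : v ∈ F j) (hw : w ∈ F j) : B (A v) w = -B v (A w) := by
  rw [hA.on_F j v hv, hA.on_F j w hw, IsQuaternionicTriple.form_lie_left hinv]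

omit hA h in
theorem form_lie_right (x v w : W) : B ⁅v, w⁆ x = -B v ⁅x, w⁆ := by
  rw [hinv, ← lie_skew, map_neg]

include hneg

/-- The left side lies in the span of the triple plus `Q j`, so it can be found by pairing with `B`.
Its `Q` part vanishes because `A` is skew on `F j` and commutes with the action of `Q j`. Pairing
with `e j b` gives the coefficients: the one at `a` is zero and the other two come from the
quaternion relations. -/
theorem lie_A_add {j : Fin n} {v w : W} (hv : v ∈ F j) (hw : w ∈ F j) :
    ⁅A v, w⁆ + ⁅v, A w⁆ = (2 / B (e j 0) (e j 0)) •
      (B v ⁅e j (a + 2), w⁆ • e j (a + 1) - B v ⁅e j (a + 1), w⁆ • e j (a + 2)) := by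
  have t := h.triple j
  obtain ⟨c₁, q₁, hq₁, h₁⟩ := h.lie_F_F j _ (hA.F_mem h hv) w hw
  obtain ⟨c₂, q₂, hq₂, h₂⟩ := h.lie_F_F j v hv _ (hA.F_mem h hw)
  obtain ⟨c, q, hq, hY⟩ : ∃ c : Fin 3 → ℝ, ∃ q ∈ Q j,
      ⁅A v, w⁆ + ⁅v, A w⁆ = ∑ b, c b • e j b + q := by
    refine ⟨c₁ + c₂, q₁ + q₂, (Q j).add_mem hq₁ hq₂, ?_⟩
    rw [h₁, h₂]; simp only [Pi.add_apply, add_smul, Finset.sum_add_distrib]; abel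
  have hBq : B (⁅A v, w⁆ + ⁅v, A w⁆) q = 0 := by
    have hz : ⁅w, q⁆ ∈ F j := by
      rw [← lie_skew]; exact (F j).neg_mem (h.lie_Q_F j q hq w hw)
    have h3 : ⁅A w, q⁆ = A ⁅w, q⁆ := by
      rw [← lie_skew, hA.lie_Q_A h hq hw, ← lie_skew w q, map_neg]
    rw [map_add, LinearMap.add_apply, hinv, hinv, h3, hA.form_A_F hinv hv hz]
    ring
  have hq0 : q = 0 := by
    by_contra hne
    have h4 : B (⁅A v, w⁆ + ⁅v, A w⁆) q = B q q := by
      rw [hY, map_add, LinearMap.add_apply, map_sum, LinearMap.sum_apply]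
      rw [Finset.sum_eq_zero fun b _ => ?_, zero_add]
      rw [map_smul, LinearMap.smul_apply, t.form_e_Q hinv b hq, smul_zero]
    exact (hneg q hne).ne (h4.symm.trans hBq)
  rw [hq0, add_zero] at hY
  have hB : ∀ b, B (⁅A v, w⁆ + ⁅v, A w⁆) (e j b) = c b * B (e j 0) (e j 0) := by
    intro b
    rw [hY, map_sum, LinearMap.sum_apply, Finset.sum_eq_single b]
    · rw [map_smul, LinearMap.smul_apply, t.form_e_e hinv b, smul_eq_mul]
    · intro b' _ hb
      rw [map_smul, LinearMap.smul_apply, t.form_e_e_of_ne hinv hb, smul_zero]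
    · simp
  -- The coefficients are quotients by `B (e j 0) (e j 0)`. If the unit were zero, its square -1 on
  -- `F j` would force `v = 0`.
  have he0 : e j 0 ≠ 0 ∨ v = 0 := by
    by_contra! hne
    have := t.sq 0 v hv
    rw [hne.1, zero_lie] at this
    exact hne.2 (neg_eq_zero.1 this.symm)
  rcases he0 with he0 | rfl
  swap
  · simp
  have hκ := (hneg _ he0).ne
  have hBY : ∀ b, B (⁅A v, w⁆ + ⁅v, A w⁆) (e j b) = B v (A ⁅e j b, w⁆) - B v ⁅e j b, A w⁆ := by
    intro b
    rw [map_add, LinearMap.add_apply, form_lie_right hinv, form_lie_right hinv,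
      hA.form_A_F hinv hv (t.lie_mem b w hw)]
    ring
  have hA' : ∀ b, A ⁅e j b, w⁆ = ⁅e j a, ⁅e j b, w⁆⁆ := fun b =>
    hA.on_F j _ (t.lie_mem b w hw)
  have ha : c a = 0 := by
    have h1 := (hB a).symm.trans (hBY a)
    rw [hA', hA.on_F j w hw, sub_self] at h1
    exact (mul_eq_zero.1 h1).resolve_right hκ
  have ha1 : c (a + 1) = 2 * B v ⁅e j (a + 2), w⁆ / B (e j 0) (e j 0) := by
    have h1 := (hB (a + 1)).symm.trans (hBY (a + 1))
    rw [hA', hA.on_F j w hw, t.mul a w hw, t.mul_swap a hw, map_neg] at h1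
    rw [eq_div_iff hκ, h1]; ring
  have ha2 : c (a + 2) = -(2 * B v ⁅e j (a + 1), w⁆) / B (e j 0) (e j 0) := by
    have h1 := (hB (a + 2)).symm.trans (hBY (a + 2))
    rw [hA', hA.on_F j w hw, t.mul_self_two a hw, t.mul_two_self a hw, map_neg] at h1
    rw [eq_div_iff hκ, h1]; ring
  rw [hY, fin_three_sum _ a, ha, ha1, ha2, zero_smul, zero_add, smul_sub, smul_smul, smul_smul,
    sub_eq_add_neg, ← neg_smul]
  congr 2 <;> ring

/-- With Y(v, w) = [Av, w] + [v, Aw], the tensor is Y(v, Aw) - A Y(v, w), and the explicit formula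
shows that the two terms agree. -/
theorem nijenhuis_F_F {j : Fin n} {v w : W} (hv : v ∈ F j) (hw : w ∈ F j) :
    lieNijenhuis A v w = 0 := by
  have t := h.triple j
  have h1 := hA.lie_A_add h hinv hneg hv hw
  have h2 := hA.lie_A_add h hinv hneg hv (hA.F_mem h hw)
  rw [hA.sq h, hA.on_F j w hw, t.mul_two_self a hw, t.mul_swap a hw, map_neg, lie_neg,
    ← sub_eq_add_neg, ← hA.on_F j w hw] at h2
  have h3 : lieNijenhuis A v w = (⁅A v, A w⁆ - ⁅v, w⁆) - A (⁅A v, w⁆ + ⁅v, A w⁆) := by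
    rw [lieNijenhuis_apply, map_add]; abel
  rw [h3, h1, h2, map_smul, map_sub, map_smul, map_smul, hA.on_succ, hA.on_two]
  module

theorem nijenhuis_eq_zero (x y : W) : lieNijenhuis A x y = 0 := by
  -- The kernel in one argument is `A`-stable, so it is everything once it contains the generators.
  -- This is applied in one argument with each generator in the other, and finally with an arbitrary
  -- vector there.
  have hstable : ∀ y, ∀ x ∈ LinearMap.ker ((lieNijenhuis A).flip y),
      A x ∈ LinearMap.ker ((lieNijenhuis A).flip y) := by
    intro y x hx
    rw [LinearMap.mem_ker, LinearMap.flip_apply] at hx ⊢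
    rw [lieNijenhuis_apply_left (hA.sq h), hx, map_zero, neg_zero]
  have hE : ∀ j x, lieNijenhuis A x (E j) = 0 := by
    intro j x
    have := hA.span_of_stable h (hstable (E j)) (fun i => hA.nijenhuis_E_E h i j)
      (fun i => ((lieNijenhuis_swap A _ _).trans (by rw [hA.nijenhuis_E_e h j i, neg_zero])))
      (fun i v hv => ((lieNijenhuis_swap A _ _).trans (by rw [hA.nijenhuis_E_F h j i hv, neg_zero])))
    exact (Submodule.eq_top_iff'.1 this) x
  have he : ∀ j x, lieNijenhuis A x (e j (a + 1)) = 0 := by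
    intro j x
    have := hA.span_of_stable h (hstable (e j (a + 1))) (fun i => hA.nijenhuis_E_e h i j)
      (fun i => hA.nijenhuis_e_e h i j)
      (fun i v hv => ((lieNijenhuis_swap A _ _).trans (by rw [hA.nijenhuis_e_F h j i hv, neg_zero])))
    exact (Submodule.eq_top_iff'.1 this) x
  have hF : ∀ j, ∀ v ∈ F j, ∀ x, lieNijenhuis A x v = 0 := by
    intro j v hv x
    have := hA.span_of_stable h (hstable v) (fun i => hA.nijenhuis_E_F h i j hv)
      (fun i => hA.nijenhuis_e_F h i j hv) (fun i w hw => by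
        rw [LinearMap.mem_ker, LinearMap.flip_apply]
        rcases lt_trichotomy i j with hij | rfl | hij
        · rw [lieNijenhuis_swap, hA.nijenhuis_F_F_of_lt h hij hw hv, neg_zero]
        · exact hA.nijenhuis_F_F h hinv hneg hw hv
        · exact hA.nijenhuis_F_F_of_lt h hij hv hw)
    exact (Submodule.eq_top_iff'.1 this) x
  have := hA.span_of_stable h (hstable y)
    (fun i => (lieNijenhuis_swap A _ _).trans (by rw [hE, neg_zero]))
    (fun i => (lieNijenhuis_swap A _ _).trans (by rw [he, neg_zero]))
    (fun i v hv => (lieNijenhuis_swap A _ _).trans (by rw [hF i v hv, neg_zero]))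
  exact (Submodule.eq_top_iff'.1 this) x

end IsJoyceEnd

namespace IsJoyceFrame

variable (h : IsJoyceFrame e E F Q) {B : LinearMap.BilinForm ℝ W}
  (hinv : ∀ x y z : W, B ⁅x, y⁆ z = B x ⁅y, z⁆) (hsymm : ∀ x y, B x y = B y x)
include h hinv hsymm

omit hsymm in
theorem form_e_E (i j : Fin n) (a : Fin 3) : B (e i a) (E j) = 0 :=
  (h.triple i).form_e_Q hinv a (h.E_mem j i)

theorem form_E_e (i j : Fin n) (a : Fin 3) : B (E j) (e i a) = 0 := by
  rw [hsymm, h.form_e_E hinv]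

theorem form_e_e (i j : Fin n) (hij : i ≠ j) (a b : Fin 3) : B (e i a) (e j b) = 0 := by
  rcases lt_or_gt_of_ne hij with hlt | hlt
  · exact (h.triple i).form_e_Q hinv a (h.e_mem j i hlt b)
  · rw [hsymm]; exact (h.triple j).form_e_Q hinv b (h.e_mem i j hlt a)

theorem form_e_F (i j : Fin n) (a : Fin 3) {v : W} (hv : v ∈ F j) : B (e i a) v = 0 := by
  rcases lt_trichotomy i j with hij | rfl | hij
  · exact (h.triple i).form_e_Q hinv a (h.F_le j i hij hv)
  · exact (h.triple i).form_e_F hinv a hv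
  · rw [hsymm]; exact (h.triple j).form_F_Q hinv hv (h.e_mem i j hij a)

theorem form_E_F (i j : Fin n) {v : W} (hv : v ∈ F j) : B (E i) v = 0 := by
  rw [hsymm]; exact (h.triple j).form_F_Q hinv hv (h.E_mem i j)

omit hsymm in
theorem form_F_F_of_lt {i j : Fin n} (hij : i < j) {v w : W} (hv : v ∈ F i) (hw : w ∈ F j) :
    B v w = 0 := (h.triple i).form_F_Q hinv hv (h.F_le j i hij hw)

end IsJoyceFrame

namespace IsJoyceEnd

variable {a : Fin 3} {A : Module.End ℝ W} (hA : IsJoyceEnd e E F a A) (h : IsJoyceFrame e E F Q)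
  {B : LinearMap.BilinForm ℝ W} (hinv : ∀ x y z : W, B ⁅x, y⁆ z = B x ⁅y, z⁆)
  (hsymm : ∀ x y, B x y = B y x) (hE : ∀ j, B (E j) (E j) = B (e j 0) (e j 0))
  (hEE : ∀ i j, i ≠ j → B (E i) (E j) = 0)
include hA h hinv hsymm hE hEE

/-- On each copy of ℍ skewness needs `E j` to have the same length as the units; on `F j` it is
invariance of `B`. Since `A` squares to -1, skew and orthogonal are the same. -/
theorem form_skew (x y : W) : B (A x) y + B x (A y) = 0 := by
  have key : B.comp A LinearMap.id + B.comp LinearMap.id A = 0 := by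
    have hsm : ∀ x y, (B.comp A LinearMap.id + B.comp LinearMap.id A) x y = B (A x) y + B x (A y) :=
      fun x y => rfl
    have s0 : ∀ j, B (e j a) (e j (a + 1)) = 0 := fun j => (h.triple j).form_e_succ hinv a
    have s1 : ∀ j, B (e j a) (e j (a + 2)) = 0 := fun j => (h.triple j).form_e_two hinv a
    have s2 : ∀ j, B (e j (a + 1)) (e j (a + 2)) = 0 := fun j => by
      have := (h.triple j).form_e_succ hinv (a + 1)
      rwa [(fin_three_add a).1] at this
    have s0' : ∀ j, B (e j (a + 1)) (e j a) = 0 := fun j => by rw [hsymm, s0]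
    have s1' : ∀ j, B (e j (a + 2)) (e j a) = 0 := fun j => by rw [hsymm, s1]
    have s2' : ∀ j, B (e j (a + 2)) (e j (a + 1)) = 0 := fun j => by rw [hsymm, s2]
    have nrm : ∀ j b, B (e j b) (e j b) = B (e j 0) (e j 0) := fun j b =>
      (h.triple j).form_e_e hinv b
    have eE : ∀ i j b, B (e i b) (E j) = 0 := fun i j b => h.form_e_E hinv i j b
    have Ee : ∀ i j b, B (E j) (e i b) = 0 := fun i j b => h.form_E_e hinv hsymm i j b
    have Ae : ∀ j b, (A (e j b) = -E j ∧ b = a) ∨ (A (e j b) = e j (a + 2) ∧ b = a + 1) ∨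
        (A (e j b) = -e j (a + 1) ∧ b = a + 2) := by
      intro j b
      obtain rfl | rfl | rfl := fin_three_eq a b
      · exact Or.inl ⟨hA.on_self j, rfl⟩
      · exact Or.inr (Or.inl ⟨hA.on_succ j, rfl⟩)
      · exact Or.inr (Or.inr ⟨hA.on_two j, rfl⟩)
    have hEe : ∀ i j b, B (A (E i)) (e j b) + B (E i) (A (e j b)) = 0 := by
      intro i j b
      rw [hA.on_E]
      rcases eq_or_ne i j with rfl | hij
      · obtain ⟨h1, rfl⟩ | ⟨h1, rfl⟩ | ⟨h1, rfl⟩ := Ae i b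
        · rw [h1, map_neg, hE, nrm]; ring
        · rw [h1, Ee, s0, add_zero]
        · rw [h1, map_neg, Ee, s1, neg_zero, add_zero]
      · rw [h.form_e_e hinv hsymm i j hij, zero_add]
        obtain ⟨h1, rfl⟩ | ⟨h1, rfl⟩ | ⟨h1, rfl⟩ := Ae j b
        · rw [h1, map_neg, hEE i j hij, neg_zero]
        · rw [h1, Ee]
        · rw [h1, map_neg, Ee, neg_zero]
    have hee : ∀ i j b c, B (A (e i b)) (e j c) + B (e i b) (A (e j c)) = 0 := by
      intro i j b c
      rcases eq_or_ne i j with rfl | hij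
      · obtain ⟨h1, hb⟩ | ⟨h1, hb⟩ | ⟨h1, hb⟩ := Ae i b <;>
          obtain ⟨h2, hc⟩ | ⟨h2, hc⟩ | ⟨h2, hc⟩ := Ae i c <;>
          simp only [h1, h2, map_neg, LinearMap.neg_apply, Ee, eE] <;>
          simp only [hb, hc, s0, s1, s2, s0', s1', s2', nrm, neg_zero, add_zero] <;> ring
      · have z := h.form_e_e hinv hsymm i j hij
        obtain ⟨h1, -⟩ | ⟨h1, -⟩ | ⟨h1, -⟩ := Ae i b <;>
          obtain ⟨h2, -⟩ | ⟨h2, -⟩ | ⟨h2, -⟩ := Ae j c <;>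
          simp only [h1, h2, map_neg, LinearMap.neg_apply, Ee, eE, z] <;> ring
    have hEF : ∀ i j, ∀ v ∈ F j, B (A (E i)) v + B (E i) (A v) = 0 := by
      intro i j v hv
      rw [hA.on_E, h.form_e_F hinv hsymm i j a hv, h.form_E_F hinv hsymm i j (hA.F_mem h hv),
        add_zero]
    have heF : ∀ i j b, ∀ v ∈ F j, B (A (e i b)) v + B (e i b) (A v) = 0 := by
      intro i j b v hv
      rw [h.form_e_F hinv hsymm i j b (hA.F_mem h hv), add_zero]
      obtain ⟨h1, -⟩ | ⟨h1, -⟩ | ⟨h1, -⟩ := Ae i b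
      · rw [h1, map_neg, LinearMap.neg_apply, h.form_E_F hinv hsymm i j hv, neg_zero]
      · rw [h1, h.form_e_F hinv hsymm i j _ hv]
      · rw [h1, map_neg, LinearMap.neg_apply, h.form_e_F hinv hsymm i j _ hv, neg_zero]
    have hswap : ∀ x y, B (A x) y + B x (A y) = B (A y) x + B y (A x) := by
      intro x y
      rw [hsymm (A x) y, hsymm x (A y), add_comm]
    refine h.linearMap_ext (fun i => ?_) (fun i b => ?_) (fun i v hv => ?_)
    · refine h.linearMap_ext (fun j => ?_) (fun j b => ?_) (fun j v hv => ?_)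
      · rw [hsm, hA.on_E, hA.on_E, eE, Ee]; simp
      · rw [hsm, hEe]; simp
      · rw [hsm, hEF i j v hv]; simp
    · refine h.linearMap_ext (fun j => ?_) (fun j c => ?_) (fun j v hv => ?_)
      · rw [hsm, hswap, hEe]; simp
      · rw [hsm, hee]; simp
      · rw [hsm, heF i j b v hv]; simp
    · refine h.linearMap_ext (fun j => ?_) (fun j b => ?_) (fun j w hw => ?_)
      · rw [hsm, hswap, hEF j i v hv]; simp
      · rw [hsm, hswap, heF j i b v hv]; simp
      · rw [hsm]
        rcases lt_trichotomy i j with hij | rfl | hij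
        · rw [h.form_F_F_of_lt hinv hij hv (hA.F_mem h hw),
            h.form_F_F_of_lt hinv hij (hA.F_mem h hv) hw]; simp
        · rw [hA.form_A_F hinv hv hw]; simp
        · rw [hswap, h.form_F_F_of_lt hinv hij hw (hA.F_mem h hv),
            h.form_F_F_of_lt hinv hij (hA.F_mem h hw) hv]; simp
  exact congrArg (fun T : LinearMap.BilinForm ℝ W => T x y) key

theorem form_hermitian (x y : W) : B (A x) (A y) = B x y := by
  have := hA.form_skew h hinv hsymm hE hEE x (A y)
  rw [hA.sq h, map_neg] at this
  linarith

end IsJoyceEnd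

theorem IsJoyceFrame.end_mul (h : IsJoyceFrame e E F Q) {A : Fin 3 → Module.End ℝ W}
    (hA : ∀ a, IsJoyceEnd e E F a (A a)) (x : W) : A 0 (A 1 x) = A 2 x := by
  have key : A 0 * A 1 = A 2 := by
    have s00 : ∀ j, A 0 (e j 0) = -E j := (hA 0).on_self
    have s01 : ∀ j, A 0 (e j 1) = e j 2 := (hA 0).on_succ
    have s02 : ∀ j, A 0 (e j 2) = -e j 1 := (hA 0).on_two
    have s11 : ∀ j, A 1 (e j 1) = -E j := (hA 1).on_self
    have s12 : ∀ j, A 1 (e j 2) = e j 0 := (hA 1).on_succ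
    have s10 : ∀ j, A 1 (e j 0) = -e j 2 := (hA 1).on_two
    have s22 : ∀ j, A 2 (e j 2) = -E j := (hA 2).on_self
    have s20 : ∀ j, A 2 (e j 0) = e j 1 := (hA 2).on_succ
    have s21 : ∀ j, A 2 (e j 1) = -e j 0 := (hA 2).on_two
    refine h.linearMap_ext (fun j => ?_) (fun j b => ?_) (fun j v hv => ?_)
    · simp [(hA _).on_E, s01]
    · obtain rfl | rfl | rfl : b = 0 ∨ b = 1 ∨ b = 2 := by lia
      · simp [s10, s02, s20]
      · simp [s11, s21, (hA _).on_E]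
      · simp [s12, s00, s22]
    · rw [Module.End.mul_apply, (hA 0).on_F j _ ((hA 1).F_mem h hv), (hA 1).on_F j v hv,
        (hA 2).on_F j v hv]
      exact (h.triple j).mul 0 v hv
  exact congrArg (fun T : Module.End ℝ W => T x) key

/-- A formal consequence of `end_mul` and of the squares: `A 2` applied to `A 1 (A 0 x)` is x. -/
theorem IsJoyceFrame.end_anticomm (h : IsJoyceFrame e E F Q) {A : Fin 3 → Module.End ℝ W}
    (hA : ∀ a, IsJoyceEnd e E F a (A a)) (x : W) : A 1 (A 0 x) = -A 2 x := by
  have h1 := h.end_mul hA (A 1 (A 0 x))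
  have h2 := (hA 1).sq h (A 0 x)
  rw [h2, map_neg, (hA 0).sq h, neg_neg] at h1
  have h3 := congrArg (A 2) h1
  rw [(hA 2).sq h] at h3
  rw [h3, neg_neg]

end JoyceFrame

/-! ### Eigenvectors of symmetric operators -/

section SymmetricOperator

/-- A real operator that is symmetric for a scalar product is a scalar or has two distinct
eigenvalues. -/
theorem exists_eigenvectors_of_symmetric {V : Type*} [AddCommGroup V] [Module ℝ V]
    [FiniteDimensional ℝ V] (h : LinearMap.BilinForm ℝ V) (hs : ∀ x y, h x y = h y x)
    (hpos : ∀ x, x ≠ 0 → 0 < h x x) (T : Module.End ℝ V) (hT : ∀ x y, h (T x) y = h x (T y)) :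
    (∃ c : ℝ, ∀ v, T v = c • v) ∨ ∃ (c d : ℝ) (v w : V), c ≠ d ∧ v ≠ 0 ∧ w ≠ 0 ∧
      T v = c • v ∧ T w = d • w := by
  have hnn : ∀ x, 0 ≤ h x x := fun x => by
    rcases eq_or_ne x 0 with rfl | hx
    · simp
    · exact (hpos x hx).le
  let core : InnerProductSpace.Core ℝ V :=
    { inner := fun x y => h x y
      conj_inner_symm := fun x y => hs y x
      re_inner_nonneg := fun x => hnn x
      add_left := fun x y z => by rw [map_add]; rfl
      smul_left := fun x y r => by rw [map_smul]; rfl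
      definite := fun x hx => by
        by_contra hne
        exact (hpos x hne).ne' hx }
  let _ : NormedAddCommGroup V := core.toNormedAddCommGroup
  let _ : InnerProductSpace ℝ V := InnerProductSpace.ofCore core.toCore
  have hsym : T.IsSymmetric := fun x y => hT x y
  let b := hsym.eigenvectorBasis rfl
  by_cases hall : ∀ i j, hsym.eigenvalues rfl i = hsym.eigenvalues rfl j
  · left
    rcases isEmpty_or_nonempty (Fin (Module.finrank ℝ V)) with hE | ⟨⟨i⟩⟩
    · have : Module.finrank ℝ V = 0 := by
        by_contra hne
        exact hE.elim ⟨0, Nat.pos_of_ne_zero hne⟩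
      have hsub := Module.finrank_zero_iff.1 this
      exact ⟨0, fun v => Subsingleton.elim _ _⟩
    · refine ⟨hsym.eigenvalues rfl i, fun v => ?_⟩
      have : T = hsym.eigenvalues rfl i • LinearMap.id := by
        refine b.toBasis.ext fun j => ?_
        rw [b.coe_toBasis, hsym.apply_eigenvectorBasis rfl j, hall i j]
        rfl
      exact congrArg (fun S : Module.End ℝ V => S v) this
  · right
    push Not at hall
    obtain ⟨i, j, hij⟩ := hall
    refine ⟨_, _, b i, b j, hij, b.orthonormal.ne_zero i, b.orthonormal.ne_zero j, ?_, ?_⟩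
    · exact hsym.apply_eigenvectorBasis rfl i
    · exact hsym.apply_eigenvectorBasis rfl j

end SymmetricOperator

/-! ### The action of the center of the tail on 𝔣ⱼ -/

section CenterBound

variable {L : Type*} [LieRing L] [LieAlgebra ℝ L] [FiniteDimensional ℝ L]

namespace IsQuaternionicTriple

variable {e : Fin 3 → L} {F Q P : Submodule ℝ L} (h : IsQuaternionicTriple e F Q)
  (hP : IsTripleTotal e F Q P) {B : LinearMap.BilinForm ℝ L}
  (hinv : ∀ x y z : L, B ⁅x, y⁆ z = B x ⁅y, z⁆) (hsymm : ∀ x y, B x y = B y x)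
  (hneg : ∀ x, x ≠ 0 → B x x < 0)
include h hP

omit [FiniteDimensional ℝ L] in
-- The derivation ad x kills the triple and `Q`, hence the bracket of any two vectors of `F`.
theorem lie_lie_F_F {x : L} (hx : x ∈ Q) (hxQ : ∀ y ∈ Q, ⁅x, y⁆ = 0) {v w : L} (hv : v ∈ F)
    (hw : w ∈ F) : ⁅⁅x, v⁆, w⁆ + ⁅v, ⁅x, w⁆⁆ = 0 := by
  obtain ⟨c, q, hq, hvw⟩ := h.lie_F_F hP hv hw
  rw [← leibniz_lie, hvw, lie_add, hxQ q hq, lie_sum, add_zero]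
  refine Finset.sum_eq_zero fun a _ => ?_
  rw [lie_smul, ← lie_skew, h.comm a x hx, neg_zero, smul_zero]

omit [FiniteDimensional ℝ L] in
theorem sq_F_F {x : L} (hx : x ∈ Q) (hxQ : ∀ y ∈ Q, ⁅x, y⁆ = 0) {v w : L} (hv : v ∈ F)
    (hw : w ∈ F) : ⁅⁅x, ⁅x, w⁆⁆, v⁆ = ⁅w, ⁅x, ⁅x, v⁆⁆⁆ := by
  have h1 := h.lie_lie_F_F hP hx hxQ (h.lie_Q_F_mem hP hx hw) hv
  have h2 := h.lie_lie_F_F hP hx hxQ hw (h.lie_Q_F_mem hP hx hv)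
  linear_combination (norm := module) h1 - h2

include hinv hsymm hneg

/-- The square of ad x is symmetric on `F` for the definite form. If it is not scalar, take
eigenvectors v, w with distinct eigenvalues. By `sq_F_F` different eigenspaces commute, and each is
stable under the triple. So w commutes with v and with `⁅e 0, v⁆`, hence with their bracket, which
has the form `k 0 • e 0 + q` with `k 0 ≠ 0`. On w and on `⁅e 1, w⁆` the action of q is then `-k 0`
times that of `e 0`. But q commutes with `e 1`, while `e 0` anticommutes with it on `F`; this forces
w = 0. -/
theorem exists_sq_eq_smul {x : L} (hx : x ∈ Q) (hxQ : ∀ y ∈ Q, ⁅x, y⁆ = 0) :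
    ∃ c : ℝ, ∀ v ∈ F, ⁅x, ⁅x, v⁆⁆ = c • v := by
  have hmem : ∀ v ∈ F, ⁅x, ⁅x, v⁆⁆ ∈ F := fun v hv =>
    h.lie_Q_F_mem hP hx (h.lie_Q_F_mem hP hx hv)
  let T : Module.End ℝ F :=
    (LieAlgebra.ad ℝ L x * LieAlgebra.ad ℝ L x).restrict (p := F) (q := F) fun v hv => hmem v hv
  have hTv : ∀ v : F, (T v : L) = ⁅x, ⁅x, (v : L)⁆⁆ := fun v => rfl
  obtain ⟨c, hc⟩ | ⟨c, d, v, w, hcd, hv0, hw0, hTv', hTw⟩ := exists_eigenvectors_of_symmetric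
    (-(B.restrict F)) (fun v w => congrArg Neg.neg (hsymm v w))
    (fun v hv => neg_pos.2 (hneg v fun h0 => hv (Subtype.ext h0))) T (fun v w => by
      have h1 := form_lie_left hinv x ⁅x, (v : L)⁆ w
      have h2 := form_lie_left hinv x (v : L) ⁅x, (w : L)⁆
      rw [h2, neg_neg] at h1
      exact congrArg Neg.neg h1)
  · exact ⟨c, fun v hv => (hTv ⟨v, hv⟩).symm.trans (congrArg Subtype.val (hc ⟨v, hv⟩))⟩
  exfalso
  obtain ⟨v, hv⟩ := v
  obtain ⟨w, hw⟩ := w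
  have ev : ⁅x, ⁅x, v⁆⁆ = c • v := congrArg Subtype.val hTv'
  have ew : ⁅x, ⁅x, w⁆⁆ = d • w := congrArg Subtype.val hTw
  have hv0 : v ≠ 0 := fun h0 => hv0 (Subtype.ext h0)
  have hw0 : w ≠ 0 := fun h0 => hw0 (Subtype.ext h0)
  have horth : ∀ v ∈ F, ∀ w ∈ F, ⁅x, ⁅x, v⁆⁆ = c • v → ⁅x, ⁅x, w⁆⁆ = d • w → ⁅w, v⁆ = 0 := by
    intro v hv w hw ev ew
    have h1 := h.sq_F_F hP hx hxQ hv hw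
    rw [ev, ew, smul_lie, lie_smul] at h1
    have h2 : (d - c) • ⁅w, v⁆ = 0 := by rw [sub_smul, h1, sub_self]
    exact (smul_eq_zero.1 h2).resolve_left (sub_ne_zero.2 hcd.symm)
  have hI : ∀ (a : Fin 3) (t : ℝ) (z : L), ⁅x, ⁅x, z⁆⁆ = t • z →
      ⁅x, ⁅x, ⁅e a, z⁆⁆⁆ = t • ⁅e a, z⁆ := by
    intro a t z hz
    rw [h.lie_lie_comm hx, h.lie_lie_comm hx, hz, lie_smul]
  obtain ⟨k, q, hq, hk⟩ := h.lie_F_F hP hv (h.lie_mem 0 v hv)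
  have hvv : ∀ a, B v ⁅e a, v⁆ = 0 := by
    intro a
    have h1 := form_lie_left hinv (e a) v v
    rw [hsymm] at h1
    linarith
  have hkB : ∀ b, k b * B (e 0) (e 0) = -B v ⁅e b, ⁅e 0, v⁆⁆ := by
    intro b
    rw [← IsJoyceEnd.form_lie_right hinv, hk, LinearMap.map_add₂, LinearMap.map_sum₂,
      Finset.sum_eq_single b]
    · rw [LinearMap.map_smul₂, h.form_e_e hinv b, smul_eq_mul, hsymm q, h.form_e_Q hinv b hq, add_zero]
    · intro b' _ hb
      rw [LinearMap.map_smul₂, h.form_e_e_of_ne hinv hb, smul_zero]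
    · simp
  have hk0 : k 0 ≠ 0 := by
    intro h0
    have h1 := hkB 0
    rw [h0, h.sq 0 v hv, map_neg, neg_neg, zero_mul] at h1
    exact (hneg v hv0).ne h1.symm
  have he0 : B (e 0) (e 0) ≠ 0 := by
    intro h0
    have h1 := hkB 0
    rw [h0, h.sq 0 v hv, map_neg, neg_neg, mul_zero] at h1
    exact (hneg v hv0).ne h1.symm
  have hk1 : k 1 = 0 := by
    have h1 := hkB 1
    rw [show ⁅e 1, ⁅e 0, v⁆⁆ = -⁅e 2, v⁆ from h.mul_swap 0 hv, map_neg, hvv] at h1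
    simpa [he0] using h1
  have hk2 : k 2 = 0 := by
    have h1 := hkB 2
    rw [show ⁅e 2, ⁅e 0, v⁆⁆ = ⁅e 1, v⁆ from h.mul_two_self 0 hv, hvv] at h1
    simpa [he0] using h1
  have hz : ∀ z ∈ F, ⁅x, ⁅x, z⁆⁆ = d • z → k 0 • ⁅e 0, z⁆ + ⁅q, z⁆ = 0 := by
    intro z hz ez
    have h1 : ⁅z, ⁅v, ⁅e 0, v⁆⁆⁆ = 0 := by
      rw [leibniz_lie, horth v hv z hz ev ez, horth _ (h.lie_mem 0 v hv) z hz (hI 0 c v ev) ez,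
        zero_lie, lie_zero, add_zero]
    rw [hk, Fin.sum_univ_three, hk1, hk2, zero_smul, zero_smul, add_zero, add_zero, ← lie_skew,
      neg_eq_zero, add_lie, smul_lie] at h1
    exact h1
  have h1 := hz w hw ew
  have h2 := hz _ (h.lie_mem 1 w hw) (hI 1 d w ew)
  have h3 : ⁅e 0, ⁅e 1, w⁆⁆ = ⁅e 2, w⁆ := h.mul 0 w hw
  have h4 : ⁅e 1, ⁅e 0, w⁆⁆ = -⁅e 2, w⁆ := h.mul_swap 0 hw
  have h5 : ⁅q, w⁆ = -(k 0 • ⁅e 0, w⁆) := (neg_eq_of_add_eq_zero_right h1).symm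
  rw [h.lie_lie_comm hq, h5, h3, lie_neg, lie_smul, h4] at h2
  have h6 : (2 * k 0) • ⁅e 2, w⁆ = 0 := by linear_combination (norm := module) h2
  have h7 : ⁅e 2, w⁆ = 0 := (smul_eq_zero.1 h6).resolve_left (mul_ne_zero two_ne_zero hk0)
  have h8 := h.sq 2 w hw
  rw [h7, lie_zero] at h8
  exact hw0 (neg_eq_zero.1 h8.symm)

/-- The elements of the center of `Q` that act trivially on `F` form a subspace of codimension at
most one. -/
theorem exists_functional :
    ∃ g : L →ₗ[ℝ] ℝ, ∀ y ∈ Q, (∀ z ∈ Q, ⁅y, z⁆ = 0) → g y = 0 → ∀ v ∈ F, ⁅y, v⁆ = 0 := by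
  by_cases hall : ∀ y ∈ Q, (∀ z ∈ Q, ⁅y, z⁆ = 0) → ∀ v ∈ F, ⁅y, v⁆ = 0
  · exact ⟨0, fun y hy hyQ _ => hall y hy hyQ⟩
  push Not at hall
  obtain ⟨x, hx, hxQ, w, hw, hxw⟩ := hall
  -- Here x acts nontrivially on w. The functional tests whether `⁅y, w⁆` is orthogonal to `⁅x, w⁆`.
  refine ⟨B ⁅x, w⁆ ∘ₗ LieAlgebra.ad ℝ L w, fun y hy hyQ hg v hv => ?_⟩
  have hg' : B ⁅x, w⁆ ⁅y, w⁆ = 0 := by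
    rw [← lie_skew y w, map_neg, neg_eq_zero]; exact hg
  have hw0 : w ≠ 0 := by rintro rfl; exact hxw (lie_zero _)
  obtain ⟨c₁, h₁⟩ := h.exists_sq_eq_smul hP hinv hsymm hneg hx hxQ
  obtain ⟨c₂, h₂⟩ := h.exists_sq_eq_smul hP hinv hsymm hneg hy hyQ
  obtain ⟨c₃, h₃⟩ := h.exists_sq_eq_smul hP hinv hsymm hneg (Q.add_mem hx hy)
    (fun z hz => by rw [add_lie, hxQ z hz, hyQ z hz, add_zero])
  have hcomm : ∀ v : L, ⁅y, ⁅x, v⁆⁆ = ⁅x, ⁅y, v⁆⁆ := by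
    intro v
    rw [leibniz_lie y x v, hyQ x hx, zero_lie, zero_add]
  -- Polarization: x, y and x + y all have scalar squares on `F` and the actions of x and y commute,
  -- so their product is scalar. Orthogonality makes this scalar zero, and x acts invertibly, so y
  -- acts as zero.
  have hxy : ∀ v ∈ F, ⁅x, ⁅y, v⁆⁆ = ((c₃ - c₁ - c₂) / 2) • v := by
    intro v hv
    have h4 := h₃ v hv
    simp only [add_lie, lie_add, h₁ v hv, h₂ v hv, hcomm] at h4
    have h5 : (2 : ℝ) • ⁅x, ⁅y, v⁆⁆ = (c₃ - c₁ - c₂) • v := by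
      linear_combination (norm := module) h4
    have h6 := congrArg (fun z => (2⁻¹ : ℝ) • z) h5
    simp only [smul_smul] at h6
    rw [inv_mul_cancel₀ two_ne_zero, one_smul] at h6
    rw [h6]; congr 1; ring
  have hc0 : (c₃ - c₁ - c₂) / 2 = 0 := by
    rw [form_lie_left hinv, hxy w hw, map_smul, smul_eq_mul, neg_eq_zero] at hg'
    exact (mul_eq_zero.1 hg').resolve_right (hneg w hw0).ne
  have hc1 : c₁ ≠ 0 := by
    intro h0
    have h5 := form_lie_left hinv x w ⁅x, w⁆
    rw [h₁ w hw, h0, zero_smul, map_zero, neg_zero] at h5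
    exact (hneg _ hxw).ne h5
  have h6 := h₁ _ (h.lie_Q_F_mem hP hy hv)
  rw [hxy v hv, hc0, zero_smul, lie_zero] at h6
  exact (smul_eq_zero.1 h6.symm).resolve_left hc1

end IsQuaternionicTriple

end CenterBound

/-! ### The tails of a Joyce decomposition, orthogonality and the rank -/

section JoyceTail

variable {L : Type*} [LieRing L] [LieAlgebra ℝ L] {n : ℕ}

theorem joyceTail_succ (b : Submodule ℝ L) (sp : Fin n → LieSubalgebra ℝ L)
    (f : Fin n → Submodule ℝ L) (j : Fin n) :
    joyceTail b sp f j = ((sp j).toSubmodule ⊔ f j) ⊔ joyceTail b sp f (j + 1) := by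
  apply le_antisymm
  · refine sup_le (le_sup_of_le_right le_sup_left) (iSup_le fun i => iSup_le fun hi => ?_)
    rcases eq_or_ne j i with rfl | hij
    · exact le_sup_left
    · refine le_sup_of_le_right (le_sup_of_le_right ?_)
      have hlt : (j : ℕ) + 1 ≤ i := by
        have : (j : ℕ) ≠ i := fun h => hij (Fin.ext h)
        omega
      exact le_iSup₂_of_le i hlt le_rfl
  · refine sup_le ?_ (sup_le le_sup_left (iSup_le fun i => iSup_le fun hi => ?_))
    · exact le_sup_of_le_right (le_iSup₂_of_le j le_rfl le_rfl)
    · exact le_sup_of_le_right (le_iSup₂_of_le i (by omega) le_rfl)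

theorem b_le_joyceTail (b : Submodule ℝ L) (sp : Fin n → LieSubalgebra ℝ L)
    (f : Fin n → Submodule ℝ L) (k : ℕ) : b ≤ joyceTail b sp f k := le_sup_left

theorem sp_le_joyceTail (b : Submodule ℝ L) (sp : Fin n → LieSubalgebra ℝ L)
    (f : Fin n → Submodule ℝ L) {k : ℕ} {j : Fin n} (hj : k ≤ j) :
    (sp j).toSubmodule ≤ joyceTail b sp f k :=
  le_sup_of_le_right (le_iSup₂_of_le j hj le_sup_left)

theorem f_le_joyceTail (b : Submodule ℝ L) (sp : Fin n → LieSubalgebra ℝ L)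
    (f : Fin n → Submodule ℝ L) {k : ℕ} {j : Fin n} (hj : k ≤ j) :
    f j ≤ joyceTail b sp f k :=
  le_sup_of_le_right (le_iSup₂_of_le j hj le_sup_right)

theorem joyceTail_eq_b (b : Submodule ℝ L) (sp : Fin n → LieSubalgebra ℝ L)
    (f : Fin n → Submodule ℝ L) : joyceTail b sp f n = b := by
  refine le_antisymm (sup_le le_rfl (iSup_le fun i => iSup_le fun hi => ?_)) le_sup_left
  exact absurd i.2 (not_lt.2 hi)

/-- The image of the imaginary units under a parametrization of `∂ⱼ`. -/
def unitImage {s : LieSubalgebra ℝ L} (φ : sp1 ≃ₗ⁅ℝ⁆ s) (a : Fin 3) : L := φ (imUnit a)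

theorem exists_sum_unitImage {s : LieSubalgebra ℝ L} (φ : sp1 ≃ₗ⁅ℝ⁆ s) {x : L} :
    x ∈ s ↔ ∃ c : Fin 3 → ℝ, x = ∑ a, c a • unitImage φ a := by
  constructor
  · intro hx
    obtain ⟨p, hp⟩ : ∃ p, φ p = ⟨x, hx⟩ := φ.surjective _
    refine ⟨![(p : ℍ[ℝ]).imI, (p : ℍ[ℝ]).imJ, (p : ℍ[ℝ]).imK], ?_⟩
    have h1 : x = (φ p : L) := (congrArg Subtype.val hp).symm
    have h2 := congrArg (fun q => (φ q : L)) (sp1_eq_sum p)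
    simp only [map_add, map_smul] at h2
    rw [h1, Fin.sum_univ_three]
    exact h2
  · rintro ⟨c, rfl⟩
    exact s.toSubmodule.sum_mem fun a _ => s.smul_mem _ (φ (imUnit a)).2

namespace JoyceDecomposition

variable {u : LieSubalgebra ℝ L} (D : JoyceDecomposition u n)

/-- The subspace `𝔟ₖ`. -/
def tail (k : ℕ) : Submodule ℝ L := joyceTail D.b D.sp D.f k

theorem iSup_summand : ⨆ i, joyceSummand D.b D.sp D.f i = ⊤ :=
  D.isInternal.submodule_iSup_eq_top

theorem tail_zero : D.tail 0 = ⊤ := by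
  rw [eq_top_iff, ← D.iSup_summand]
  refine iSup_le ?_
  rintro (_ | j | j)
  · exact b_le_joyceTail _ _ _ _
  · exact sp_le_joyceTail _ _ _ (Nat.zero_le _)
  · exact f_le_joyceTail _ _ _ (Nat.zero_le _)

/-- With indices starting at 0, `tail j` still contains ∂ⱼ and 𝔣ⱼ; the part behind them, which
commutes with ∂ⱼ, is `tail (j + 1)`. -/
theorem isQuaternionicTriple (j : Fin n) (φ : sp1 ≃ₗ⁅ℝ⁆ D.sp j) :
    IsQuaternionicTriple (unitImage φ) (D.f j) (D.tail (j + 1)) :=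
  isQuaternionicTriple_of_standardRep (D.f_rep j) (D.sp_f j)
    (D.tail_comm (j + 1) j.2 j (Nat.lt_succ_self _)) φ

theorem mem_tail_iff (j : Fin n) (φ : sp1 ≃ₗ⁅ℝ⁆ D.sp j) (x : L) :
    x ∈ D.tail j ↔ ∃ c : Fin 3 → ℝ, ∃ v ∈ D.f j, ∃ q ∈ D.tail (j + 1),
      x = ∑ a, c a • unitImage φ a + v + q := by
  unfold tail
  rw [joyceTail_succ, Submodule.mem_sup]
  constructor
  · rintro ⟨y, hy, q, hq, rfl⟩
    obtain ⟨s, hs, v, hv, rfl⟩ := Submodule.mem_sup.1 hy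
    obtain ⟨c, rfl⟩ := (exists_sum_unitImage φ).1 hs
    exact ⟨c, v, hv, q, hq, rfl⟩
  · rintro ⟨c, v, hv, q, hq, rfl⟩
    exact ⟨_, Submodule.add_mem_sup ((exists_sum_unitImage φ).2 ⟨c, rfl⟩) hv, q, hq, rfl⟩

/-- That the tails are subalgebras is not part of the definition. Each is the centralizer of a ∂ in
the preceding tail, and the chain starts with the whole Lie algebra. -/
theorem lie_mem_tail {k : ℕ} (hk : k ≤ n) : ∀ x ∈ D.tail k, ∀ y ∈ D.tail k, ⁅x, y⁆ ∈ D.tail k := by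
  induction k with
  | zero => intro x _ y _; rw [D.tail_zero]; trivial
  | succ k ih =>
    obtain ⟨φ⟩ := D.sp_equiv ⟨k, hk⟩
    intro x hx y hy
    exact (D.isQuaternionicTriple ⟨k, hk⟩ φ).lie_Q_mem
      ⟨D.mem_tail_iff ⟨k, hk⟩ φ, ih (Nat.le_of_succ_le hk)⟩ hx hy

theorem isTripleTotal (j : Fin n) (φ : sp1 ≃ₗ⁅ℝ⁆ D.sp j) :
    IsTripleTotal (unitImage φ) (D.f j) (D.tail (j + 1)) (D.tail j) :=
  ⟨D.mem_tail_iff j φ, D.lie_mem_tail j.2.le⟩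

theorem b_le_tail (k : ℕ) : D.b ≤ D.tail k := b_le_joyceTail _ _ _ _

theorem lie_b_sp {x y : L} (hx : x ∈ D.b) {j : Fin n} (hy : y ∈ D.sp j) : ⁅x, y⁆ = 0 :=
  D.tail_comm (j + 1) j.2 j (Nat.lt_succ_self _) x (D.b_le_tail _ hx) y hy

theorem lie_sp_sp {i j : Fin n} (hij : i ≠ j) {x y : L} (hx : x ∈ D.sp i) (hy : y ∈ D.sp j) :
    ⁅x, y⁆ = 0 := by
  rcases lt_or_gt_of_ne hij with h | h
  · rw [← lie_skew, neg_eq_zero]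
    exact D.tail_comm (i + 1) i.2 i (Nat.lt_succ_self _) y (sp_le_joyceTail _ _ _ h hy) x hx
  · exact D.tail_comm (j + 1) j.2 j (Nat.lt_succ_self _) x (sp_le_joyceTail _ _ _ h hx) y hy

section Form

variable {B : LinearMap.BilinForm ℝ L} (hinv : ∀ x y z : L, B ⁅x, y⁆ z = B x ⁅y, z⁆)
  (hsymm : ∀ x y, B x y = B y x)
include hinv

theorem form_sp_tail {j : Fin n} {x y : L} (hx : x ∈ D.sp j) (hy : y ∈ D.tail (j + 1)) :
    B x y = 0 := by
  obtain ⟨φ⟩ := D.sp_equiv j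
  obtain ⟨c, rfl⟩ := (exists_sum_unitImage φ).1 hx
  rw [LinearMap.map_sum₂]
  exact Finset.sum_eq_zero fun a _ => by
    rw [LinearMap.map_smul₂, (D.isQuaternionicTriple j φ).form_e_Q hinv a hy, smul_zero]

theorem form_sp_f {j : Fin n} {x y : L} (hx : x ∈ D.sp j) (hy : y ∈ D.f j) : B x y = 0 := by
  obtain ⟨φ⟩ := D.sp_equiv j
  obtain ⟨c, rfl⟩ := (exists_sum_unitImage φ).1 hx
  rw [LinearMap.map_sum₂]
  exact Finset.sum_eq_zero fun a _ => by
    rw [LinearMap.map_smul₂, (D.isQuaternionicTriple j φ).form_e_F hinv a hy, smul_zero]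

theorem form_f_tail {j : Fin n} {x y : L} (hx : x ∈ D.f j) (hy : y ∈ D.tail (j + 1)) :
    B x y = 0 := by
  obtain ⟨φ⟩ := D.sp_equiv j
  exact (D.isQuaternionicTriple j φ).form_F_Q hinv hx hy

include hsymm

/-- The summands of a Joyce decomposition are orthogonal for every invariant symmetric form. -/
theorem form_summand {i j : Unit ⊕ Fin n ⊕ Fin n} (hij : i ≠ j) {x y : L}
    (hx : x ∈ D.summand i) (hy : y ∈ D.summand j) : B x y = 0 := by
  have key : ∀ (k : Fin n) {x y : L}, (x ∈ D.sp k ∨ x ∈ D.f k) → y ∈ D.tail (k + 1) →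
      B x y = 0 := by
    rintro k x y (hx | hx) hy
    · exact D.form_sp_tail hinv hx hy
    · exact D.form_f_tail hinv hx hy
  have two : ∀ (k l : Fin n) {x y : L}, k ≠ l → (x ∈ D.sp k ∨ x ∈ D.f k) →
      (y ∈ D.sp l ∨ y ∈ D.f l) → B x y = 0 := by
    intro k l x y hkl hx hy
    have mem : ∀ (k l : Fin n) {y : L}, k < l → (y ∈ D.sp l ∨ y ∈ D.f l) → y ∈ D.tail (k + 1) := by
      rintro k l y hlt (hy | hy)
      · exact sp_le_joyceTail _ _ _ hlt hy
      · exact f_le_joyceTail _ _ _ hlt hy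
    rcases lt_or_gt_of_ne hkl with hlt | hlt
    · exact key k hx (mem k l hlt hy)
    · rw [hsymm]; exact key l hy (mem l k hlt hx)
  obtain _ | i | i := i <;> obtain _ | j | j := j
  · exact absurd rfl hij
  · rw [hsymm]; exact key j (Or.inl hy) (D.b_le_tail _ hx)
  · rw [hsymm]; exact key j (Or.inr hy) (D.b_le_tail _ hx)
  · exact key i (Or.inl hx) (D.b_le_tail _ hy)
  · exact two i j (fun h => hij (by rw [h])) (Or.inl hx) (Or.inl hy)
  · rcases eq_or_ne i j with rfl | h
    · exact D.form_sp_f hinv hx hy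
    · exact two i j h (Or.inl hx) (Or.inr hy)
  · exact key i (Or.inr hx) (D.b_le_tail _ hy)
  · rcases eq_or_ne i j with rfl | h
    · rw [hsymm]; exact D.form_sp_f hinv hy hx
    · exact two i j h (Or.inr hx) (Or.inl hy)
  · exact two i j (fun h => hij (by rw [h])) (Or.inr hx) (Or.inr hy)

end Form

section Center

variable [FiniteDimensional ℝ L] {B : LinearMap.BilinForm ℝ L}
  (hinv : ∀ x y z : L, B ⁅x, y⁆ z = B x ⁅y, z⁆) (hsymm : ∀ x y, B x y = B y x)
  (hneg : ∀ x, x ≠ 0 → B x x < 0)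

/-- The center of `𝔟ₖ`. -/
def tailCenter (k : ℕ) : Submodule ℝ L where
  carrier := {x | x ∈ D.tail k ∧ ∀ y ∈ D.tail k, ⁅x, y⁆ = 0}
  zero_mem' := ⟨Submodule.zero_mem _, fun _ _ => zero_lie _⟩
  add_mem' := fun hx hy => ⟨Submodule.add_mem _ hx.1 hy.1, fun z hz => by
    rw [add_lie, hx.2 z hz, hy.2 z hz, add_zero]⟩
  smul_mem' := fun c _ hx => ⟨Submodule.smul_mem _ c hx.1, fun z hz => by
    rw [smul_lie, hx.2 z hz, smul_zero]⟩

include hinv hsymm hneg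

/-- A central element of the smaller tail commutes with ∂ⱼ; if it also acts trivially on 𝔣ⱼ, it is
central in the larger tail. The latter condition is implied by the vanishing of one linear
functional. -/
theorem finrank_tailCenter_succ (j : Fin n) :
    Module.finrank ℝ (D.tailCenter (j + 1)) ≤ Module.finrank ℝ (D.tailCenter j) + 1 := by
  obtain ⟨φ⟩ := D.sp_equiv j
  have h := D.isQuaternionicTriple j φ
  have hP := D.isTripleTotal j φ
  obtain ⟨g, hg⟩ := h.exists_functional hP hinv hsymm hneg
  have h1 := LinearMap.finrank_range_add_finrank_ker (g.domRestrict (D.tailCenter (j + 1)))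
  have h2 : Module.finrank ℝ (LinearMap.range (g.domRestrict (D.tailCenter (j + 1)))) ≤ 1 :=
    (Submodule.finrank_le _).trans (Module.finrank_self ℝ).le
  have h3 : Submodule.map (D.tailCenter (j + 1)).subtype
      (LinearMap.ker (g.domRestrict (D.tailCenter (j + 1)))) ≤ D.tailCenter j := by
    rintro _ ⟨⟨x, hx⟩, hgx, rfl⟩
    have hgx : g x = 0 := hgx
    refine ⟨hP.Q_le hx.1, fun y hy => ?_⟩
    obtain ⟨c, v, hv, q, hq, rfl⟩ := (hP.mem_iff y).1 hy
    rw [lie_add, lie_add, lie_sum, Submodule.subtype_apply, hg x hx.1 hx.2 hgx v hv, hx.2 q hq,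
      add_zero, add_zero]
    refine Finset.sum_eq_zero fun a _ => ?_
    rw [lie_smul, ← lie_skew, h.comm a x hx.1, neg_zero, smul_zero]
  have h4 := Submodule.finrank_mono h3
  rw [Submodule.finrank_map_subtype_eq] at h4
  omega

theorem finrank_tailCenter_le (hc : LieAlgebra.center ℝ L = ⊥) {k : ℕ} (hk : k ≤ n) :
    Module.finrank ℝ (D.tailCenter k) ≤ k := by
  induction k with
  | zero =>
    have : D.tailCenter 0 = ⊥ := by
      rw [eq_bot_iff]
      rintro x ⟨-, hx⟩
      have : x ∈ LieAlgebra.center ℝ L := by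
        rw [LieModule.mem_maxTrivSubmodule]
        intro y
        rw [← lie_skew, hx y (by rw [D.tail_zero]; trivial), neg_zero]
      rwa [hc] at this
    rw [this, finrank_bot]
  | succ k ih =>
    have := D.finrank_tailCenter_succ hinv hsymm hneg ⟨k, hk⟩
    exact this.trans (Nat.succ_le_succ (ih (Nat.le_of_succ_le hk)))

/-- The last tail is 𝔟, which is abelian and hence its own center. -/
theorem finrank_b_le (hc : LieAlgebra.center ℝ L = ⊥) : Module.finrank ℝ D.b ≤ n := by
  refine (Submodule.finrank_mono ?_).trans (D.finrank_tailCenter_le hinv hsymm hneg hc le_rfl)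
  intro x hx
  refine ⟨D.b_le_tail n hx, fun y hy => D.b_abelian x hx y ?_⟩
  unfold tail at hy
  rwa [joyceTail_eq_b] at hy

end Center

section Rank

variable [FiniteDimensional ℝ L] [LieAlgebra.IsKilling ℝ L] [u.IsCartanSubalgebra]

/-- An element that centralizes a Cartan subalgebra normalizes it. -/
theorem mem_cartan_of_comm {x : L} (hx : ∀ y ∈ u, ⁅x, y⁆ = 0) : x ∈ u := by
  rw [← LieSubalgebra.IsCartanSubalgebra.self_normalizing (R := ℝ) (H := u),
    LieSubalgebra.mem_normalizer_iff]
  intro y hy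
  rw [hx y hy]
  exact u.zero_mem

theorem lie_cartan {x y : L} (hx : x ∈ u) (hy : y ∈ u) : ⁅x, y⁆ = 0 :=
  congrArg Subtype.val (trivial_lie_zero u u ⟨x, hx⟩ ⟨y, hy⟩)

theorem exists_cartan_decomposition {x : L} (hx : x ∈ u) :
    ∃ b₀ ∈ D.b, ∃ s : Fin n → L, (∀ j, s j ∈ D.sp j) ∧ x = b₀ + ∑ j, s j := by
  obtain ⟨b₀, hb, y, hy, rfl⟩ := Submodule.mem_sup.1 (D.cartan_le hx)
  obtain ⟨s, hs, rfl⟩ := (Submodule.mem_iSup_iff_exists_finsupp _ y).1 hy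
  exact ⟨b₀, hb, s, hs, by rw [Finsupp.sum_fintype _ _ fun _ => rfl]⟩

theorem b_le_cartan : D.b ≤ u.toSubmodule := by
  intro x hx
  refine mem_cartan_of_comm fun y hy => ?_
  obtain ⟨b₀, hb, s, hs, rfl⟩ := D.exists_cartan_decomposition hy
  rw [lie_add, D.b_abelian x hx b₀ hb, lie_sum, zero_add]
  exact Finset.sum_eq_zero fun j _ => D.lie_b_sp hx (hs j)

theorem lie_sp_decomposition {j : Fin n} {x b₀ : L} (hx : x ∈ D.sp j) (hb : b₀ ∈ D.b)
    {s : Fin n → L} (hs : ∀ i, s i ∈ D.sp i) : ⁅x, b₀ + ∑ i, s i⁆ = ⁅x, s j⁆ := by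
  rw [lie_add, ← lie_skew, D.lie_b_sp hb hx, neg_zero, zero_add, lie_sum,
    Finset.sum_eq_single j (fun i _ hij => D.lie_sp_sp hij.symm hx (hs i)) (by simp)]

variable (hneg : ∀ x : L, x ≠ 0 → killingForm ℝ L x x < 0)
include hneg

/-- The bracket of two elements of `u` is zero and equals the sum of the brackets of their
components in the ∂ᵢ. These are mutually orthogonal, so each vanishes by definiteness, and every
component centralizes `u`. -/
theorem component_mem_cartan {b₀ : L} (hb : b₀ ∈ D.b) {s : Fin n → L} (hs : ∀ j, s j ∈ D.sp j)
    (hx : b₀ + ∑ j, s j ∈ u) (j : Fin n) : s j ∈ u := by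
  refine mem_cartan_of_comm fun y hy => ?_
  obtain ⟨b₁, hb₁, t, ht, rfl⟩ := D.exists_cartan_decomposition hy
  rw [D.lie_sp_decomposition (hs j) hb₁ ht]
  have h1 := lie_cartan hx hy
  have h2 : ∑ i, ⁅s i, t i⁆ = 0 := by
    rw [add_lie, lie_add, D.b_abelian b₀ hb b₁ hb₁, lie_sum, zero_add,
      Finset.sum_eq_zero (fun i _ => D.lie_b_sp hb (ht i)), zero_add, sum_lie] at h1
    rw [← h1]
    exact Finset.sum_congr rfl fun i _ => (D.lie_sp_decomposition (hs i) hb₁ ht).symm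
  by_contra hne
  refine (hneg _ hne).ne ?_
  have h3 : killingForm ℝ L (∑ i, ⁅s i, t i⁆) ⁅s j, t j⁆ = killingForm ℝ L ⁅s j, t j⁆ ⁅s j, t j⁆ := by
    rw [LinearMap.map_sum₂]
    refine Finset.sum_eq_single j (fun i _ hij => ?_) (by simp)
    exact D.form_summand (B := killingForm ℝ L) (LieModule.traceForm_apply_lie_apply ℝ L L)
      (LieModule.traceForm_comm ℝ L L) (i := Sum.inr (Sum.inl i)) (j := Sum.inr (Sum.inl j))
      (by simpa using hij) ((D.sp i).lie_mem (hs i) (ht i)) ((D.sp j).lie_mem (hs j) (ht j))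
  rw [← h3, h2, map_zero, LinearMap.zero_apply]

/-- If `u` met ∂ⱼ in zero, all ∂ⱼ components of `u` would vanish, so ∂ⱼ would centralize `u` and lie
in it. The intersection is a line because commuting elements of 𝔰𝔭(1) are proportional. -/
theorem exists_cartan_generator (j : Fin n) :
    ∃ t ∈ D.sp j, t ∈ u ∧ t ≠ 0 ∧ ∀ x ∈ D.sp j, x ∈ u → ∃ c : ℝ, x = c • t := by
  obtain ⟨φ⟩ := D.sp_equiv j
  obtain ⟨t, htj, htu, ht0⟩ : ∃ t ∈ D.sp j, t ∈ u ∧ t ≠ 0 := by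
    by_contra! hall
    have h1 : (φ (imUnit 0) : L) ∈ u := by
      refine mem_cartan_of_comm fun y hy => ?_
      obtain ⟨b₀, hb, s, hs, rfl⟩ := D.exists_cartan_decomposition hy
      rw [D.lie_sp_decomposition (φ (imUnit 0)).2 hb hs,
        hall _ (hs j) (D.component_mem_cartan hneg hb hs hy j), lie_zero]
    have h2 := hall _ (φ (imUnit 0)).2 h1
    have h3 : imUnit 0 = 0 := φ.injective ((Subtype.ext h2).trans (map_zero φ).symm)
    have h4 := imUnit_imI 0
    rw [h3] at h4
    simp at h4
  refine ⟨t, htj, htu, ht0, fun x hxj hxu => ?_⟩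
  obtain ⟨p, hp⟩ : ∃ p, φ p = ⟨t, htj⟩ := φ.surjective _
  obtain ⟨q, hq⟩ : ∃ q, φ q = ⟨x, hxj⟩ := φ.surjective _
  have hp0 : p ≠ 0 := by
    rintro rfl
    rw [map_zero] at hp
    exact ht0 (congrArg Subtype.val hp).symm
  have hpq : ⁅p, q⁆ = 0 := by
    have h1 : φ ⁅p, q⁆ = φ 0 := by
      rw [LieEquiv.map_lie, hp, hq, map_zero]
      exact Subtype.ext (lie_cartan htu hxu)
    exact φ.injective h1
  obtain ⟨c, rfl⟩ := sp1_exists_smul_of_lie_eq_zero hp0 hpq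
  refine ⟨c, ?_⟩
  rw [map_smul, hp] at hq
  exact (congrArg Subtype.val hq).symm

/-- The Cartan subalgebra is the sum of 𝔟 and of one line in each ∂ⱼ; orthogonality for the Killing
form makes the sum direct. -/
theorem finrank_cartan : Module.finrank ℝ u = Module.finrank ℝ D.b + n := by
  choose t htj htu ht0 ht using D.exists_cartan_generator hneg
  let Φ : D.b × (Fin n → ℝ) →ₗ[ℝ] L :=
    D.b.subtype.coprod (Fintype.linearCombination ℝ t)
  have hΦ : ∀ b c, Φ (b, c) = b + ∑ j, c j • t j := fun b c => rfl
  have horth := fun {i j : Unit ⊕ Fin n ⊕ Fin n} (hij : i ≠ j) {x y : L} =>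
    D.form_summand (B := killingForm ℝ L) (LieModule.traceForm_apply_lie_apply ℝ L L)
      (LieModule.traceForm_comm ℝ L L) hij (x := x) (y := y)
  have hinj : Function.Injective Φ := by
    rw [← LinearMap.ker_eq_bot, LinearMap.ker_eq_bot']
    rintro ⟨b, c⟩ h0
    rw [hΦ] at h0
    have hc : c = 0 := by
      ext j
      have h1 : killingForm ℝ L (b + ∑ i, c i • t i) (t j) = c j * killingForm ℝ L (t j) (t j) := by
        rw [LinearMap.map_add₂, LinearMap.map_sum₂,
          horth (i := Sum.inl ()) (j := Sum.inr (Sum.inl j)) (by simp) b.2 (htj j), zero_add,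
          Finset.sum_eq_single j]
        · rw [LinearMap.map_smul₂, smul_eq_mul]
        · intro i _ hij
          rw [LinearMap.map_smul₂, horth (i := Sum.inr (Sum.inl i)) (j := Sum.inr (Sum.inl j))
            (by simpa using hij) (htj i) (htj j), smul_zero]
        · simp
      rw [h0, map_zero, LinearMap.zero_apply] at h1
      exact (mul_eq_zero.1 h1.symm).resolve_right (hneg _ (ht0 j)).ne
    rw [hc] at h0
    simp only [Pi.zero_apply, zero_smul, Finset.sum_const_zero, add_zero] at h0
    exact Prod.ext (Subtype.ext h0) hc
  have hrange : LinearMap.range Φ = u.toSubmodule := by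
    apply le_antisymm
    · rintro _ ⟨⟨b, c⟩, rfl⟩
      rw [hΦ]
      exact u.toSubmodule.add_mem (D.b_le_cartan b.2)
        (u.toSubmodule.sum_mem fun j _ => u.smul_mem _ (htu j))
    · intro x hx
      obtain ⟨b₀, hb, s, hs, rfl⟩ := D.exists_cartan_decomposition hx
      choose c hc using fun j => ht j (s j) (hs j) (D.component_mem_cartan hneg hb hs hx j)
      exact ⟨(⟨b₀, hb⟩, c), by rw [hΦ]; simp only [← hc]⟩
  have h1 := LinearMap.finrank_range_of_inj hinj
  rw [hrange, Module.finrank_prod, Module.finrank_fin_fun] at h1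
  exact h1

end Rank

end JoyceDecomposition

end JoyceTail

/-! ### Linear algebra: gluing linear maps, and orthogonal bases of prescribed length -/

theorem DirectSum.IsInternal.exists_linearMap {ι L M : Type*} [DecidableEq ι] [AddCommGroup L]
    [Module ℝ L] [AddCommGroup M] [Module ℝ M] {S : ι → Submodule ℝ L}
    (h : DirectSum.IsInternal S) (f : ∀ i, S i →ₗ[ℝ] M) :
    ∃ F : L →ₗ[ℝ] M, ∀ i (x : S i), F x = f i x := by
  let e : (DirectSum ι fun i => S i) ≃ₗ[ℝ] L :=
    LinearEquiv.ofBijective (DirectSum.coeLinearMap S) h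
  refine ⟨DirectSum.toModule ℝ ι M f ∘ₗ e.symm.toLinearMap, fun i x => ?_⟩
  have h1 : e.symm (x : L) = DirectSum.lof ℝ ι (fun i => S i) i x := by
    rw [LinearEquiv.symm_apply_eq]
    exact (DirectSum.coeLinearMap_lof S i x).symm
  rw [LinearMap.comp_apply, LinearEquiv.coe_coe, h1, DirectSum.toModule_lof]

theorem LinearMap.BilinForm.exists_orthogonal_basis_of_neg {U : Type*} [AddCommGroup U] [Module ℝ U]
    [FiniteDimensional ℝ U] {n : ℕ} (hn : Module.finrank ℝ U = n) (B : LinearMap.BilinForm ℝ U)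
    (hs : ∀ x y, B x y = B y x) (hneg : ∀ x, x ≠ 0 → B x x < 0) (κ : Fin n → ℝ)
    (hκ : ∀ i, κ i < 0) :
    ∃ E : Module.Basis (Fin n) ℝ U, (∀ i, B (E i) (E i) = κ i) ∧
      ∀ i j, i ≠ j → B (E i) (E j) = 0 := by
  subst hn
  obtain ⟨v, hv⟩ := LinearMap.BilinForm.exists_orthogonal_basis (B := B) ⟨fun x y => hs x y⟩
  have hpos : ∀ i, 0 < κ i / B (v i) (v i) := fun i =>
    div_pos_of_neg_of_neg (hκ i) (hneg _ (v.ne_zero i))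
  -- The quotient under the root is positive, being one of two negative numbers.
  refine ⟨v.isUnitSMul (w := fun i => √(κ i / B (v i) (v i)))
    fun i => (Real.sqrt_pos.2 (hpos i)).ne'.isUnit, fun i => ?_, fun i j hij => ?_⟩
  · rw [Module.Basis.isUnitSMul_apply, LinearMap.map_smul₂, map_smul, smul_eq_mul, smul_eq_mul,
      ← mul_assoc, Real.mul_self_sqrt (hpos i).le, div_mul_cancel₀ _ (hneg _ (v.ne_zero i)).ne]
  · rw [Module.Basis.isUnitSMul_apply, Module.Basis.isUnitSMul_apply, LinearMap.map_smul₂, map_smul]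
    have h0 : B (v i) (v j) = 0 := hv hij
    rw [h0, smul_zero, smul_zero]

/-! ### Real and imaginary parts of quaternions -/

section ImaginaryPart

theorem sp1Im_add (p q : ℍ[ℝ]) : sp1Im (p + q) = sp1Im p + sp1Im q :=
  sp1_ext rfl rfl rfl

theorem sp1Im_smul (c : ℝ) (q : ℍ[ℝ]) : sp1Im (c • q) = c • sp1Im q :=
  sp1_ext rfl rfl rfl

theorem sp1Im_coe (p : sp1) : sp1Im (p : ℍ[ℝ]) = p := sp1_ext rfl rfl rfl

theorem sp1Im_one : sp1Im 1 = 0 := sp1_ext rfl rfl rfl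

theorem quaternion_eq_smul_one_add (q : ℍ[ℝ]) : q = q.re • 1 + (sp1Im q : ℍ[ℝ]) :=
  QuaternionAlgebra.ext (show q.re = q.re * 1 + 0 by ring)
    (show q.imI = q.re * 0 + q.imI by ring) (show q.imJ = q.re * 0 + q.imJ by ring)
    (show q.imK = q.re * 0 + q.imK by ring)

theorem imUnit_mul_self (a : Fin 3) : (imUnit a : ℍ[ℝ]) * imUnit a = (-1 : ℝ) • 1 := by
  fin_cases a <;> ext <;> simp [sp1_re, imUnit_imI, imUnit_imJ, imUnit_imK]

theorem imUnit_mul_succ (a : Fin 3) : (imUnit a : ℍ[ℝ]) * imUnit (a + 1) = imUnit (a + 2) := by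
  fin_cases a <;> ext <;> simp [sp1_re, imUnit_imI, imUnit_imJ, imUnit_imK]

theorem imUnit_mul_two (a : Fin 3) :
    (imUnit a : ℍ[ℝ]) * imUnit (a + 2) = (-1 : ℝ) • imUnit (a + 1) := by
  fin_cases a <;> ext <;> simp [sp1_re, imUnit_imI, imUnit_imJ, imUnit_imK]

end ImaginaryPart

/-! ### The extended Lie algebra 𝔱 ⊕ 𝔤 -/

section Extension

variable {L : Type*} [LieRing L] [LieAlgebra ℝ L] {n : ℕ} {u : LieSubalgebra ℝ L}
  (D : JoyceDecomposition u n) {V : Type*} [LieRing V] [LieAlgebra ℝ V]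
  (φ : ∀ j, sp1 ≃ₗ⁅ℝ⁆ D.sp j) (E : Module.Basis (Fin n) ℝ (D.euclid V))

theorem quatEmbed_add (j : Fin n) (p q : ℍ[ℝ]) :
    quatEmbed D φ E j (p + q) = quatEmbed D φ E j p + quatEmbed D φ E j q := by
  have h : (φ j (sp1Im (p + q)) : L) = φ j (sp1Im p) + φ j (sp1Im q) := by
    rw [sp1Im_add, map_add]; rfl
  unfold quatEmbed
  rw [h, Quaternion.re_add, add_smul, ← add_zero (0 : V), ← Prod.mk_add_mk, add_zero]
  abel

theorem quatEmbed_smul (j : Fin n) (c : ℝ) (q : ℍ[ℝ]) :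
    quatEmbed D φ E j (c • q) = c • quatEmbed D φ E j q := by
  have h : (φ j (sp1Im (c • q)) : L) = c • (φ j (sp1Im q) : L) := by
    rw [sp1Im_smul, map_smul]; rfl
  have h' : ((0 : V), c • (φ j (sp1Im q) : L)) = c • (0, (φ j (sp1Im q) : L)) :=
    Prod.ext (smul_zero c).symm rfl
  unfold quatEmbed
  rw [h, h', smul_add, smul_smul]
  rfl

theorem quatEmbed_one (j : Fin n) : quatEmbed D φ E j 1 = E j := by
  have h : (φ j 0 : L) = 0 := by rw [map_zero]; rfl
  unfold quatEmbed
  rw [sp1Im_one, h, Quaternion.re_one, one_smul, ← Prod.zero_eq_mk, add_zero]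

theorem quatEmbed_coe (j : Fin n) (p : sp1) : quatEmbed D φ E j p = (0, (φ j p : L)) := by
  unfold quatEmbed
  rw [sp1Im_coe, sp1_re, zero_smul, zero_add]

theorem quatEmbed_imUnit (j : Fin n) (a : Fin 3) :
    quatEmbed D φ E j (imUnit a) = (0, unitImage (φ j) a) := quatEmbed_coe D φ E j _

theorem isJoyceEnd_of_isJoyceHypercomplex {A : Fin 3 → Module.End ℝ (V × L)}
    (hA : IsJoyceHypercomplex D φ E A) (a : Fin 3) :
    IsJoyceEnd (fun j b => ((0 : V), unitImage (φ j) b)) (fun j => (E j : V × L))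
      (fun j => (⊥ : Submodule ℝ V).prod (D.f j)) a (A a) where
  on_E j := by
    rw [← quatEmbed_one D φ E, hA.on_quat, mul_one, quatEmbed_imUnit]
  on_self j := by
    rw [← quatEmbed_imUnit D φ E, hA.on_quat, imUnit_mul_self, quatEmbed_smul, quatEmbed_one,
      neg_one_smul]
  on_succ j := by
    rw [← quatEmbed_imUnit D φ E, hA.on_quat, imUnit_mul_succ, quatEmbed_imUnit]
  on_two j := by
    rw [← quatEmbed_imUnit D φ E, hA.on_quat, imUnit_mul_two, quatEmbed_smul, quatEmbed_imUnit,
      neg_one_smul]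
  on_F j v hv := by
    obtain ⟨v₁, v₂⟩ := v
    obtain rfl : v₁ = 0 := hv.1
    rw [hA.on_f a j v₂ hv.2]
    exact Prod.ext (lie_zero _).symm rfl

/-- Joyce's endomorphisms exist for every choice of a basis of `ℝⁿ`. -/
theorem exists_isJoyceHypercomplex : ∃ A, IsJoyceHypercomplex D φ E A := by
  have key : ∀ a : Fin 3, ∃ A : Module.End ℝ (V × L), (∀ j, A (E j) = (0, unitImage (φ j) a)) ∧
      (∀ (j : Fin n) (p : sp1), A (0, (φ j p : L)) = quatEmbed D φ E j ((imUnit a : ℍ[ℝ]) * p)) ∧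
      ∀ (j : Fin n), ∀ v ∈ D.f j, A ((0 : V), v) = ((0 : V), ⁅(φ j (imUnit a) : L), v⁆) := by
    intro a
    -- The map prescribed on ℝⁿ is split into its parts on `V` and on 𝔟, because the direct sum
    -- decomposition available for gluing is that of `L`.
    let C : D.euclid V →ₗ[ℝ] V × L := E.constr ℝ fun j => ((0 : V), unitImage (φ j) a)
    let C₁ : V →ₗ[ℝ] V × L := C ∘ₗ LinearMap.codRestrict (D.euclid V) (LinearMap.inl ℝ V L)
      fun v => ⟨trivial, D.b.zero_mem⟩
    let C₂ : D.b →ₗ[ℝ] V × L := C ∘ₗ LinearMap.codRestrict (D.euclid V)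
      (LinearMap.inr ℝ V L ∘ₗ D.b.subtype) fun b => ⟨trivial, b.2⟩
    let M (j : Fin n) : D.sp j →ₗ[ℝ] V × L :=
      { toFun := fun x => quatEmbed D φ E j ((imUnit a : ℍ[ℝ]) * ((φ j).symm x : sp1))
        map_add' := fun x y => by
          rw [← quatEmbed_add, ← mul_add, map_add]; rfl
        map_smul' := fun c x => by
          rw [RingHom.id_apply, ← quatEmbed_smul, ← mul_smul_comm, map_smul]; rfl }
    obtain ⟨F, hF⟩ := D.isInternal.exists_linearMap (M := V × L) (fun i => match i with
      | Sum.inl _ => C₂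
      | Sum.inr (Sum.inl j) => M j
      | Sum.inr (Sum.inr j) => LinearMap.inr ℝ V L ∘ₗ
          (LieAlgebra.ad ℝ L (φ j (imUnit a) : L)) ∘ₗ (D.f j).subtype)
    refine ⟨C₁.coprod F, fun j => ?_, fun j p => ?_, fun j v hv => ?_⟩
    · have h1 : F (E j : V × L).2 = C₂ ⟨(E j : V × L).2, (E j).2.2⟩ :=
        hF (Sum.inl ()) ⟨(E j : V × L).2, (E j).2.2⟩
      have h2 : C (E j) = ((0 : V), unitImage (φ j) a) := E.constr_basis ℝ _ j
      rw [LinearMap.coprod_apply, h1, ← h2]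
      change C _ + C _ = _
      rw [← map_add]
      congr 1
      exact Subtype.ext (Prod.ext (add_zero _) (zero_add _))
    · have h1 : F (φ j p : L) = M j (φ j p) := hF (Sum.inr (Sum.inl j)) (φ j p)
      rw [LinearMap.coprod_apply, map_zero, zero_add, h1]
      change quatEmbed D φ E j ((imUnit a : ℍ[ℝ]) * ((φ j).symm (φ j p) : sp1)) = _
      rw [LieEquiv.symm_apply_apply]
    · have h1 : F v = ((0 : V), ⁅(φ j (imUnit a) : L), v⁆) := hF (Sum.inr (Sum.inr j)) ⟨v, hv⟩
      rw [LinearMap.coprod_apply, map_zero, zero_add, h1]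
  choose A hE hsp hf using key
  refine ⟨A, fun a j q => ?_, hf⟩
  rw [quaternion_eq_smul_one_add q, quatEmbed_add, quatEmbed_smul, map_add, map_smul,
    quatEmbed_one, quatEmbed_coe, hE, hsp, mul_add, quatEmbed_add, mul_smul_comm, mul_one,
    quatEmbed_smul, quatEmbed_imUnit]

/-- The abelian summand `V` is central, so adding it to every tail preserves all relations of the
decomposition of `L`. -/
theorem isJoyceFrame_extension (hV : ∀ x y : V, ⁅x, y⁆ = 0) :
    IsJoyceFrame (fun j b => ((0 : V), unitImage (φ j) b)) (fun j => (E j : V × L))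
      (fun j => (⊥ : Submodule ℝ V).prod (D.f j))
      (fun j => (⊤ : Submodule ℝ V).prod (D.tail (j + 1))) where
  triple j := by
    have t := D.isQuaternionicTriple j (φ j)
    refine ⟨fun a => ?_, fun a v hv => ⟨?_, t.lie_mem a _ hv.2⟩, fun a v hv => ?_, fun a v hv => ?_,
      fun a q hq => ?_⟩
    · exact Prod.ext ((lie_zero _).trans (smul_zero _).symm) (t.lie_succ a)
    · exact zero_lie _
    · have h1 : v.1 = 0 := hv.1
      exact Prod.ext ((zero_lie _).trans (by rw [Prod.fst_neg, h1, neg_zero])) (t.sq a _ hv.2)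
    · exact Prod.ext ((zero_lie _).trans (zero_lie _).symm) (t.mul a _ hv.2)
    · exact Prod.ext (zero_lie _) (t.comm a _ hq.2)
  E_mem i j := ⟨trivial, D.b_le_tail _ (E i).2.2⟩
  e_mem i j hij a := ⟨trivial, sp_le_joyceTail _ _ _ hij (φ i (imUnit a)).2⟩
  F_le i j hij v hv := ⟨trivial, f_le_joyceTail _ _ _ hij hv.2⟩
  lie_Q_F j q hq v hv := by
    refine ⟨hV _ _, ?_⟩
    exact (D.isQuaternionicTriple j (φ j)).lie_Q_F_mem (D.isTripleTotal j (φ j)) hq.2 hv.2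
  lie_F_F j v hv w hw := by
    obtain ⟨c, q, hq, h⟩ := (D.isQuaternionicTriple j (φ j)).lie_F_F (D.isTripleTotal j (φ j))
      hv.2 hw.2
    refine ⟨c, (0, q), ⟨trivial, hq⟩, Prod.ext ((hV _ _).trans ?_) (h.trans ?_)⟩
    · simp [Prod.fst_sum]
    · simp [Prod.snd_sum]
  E_comm i j := Prod.ext (hV _ _) (D.b_abelian _ (E i).2.2 _ (E j).2.2)
  span_eq_top P hE he hF := by
    have h1 : D.euclid V ≤ P := by
      intro x hx
      have h2 := congrArg (D.euclid V).subtype (E.sum_repr ⟨x, hx⟩)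
      rw [map_sum] at h2
      change _ = x at h2
      rw [← h2]
      exact P.sum_mem fun i _ => by
        rw [map_smul]
        exact P.smul_mem _ (hE i)
    have h3 : P.comap (LinearMap.inr ℝ V L) = ⊤ := by
      rw [eq_top_iff, ← D.iSup_summand]
      refine iSup_le ?_
      rintro (_ | j | j) x hx
      · exact h1 ⟨trivial, hx⟩
      · obtain ⟨c, rfl⟩ := (exists_sum_unitImage (φ j)).1 hx
        exact Submodule.sum_mem _ fun a _ => Submodule.smul_mem _ _ (he j a)
      · exact hF j ⟨rfl, hx⟩
    rw [eq_top_iff]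
    rintro ⟨v, x⟩ -
    have h4 : (v, x) = (v, (0 : L)) + LinearMap.inr ℝ V L x := by simp
    rw [h4]
    refine P.add_mem (h1 ⟨trivial, D.b.zero_mem⟩) ?_
    have : x ∈ P.comap (LinearMap.inr ℝ V L) := by rw [h3]; trivial
    exact this

/-- The orthogonal sum of the form `K` on `L` and of the negative of the form `h` on `V`. -/
noncomputable def extensionForm (h : LinearMap.BilinForm ℝ V) (K : LinearMap.BilinForm ℝ L) :
    LinearMap.BilinForm ℝ (V × L) :=
  K.comp (LinearMap.snd ℝ V L) (LinearMap.snd ℝ V L) -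
    h.comp (LinearMap.fst ℝ V L) (LinearMap.fst ℝ V L)

theorem extensionForm_apply (h : LinearMap.BilinForm ℝ V) (K : LinearMap.BilinForm ℝ L)
    (x y : V × L) : extensionForm h K x y = K x.2 y.2 - h x.1 y.1 := rfl

variable {h : LinearMap.BilinForm ℝ V} (hs : ∀ x y, h x y = h y x) (hpos : ∀ x, x ≠ 0 → 0 < h x x)
include hs hpos

theorem extensionForm_neg {K : LinearMap.BilinForm ℝ L} (hK : ∀ x, x ≠ 0 → K x x < 0) (x : V × L)
    (hx : x ≠ 0) : extensionForm h K x x < 0 := by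
  rw [extensionForm_apply]
  rcases eq_or_ne x.1 0 with h1 | h1
  · have h2 : x.2 ≠ 0 := fun h2 => hx (Prod.ext h1 h2)
    rw [h1, map_zero, sub_zero]
    exact hK _ h2
  · have h3 := hpos _ h1
    rcases eq_or_ne x.2 0 with h2 | h2
    · rw [h2, map_zero, zero_sub]; linarith
    · have := hK _ h2; linarith

theorem exists_extendedKillingForm [FiniteDimensional ℝ L] [FiniteDimensional ℝ V]
    (hV : ∀ x y : V, ⁅x, y⁆ = 0) (hK : ∀ x : L, x ≠ 0 → killingForm ℝ L x x < 0)
    (hn : Module.finrank ℝ V + Module.finrank ℝ D.b = n) :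
    ∃ (E : Module.Basis (Fin n) ℝ (D.euclid V)) (A : Fin 3 → Module.End ℝ (V × L)),
      IsJoyceHypercomplex D φ E A ∧
      IsExtendedKillingForm D A (extensionForm h (killingForm ℝ L)) ∧
      (∀ a x, A a (A a x) = -x) ∧ (∀ x, A 0 (A 1 x) = A 2 x) ∧ (∀ x, A 1 (A 0 x) = -A 2 x) ∧
      ∀ a x y, ⁅A a x, A a y⁆ - ⁅x, y⁆ - A a ⁅A a x, y⁆ - A a ⁅x, A a y⁆ = 0 := by
  set B := extensionForm h (killingForm ℝ L) with hB
  have hsymm : ∀ x y, B x y = B y x := fun x y => by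
    rw [hB, extensionForm_apply, extensionForm_apply, hs, LieModule.traceForm_comm]
  have hneg : ∀ x, x ≠ 0 → B x x < 0 := extensionForm_neg hs hpos hK
  have hinv : ∀ x y z : V × L, B ⁅x, y⁆ z = B x ⁅y, z⁆ := fun x y z => by
    -- Brackets have no `V` component, so any form on `V` is compatible with invariance.
    have h1 : (⁅x, y⁆ : V × L).1 = 0 := hV _ _
    have h2 : (⁅y, z⁆ : V × L).1 = 0 := hV _ _
    rw [hB, extensionForm_apply, extensionForm_apply, h1, h2, map_zero, map_zero,
      LinearMap.zero_apply]
    exact congrArg (· - 0) (LieModule.traceForm_apply_lie_apply ℝ L L x.2 y.2 z.2)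
  have hfin : Module.finrank ℝ (D.euclid V) = n := by
    refine Eq.trans ?_ hn
    let e : (D.euclid V) ≃ₗ[ℝ] V × D.b :=
      { toFun := fun x => (x.1.1, ⟨x.1.2, x.2.2⟩)
        invFun := fun p => ⟨(p.1, p.2), trivial, p.2.2⟩
        map_add' := fun _ _ => rfl
        map_smul' := fun _ _ => rfl
        left_inv := fun _ => rfl
        right_inv := fun _ => rfl }
    rw [e.finrank_eq, Module.finrank_prod]
  have hne : ∀ j, ((0 : V), unitImage (φ j) 0) ≠ 0 := by
    intro j h0
    have h1 : (φ j (imUnit 0) : L) = 0 := congrArg Prod.snd h0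
    have h3 : imUnit 0 = 0 := (φ j).injective ((Subtype.ext h1).trans (map_zero (φ j)).symm)
    have h4 := imUnit_imI 0
    rw [h3] at h4
    simp at h4
  -- The prescribed value at `E j` is that of the form at `φⱼ(i)`; this normalization is what makes
  -- the left multiplications on ℍ isometric.
  obtain ⟨E, hE, hEE⟩ := LinearMap.BilinForm.exists_orthogonal_basis_of_neg hfin
    (B.restrict (D.euclid V)) (fun x y => hsymm x y)
    (fun x hx => hneg x (fun h0 => hx (Subtype.ext h0))) _ (fun j => hneg _ (hne j))
  obtain ⟨A, hA⟩ := exists_isJoyceHypercomplex D φ E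
  have hF := isJoyceFrame_extension D φ E hV
  have hAE := isJoyceEnd_of_isJoyceHypercomplex D φ E hA
  refine ⟨E, A, hA, ⟨hsymm, hneg, fun x y => ?_, fun a x y => ?_, fun i j hij x hx y hy => ?_, hinv⟩,
    fun a => (hAE a).sq hF, hF.end_mul hAE, hF.end_anticomm hAE,
    fun a => (hAE a).nijenhuis_eq_zero hF hinv hneg⟩
  · rw [hB, extensionForm_apply, map_zero, sub_zero]
  · exact (hAE a).form_hermitian hF hinv hsymm hE hEE x y
  · have h1 : killingForm ℝ L x.2 y.2 = 0 := by
      refine D.form_summand (LieModule.traceForm_apply_lie_apply ℝ L L)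
        (LieModule.traceForm_comm ℝ L L) hij ?_ ?_
      · obtain _ | i | i := i <;> exact hx.2
      · obtain _ | j | j := j <;> exact hy.2
    have h2 : x.1 = 0 ∨ y.1 = 0 := by
      obtain _ | i | i := i
      · obtain _ | j | j := j
        · exact absurd rfl hij
        · exact Or.inr hy.1
        · exact Or.inr hy.1
      · exact Or.inl hx.1
      · exact Or.inl hx.1
    rw [hB, extensionForm_apply, h1, zero_sub, neg_eq_zero]
    rcases h2 with h2 | h2
    · rw [h2, map_zero, LinearMap.zero_apply]
    · rw [h2, map_zero]

end Extension

/-! ### From the Lie algebra to the product group -/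

section ProductGroup

variable {E₁ E₂ H₁ H₂ : Type*} [NormedAddCommGroup E₁] [NormedSpace ℝ E₁] [CompleteSpace E₁]
  [FiniteDimensional ℝ E₁] [NormedAddCommGroup E₂] [NormedSpace ℝ E₂] [CompleteSpace E₂]
  [FiniteDimensional ℝ E₂] [TopologicalSpace H₁] [TopologicalSpace H₂]
  {I₁ : ModelWithCorners ℝ E₁ H₁} {I₂ : ModelWithCorners ℝ E₂ H₂}
  [I₁.Boundaryless] [I₂.Boundaryless]
  {G₁ G₂ : Type*} [TopologicalSpace G₁] [ChartedSpace H₁ G₁] [Group G₁] [LieGroup I₁ ∞ G₁]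
  [TopologicalSpace G₂] [ChartedSpace H₂ G₂] [Group G₂] [LieGroup I₂ ∞ G₂]

theorem prodLeftField_eq_leftTrans (v : E₁ × E₂) (p : G₁ × G₂) :
    prodLeftField I₁ I₂ v p = leftTrans (I₁.prod I₂) p v := by
  have h1 : ∀ x : E₁, id (α := E₁ × E₂)
      (mfderiv I₁ (I₁.prod I₂) (fun x : G₁ => (x, (1 : G₂))) 1 x) = (x, 0) := fun x =>
    congrArg (fun A : E₁ →L[ℝ] E₁ × E₂ => A x)
      (mfderiv_prod_left (I := I₁) (I' := I₂) (x₀ := (1 : G₁)) (y₀ := (1 : G₂)))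
  have h2 : ∀ y : E₂, id (α := E₁ × E₂)
      (mfderiv I₂ (I₁.prod I₂) (fun y : G₂ => ((1 : G₁), y)) 1 y) = (0, y) := fun y =>
    congrArg (fun A : E₂ →L[ℝ] E₁ × E₂ => A y)
      (mfderiv_prod_right (I := I₁) (I' := I₂) (x₀ := (1 : G₁)) (y₀ := (1 : G₂)))
  have h3 : id (α := E₁ × E₂) (mfderiv I₁ (I₁.prod I₂) (fun x : G₁ => (x, (1 : G₂))) 1 v.1) +
      id (α := E₁ × E₂) (mfderiv I₂ (I₁.prod I₂) (fun y : G₂ => ((1 : G₁), y)) 1 v.2) = v := by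
    rw [h1, h2, Prod.mk_add_mk, add_zero, zero_add]
  exact congrArg (fun w : E₁ × E₂ => leftTrans (I₁.prod I₂) p w) h3

/-- The left-invariant hyper-Hermitian structure on a product of two Lie groups, and its
left-invariant connection. -/
theorem exists_leftInvariant_hkt
    (A : Fin 3 → Module.End ℝ (GroupLieAlgebra I₁ G₁ × GroupLieAlgebra I₂ G₂))
    (B : LinearMap.BilinForm ℝ (GroupLieAlgebra I₁ G₁ × GroupLieAlgebra I₂ G₂))
    (hs : ∀ x y, B x y = B y x) (hneg : ∀ x, x ≠ 0 → B x x < 0)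
    (hinv : ∀ x y z : GroupLieAlgebra I₁ G₁ × GroupLieAlgebra I₂ G₂, B ⁅x, y⁆ z = B x ⁅y, z⁆)
    (hAd : ∀ (p : G₁ × G₂) (x y : E₁ × E₂),
      B (adInv I₁ p.1 x.1, adInv I₂ p.2 x.2) (adInv I₁ p.1 y.1, adInv I₂ p.2 y.2) = B x y)
    (hherm : ∀ a x y, B (A a x) (A a y) = B x y) (hsq : ∀ a x, A a (A a x) = -x)
    (hmul : ∀ x, A 0 (A 1 x) = A 2 x) (hanti : ∀ x, A 1 (A 0 x) = -A 2 x)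
    (hN : ∀ a x y, ⁅A a x, A a y⁆ - ⁅x, y⁆ - A a ⁅A a x, y⁆ - A a ⁅x, A a y⁆ = 0) :
    ∃ (g : Bundle.ContMDiffRiemannianMetric (I₁.prod I₂) ∞ (E₁ × E₂)
        (TangentSpace (I₁.prod I₂) : G₁ × G₂ → Type _))
      (J : Fin 3 → Π p : G₁ × G₂, TangentSpace (I₁.prod I₂) p →L[ℝ] TangentSpace (I₁.prod I₂) p),
      (∀ p v w, g.inner p (prodLeftField I₁ I₂ v p) (prodLeftField I₁ I₂ w p) = -B v w) ∧
      (∀ a p v, J a p (prodLeftField I₁ I₂ v p) = prodLeftField I₁ I₂ (A a v) p) ∧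
      IsBiInvariantMetric (I₁.prod I₂) g ∧
      IsHyperHermitian (I₁.prod I₂) g J ∧
      (∃ N : CovariantDerivative (I₁.prod I₂) (E₁ × E₂)
          (TangentSpace (I₁.prod I₂) : G₁ × G₂ → Type _),
        IsLeftInvariantConnection (I₁.prod I₂) N) ∧
      ∀ N : CovariantDerivative (I₁.prod I₂) (E₁ × E₂)
          (TangentSpace (I₁.prod I₂) : G₁ × G₂ → Type _),
        IsLeftInvariantConnection (I₁.prod I₂) N →
        IsFlatConnection (I₁.prod I₂) N ∧ IsHKTConnection (I₁.prod I₂) g J N := by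
  let B₀ : (E₁ × E₂) →ₗ[ℝ] (E₁ × E₂) →ₗ[ℝ] ℝ := -B
  let B' : (E₁ × E₂) →L[ℝ] (E₁ × E₂) →L[ℝ] ℝ := LinearMap.toContinuousLinearMap
    ((LinearMap.toContinuousLinearMap (𝕜 := ℝ) (E := E₁ × E₂) (F' := ℝ)).toLinearMap ∘ₗ B₀)
  let A' (a : Fin 3) : (E₁ × E₂) →L[ℝ] (E₁ × E₂) :=
    LinearMap.toContinuousLinearMap (E := E₁ × E₂) (F' := E₁ × E₂) (A a)
  have hs' : ∀ v w, B' v w = B' w v := fun v w => congrArg Neg.neg (hs v w)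
  have hpos : ∀ v, v ≠ 0 → 0 < B' v v := fun v hv => neg_pos.2 (hneg v hv)
  -- `br` is the componentwise bracket of the product Lie algebra, read in the model space; it
  -- agrees with the bracket of left-invariant fields on the product group.
  let br (v w : E₁ × E₂) : E₁ × E₂ :=
    Bracket.bracket (L := GroupLieAlgebra I₁ G₁ × GroupLieAlgebra I₂ G₂)
      (M := GroupLieAlgebra I₁ G₁ × GroupLieAlgebra I₂ G₂) v w
  have hbr : ∀ v w : E₁ × E₂, bracketE (I₁.prod I₂) (G₁ × G₂) v w = br v w :=
    fun v w => bracketE_prod v w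
  refine ⟨leftMetric (I₁.prod I₂) (G₁ × G₂) B' hs' hpos, fun a => leftEnd (I₁.prod I₂) (A' a),
    fun p v w => ?_, fun a p v => ?_, ?_, ?_, ⟨_, isLeftInvariantConnection_leftConnection⟩,
    fun N hL => ⟨isFlatConnection_of_isLeftInvariant hL, ?_⟩⟩
  · refine (leftMetric_inner B' hs' hpos p _ _).trans ?_
    have h : ∀ v : E₁ × E₂, id (α := E₁ × E₂) (mcForm (I₁.prod I₂) p (prodLeftField I₁ I₂ v p)) = v :=
      fun v => (congrArg (fun w => id (α := E₁ × E₂) (mcForm (I₁.prod I₂) p w))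
        (prodLeftField_eq_leftTrans v p)).trans (mcForm_leftTrans p v)
    exact congrArg₂ (fun x y : E₁ × E₂ => B' x y) (h v) (h w)
  · refine (congrArg (leftEnd (I₁.prod I₂) (A' a) p) (prodLeftField_eq_leftTrans (E₁ := E₁)
      (E₂ := E₂) v p)).trans ?_
    refine (leftEnd_leftTrans (A' a) p v).trans ?_
    exact (prodLeftField_eq_leftTrans (E₁ := E₁) (E₂ := E₂) (A a v) p).symm
  · refine isBiInvariantMetric_leftMetric B' hs' hpos fun p v w => ?_
    rw [adInv_prod, adInv_prod]
    exact congrArg Neg.neg (hAd p v w)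
  · refine isHyperHermitian_left B' hs' hpos A' hsq hmul hanti
      (fun a v w => congrArg Neg.neg (hherm a v w)) fun a v w => ?_
    rw [hbr, hbr, hbr, hbr]
    exact hN a v w
  · refine isHKTConnection_of_isLeftInvariant hL B' hs' hpos A' fun x y z => ?_
    rw [hbr, hbr]
    exact congrArg Neg.neg (hinv x y z)

end ProductGroup

theorem mainTheorem10 {d : ℕ} {G : Type*} [TopologicalSpace G] [T2Space G] [CompactSpace G]
    [ChartedSpace (EuclideanSpace ℝ (Fin d)) G] [Group G] [LieGroup (𝓡 d) ∞ G]
    [LieAlgebra.IsSemisimple ℝ (GroupLieAlgebra (𝓡 d) G)]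
    (u : LieSubalgebra ℝ (GroupLieAlgebra (𝓡 d) G)) [u.IsCartanSubalgebra]
    (r : ℕ) (hr : r = Module.finrank ℝ u)
    {n : ℕ} (D : JoyceDecomposition u n) :
    (∀ i j, i ≠ j → ∀ x ∈ D.summand i, ∀ y ∈ D.summand j,
      killingForm ℝ (GroupLieAlgebra (𝓡 d) G) x y = 0) ∧
    r ≤ 2 * n ∧
    ∀ (m : ℕ) (_ : m + r = 2 * n) (T : Type*) [TopologicalSpace T] [T2Space T] [CompactSpace T]
      [ConnectedSpace T] [ChartedSpace (EuclideanSpace ℝ (Fin m)) T] [CommGroup T] [LieGroup (𝓡 m) ∞ T]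
      (φ : ∀ j, sp1 ≃ₗ⁅ℝ⁆ D.sp j),
      ∃ (E : Module.Basis (Fin n) ℝ (D.euclid (GroupLieAlgebra (𝓡 m) T)))
        (A : Fin 3 → Module.End ℝ (GroupLieAlgebra (𝓡 m) T × GroupLieAlgebra (𝓡 d) G))
        (B : LinearMap.BilinForm ℝ (GroupLieAlgebra (𝓡 m) T × GroupLieAlgebra (𝓡 d) G)),
        IsJoyceHypercomplex D φ E A ∧
        IsExtendedKillingForm D A B ∧
        ∃ (g : Bundle.ContMDiffRiemannianMetric ((𝓡 m).prod (𝓡 d)) ∞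
            (EuclideanSpace ℝ (Fin m) × EuclideanSpace ℝ (Fin d))
            (TangentSpace ((𝓡 m).prod (𝓡 d)) : T × G → Type _))
          (J : Fin 3 → Π p : T × G, TangentSpace ((𝓡 m).prod (𝓡 d)) p →L[ℝ]
            TangentSpace ((𝓡 m).prod (𝓡 d)) p),
          (∀ p v w, g.inner p (prodLeftField (𝓡 m) (𝓡 d) v p)
            (prodLeftField (𝓡 m) (𝓡 d) w p) = -B v w) ∧
          (∀ a p v, J a p (prodLeftField (𝓡 m) (𝓡 d) v p) =
            prodLeftField (𝓡 m) (𝓡 d) (A a v) p) ∧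
          IsBiInvariantMetric ((𝓡 m).prod (𝓡 d)) g ∧
          IsHyperHermitian ((𝓡 m).prod (𝓡 d)) g J ∧
          (∃ N : CovariantDerivative ((𝓡 m).prod (𝓡 d))
              (EuclideanSpace ℝ (Fin m) × EuclideanSpace ℝ (Fin d))
              (TangentSpace ((𝓡 m).prod (𝓡 d)) : T × G → Type _),
            IsLeftInvariantConnection ((𝓡 m).prod (𝓡 d)) N) ∧
          ∀ N : CovariantDerivative ((𝓡 m).prod (𝓡 d))
              (EuclideanSpace ℝ (Fin m) × EuclideanSpace ℝ (Fin d))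
              (TangentSpace ((𝓡 m).prod (𝓡 d)) : T × G → Type _),
            IsLeftInvariantConnection ((𝓡 m).prod (𝓡 d)) N →
            IsFlatConnection ((𝓡 m).prod (𝓡 d)) N ∧
            IsHKTConnection ((𝓡 m).prod (𝓡 d)) g J N := by
  have : FiniteDimensional ℝ (GroupLieAlgebra (𝓡 d) G) :=
    inferInstanceAs (FiniteDimensional ℝ (EuclideanSpace ℝ (Fin d)))
  have hc : LieAlgebra.center ℝ (GroupLieAlgebra (𝓡 d) G) = ⊥ := LieAlgebra.center_eq_bot _ _
  have hK : ∀ x : GroupLieAlgebra (𝓡 d) G, x ≠ 0 →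
      killingForm ℝ (GroupLieAlgebra (𝓡 d) G) x x < 0 := fun x hx =>
    killingForm_neg_of_compact hc hx
  have hinv := LieModule.traceForm_apply_lie_apply ℝ (GroupLieAlgebra (𝓡 d) G)
    (GroupLieAlgebra (𝓡 d) G)
  have hsymm := LieModule.traceForm_comm ℝ (GroupLieAlgebra (𝓡 d) G) (GroupLieAlgebra (𝓡 d) G)
  have hu := D.finrank_cartan hK
  have hb := D.finrank_b_le hinv hsymm hK hc
  refine ⟨fun i j hij x hx y hy => D.form_summand hinv hsymm hij hx hy, by omega, ?_⟩
  intro m hm T _ _ _ _ _ _ _ φ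
  have : FiniteDimensional ℝ (GroupLieAlgebra (𝓡 m) T) :=
    inferInstanceAs (FiniteDimensional ℝ (EuclideanSpace ℝ (Fin m)))
  -- Any scalar product on 𝔱 serves here: Ad is trivial on a commutative group, so invariance is
  -- automatic.
  obtain ⟨h, hs, hpos, -⟩ := exists_invariant_inner (I := 𝓡 m) (K := T)
  have hV : ∀ x y : GroupLieAlgebra (𝓡 m) T, ⁅x, y⁆ = 0 := fun x y =>
    bracketE_eq_zero_of_comm (I := 𝓡 m) (T := T) x y
  have hdim : Module.finrank ℝ (GroupLieAlgebra (𝓡 m) T) = m := finrank_euclideanSpace_fin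
  -- The dimensions match because dim 𝔱 = 2n - r and dim 𝔟 = r - n.
  obtain ⟨E, A, hA, hB, hsq, hmul, hanti, hN⟩ := exists_extendedKillingForm D φ
    (V := GroupLieAlgebra (𝓡 m) T) (h := h) hs hpos hV hK (by omega)
  refine ⟨E, A, _, hA, hB, exists_leftInvariant_hkt A _ hB.symm hB.neg_def hB.invariant ?_
    hB.hermitian hsq hmul hanti hN⟩
  intro p x y
  exact congrArg₂ (· - ·) (killingForm_adInv p.2 x.2 y.2) (congrArg₂
    (fun v w : EuclideanSpace ℝ (Fin m) => h v w) (adInv_of_comm p.1 x.1) (adInv_of_comm p.1 y.1))
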